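/- Fix $d\ge 1$, $\alpha,\lambda,c>0$ and $\tau>1$ such that $\gamma:=\alpha(\tau-1)/d$ satisfies $1<\gamma<2$, and let $W$ be a real random variable with $$\mathbb P(W\ge w)\ \ge\ \min\{c\,w^{-(\tau-1)},1\}\qquad\text{for all } w>0 .$$ Scale-free percolation (SFP) is the random graph on $\mathbb Z^d$ obtained as follows: the vertices $x\in\mathbb Z^d$ carry i.i.d. weights $W_x$ with the law of $W$ and, conditionally on the weights, every edge $\{x,y\}$ with $x\neq y$ is present (open) independently of all others with probability $1-\exp(-\lambda W_xW_y/\|x-y\|_1^{\alpha})$. For $m\ge 1$ and $x\in\mathbb Z^d$ let $Q_m(x)=x+\{0,\dots,m-1\}^d$. Let $0<\rho\le 1$ and $K>0$. An $(x,m,\rho,K)$-hierarchically clustered tree is defined recursively. For $m=1$ it is the isolated vertex $x$. For $m\ge2$ it is a tree $T$ with vertex set $V\subseteq Q_m(x)$ such that 1. $|V|>\rho m^d$; 2. $\operatorname{diam}(T)\le K\max\{1,\log\log m\}$; 3. if $T$ is rooted at a vertex of maximal weight, then the weights do not increase along the path from the root to any vertex of $T$; 4. for every edge of $T$ there are $1\le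 m'\le m$ and $x'\in Q_m(x)$ such that, of the two trees left when the edge is removed from $T$, one is an $(x',m',\rho,K)$-hierarchically clustered tree and the other has no vertex in $Q_{m'}(x')$. **Theorem.** There exist $\xi>0$, $\rho\in(0,1]$, $K>0$ and an integer $m_0>0$ such that the following two statements hold. (1) For all $m\ge m_0$, the probability that the subgraph of SFP inside the box $\{0,\dots,m-1\}^d$ contains a $(0,m,\rho,K)$-hierarchically clustered tree is at least $1-\exp(-\rho m^{\xi})$. (2) Almost surely SFP has an infinite connected component, and any infinite connected component contains an infinite tree $\mathcal T_\infty$ such that the removal of any edge of $\mathcal T_\infty$ leaves one finite and one infinite component, the finite one being an $(x,m,\rho,K)$-hierarchically clustered tree for some $x\in\mathbb Z^d$ and $m\ge1$. -/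

import Mathlib

namespace SFP

open MeasureTheory

/-- The `ℓ¹`-distance of two points of `ℤ^d`, as a real number. -/
def l1Dist {d : ℕ} (x y : Fin d → ℤ) : ℝ := ∑ i, |(x i : ℝ) - (y i : ℝ)|

/-- The conditional probability, given the weights `W`, that the edge `{x, y}` is retained. -/
noncomputable def edgeProb {d : ℕ} (α lam : ℝ) (W : (Fin d → ℤ) → ℝ) (x y : Fin d → ℤ) : ℝ :=
  1 - Real.exp (-(lam * (W x * W y / l1Dist x y ^ α)))

theorem edgeProb_comm {d : ℕ} (α lam : ℝ) (W : (Fin d → ℤ) → ℝ) (x y : Fin d → ℤ) :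
    edgeProb α lam W x y = edgeProb α lam W y x := by
  have h : l1Dist x y = l1Dist y x := by
    unfold l1Dist
    exact Finset.sum_congr rfl fun i _ => abs_sub_comm _ _
  unfold edgeProb
  rw [h, mul_comm (W x) (W y)]

/-- A sample point: the weights of the vertices of `ℤ^d`, and a mark in `[0, 1]` for every
(unordered) pair of vertices. -/
abbrev Sample (d : ℕ) : Type := ((Fin d → ℤ) → ℝ) × (Sym2 (Fin d → ℤ) → unitInterval)

/-- The probability measure of scale-free percolation with weight law `ν`: the weights are i.i.d.
with law `ν`, the marks are i.i.d. uniform on `[0, 1]`, and weights and marks are independent. -/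
noncomputable def law (d : ℕ) (ν : Measure ℝ) [IsProbabilityMeasure ν] : Measure (Sample d) :=
  (Measure.infinitePi fun _ : Fin d → ℤ => ν).prod
    (Measure.infinitePi fun _ : Sym2 (Fin d → ℤ) => (volume : Measure unitInterval))

/-- The graph of open edges: the edge `{x, y}` is open when its uniform mark is less than
`edgeProb α lam W x y`.  Thus, conditionally on the weights, the edges are open independently of
each other with probabilities `edgeProb α lam W x y`. -/
def openGraph {d : ℕ} (α lam : ℝ) (ω : Sample d) : SimpleGraph (Fin d → ℤ) where
  Adj x y := x ≠ y ∧ (ω.2 s(x, y) : ℝ) < edgeProb α lam ω.1 x y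
  symm := ⟨fun x y h => ⟨h.1.symm, by
    rw [Sym2.eq_swap, edgeProb_comm]
    exact h.2⟩⟩
  loopless := ⟨fun _ h => h.1 rfl⟩

/-- The box `x + [0, m - 1]^d` in `ℤ^d`. -/
def box {d : ℕ} (m : ℕ) (x : Fin d → ℤ) : Set (Fin d → ℤ) :=
  {y | ∀ i, x i ≤ y i ∧ y i ≤ x i + ((m : ℤ) - 1)}

theorem box_finite {d : ℕ} (m : ℕ) (x : Fin d → ℤ) : (box m x).Finite := by
  refine (Set.finite_Icc x (fun i => x i + ((m : ℤ) - 1))).subset ?_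
  intro y hy
  exact ⟨fun i => (hy i).1, fun i => (hy i).2⟩

/-- What remains on the side of `u` when the edge `{u, v}` is removed from `T`, that is, the
connected component of `u` in `T` without the edge `{u, v}`. -/
def side {V : Type*} {G : SimpleGraph V} (T : G.Subgraph) (u v : V) : G.Subgraph :=
  (T.deleteEdges {s(u, v)}).induce
    {w | (T.deleteEdges {s(u, v)}).spanningCoe.Reachable u w}

theorem side_verts_subset {V : Type*} {G : SimpleGraph V} (T : G.Subgraph) {u v : V}
    (hu : u ∈ T.verts) : (side T u v).verts ⊆ T.verts := by
  intro w hw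
  have hw' : (T.deleteEdges {s(u, v)}).spanningCoe.Reachable u w := hw
  obtain ⟨p⟩ := hw'.symm
  cases p with
  | nil => exact hu
  | cons h _ =>
    have h' : (T.deleteEdges {s(u, v)}).Adj w _ := h
    exact (T.deleteEdges {s(u, v)}).edge_vert h'

theorem notMem_side {V : Type*} {G : SimpleGraph V} (T : G.Subgraph) (hT : T.coe.IsTree)
    {u v : V} (h : T.Adj u v) : v ∉ (side T u v).verts := by
  intro hv
  have hv' : (T.deleteEdges {s(u, v)}).spanningCoe.Reachable u v := hv
  have hbr : T.coe.IsBridge s(⟨u, T.edge_vert h⟩, ⟨v, T.edge_vert h.symm⟩) :=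
    SimpleGraph.isAcyclic_iff_forall_adj_isBridge.mp hT.isAcyclic h
  rw [SimpleGraph.isBridge_iff] at hbr
  apply hbr
  have key : ∀ (a b : V) (p : (T.deleteEdges {s(u, v)}).spanningCoe.Walk a b)
      (ha : a ∈ T.verts) (hb : b ∈ T.verts),
      (T.coe \ SimpleGraph.fromEdgeSet
        {s((⟨u, T.edge_vert h⟩ : T.verts), ⟨v, T.edge_vert h.symm⟩)}).Reachable
        ⟨a, ha⟩ ⟨b, hb⟩ := by
    intro a b p
    induction p with
    | nil => intro _ _; exact SimpleGraph.Reachable.refl _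
    | cons hadj _ ih =>
      intro ha hb
      have h1 := hadj
      simp only [SimpleGraph.Subgraph.spanningCoe_adj, SimpleGraph.Subgraph.deleteEdges_adj,
        Set.mem_singleton_iff] at h1
      refine SimpleGraph.Reachable.trans (SimpleGraph.Adj.reachable ?_)
        (ih (T.edge_vert h1.1.symm) hb)
      rw [SimpleGraph.sdiff_adj]
      refine ⟨h1.1, ?_⟩
      rw [SimpleGraph.fromEdgeSet_adj]
      rintro ⟨h2, -⟩
      apply h1.2
      have h3 := congrArg (Sym2.map Subtype.val) (Set.mem_singleton_iff.mp h2)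
      simpa using h3
  obtain ⟨p⟩ := hv'
  exact key u v p _ _

theorem side_ncard_lt {V : Type*} {G : SimpleGraph V} (T : G.Subgraph) (hT : T.coe.IsTree)
    (hfin : T.verts.Finite) {u v : V} (h : T.Adj u v) :
    (side T u v).verts.ncard < T.verts.ncard :=
  Set.ncard_lt_ncard ⟨side_verts_subset T (T.edge_vert h),
    fun hs => notMem_side T hT h (hs (T.edge_vert h.symm))⟩ hfin

/-- The weights do not increase along the paths of `T` that start at a vertex of `T` of maximal
weight. -/
def OrderedWeights {V : Type*} {G : SimpleGraph V} (W : V → ℝ) (T : G.Subgraph) : Prop :=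
  ∃ r : T.verts, (∀ v : T.verts, W v ≤ W r) ∧
    ∀ (v : T.verts) (p : T.coe.Walk r v), p.IsPath →
      p.support.IsChain fun a b => W b ≤ W a

/-- `IsHCTree W ρ K x m T`: the subgraph `T`, with the vertex weights `W`, is an
`(x, m, ρ, K)`-hierarchically clustered tree.  (There is none for `m = 0`.) -/
def IsHCTree {d : ℕ} {G : SimpleGraph (Fin d → ℤ)} (W : (Fin d → ℤ) → ℝ) (ρ K : ℝ)
    (x : Fin d → ℤ) (m : ℕ) (T : G.Subgraph) : Prop :=
  (m = 1 ∧ T = G.singletonSubgraph x) ∨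
  (2 ≤ m ∧ ∃ (_ : T.coe.IsTree) (_ : T.verts ⊆ box m x),
    ρ * (m : ℝ) ^ d < (T.verts.ncard : ℝ) ∧
    (T.coe.diam : ℝ) ≤ K * max 1 (Real.log (Real.log m)) ∧
    OrderedWeights W T ∧
    ∀ u v : Fin d → ℤ, ∀ _ : T.Adj u v, ∃ m' ≤ m, ∃ x' ∈ box m x,
      (IsHCTree W ρ K x' m' (side T u v) ∧ Disjoint (box m' x') (side T v u).verts) ∨
      (IsHCTree W ρ K x' m' (side T v u) ∧ Disjoint (box m' x') (side T u v).verts))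
termination_by T.verts.ncard
decreasing_by
  · exact side_ncard_lt T ‹_› ((box_finite m x).subset ‹_›) ‹_›
  · exact side_ncard_lt T ‹_› ((box_finite m x).subset ‹_›) (SimpleGraph.Subgraph.adj_symm T ‹_›)

/-- `T` is an infinite tree such that the removal of any edge leaves a finite and an infinite
component, the finite one being an `(x, m, ρ, K)`-hierarchically clustered tree for some `x`
and `m`. -/
def IsInfiniteHCTree {d : ℕ} {G : SimpleGraph (Fin d → ℤ)} (W : (Fin d → ℤ) → ℝ) (ρ K : ℝ)
    (T : G.Subgraph) : Prop :=
  T.verts.Infinite ∧ T.coe.IsTree ∧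
    ∀ u v : Fin d → ℤ, T.Adj u v →
      ((side T u v).verts.Finite ∧ (side T v u).verts.Infinite ∧
        ∃ (x : Fin d → ℤ) (m : ℕ), 1 ≤ m ∧ IsHCTree W ρ K x m (side T u v)) ∨
      ((side T v u).verts.Finite ∧ (side T u v).verts.Infinite ∧
        ∃ (x : Fin d → ℤ) (m : ℕ), 1 ≤ m ∧ IsHCTree W ρ K x m (side T v u))

end SFP

/-! The construction is a renormalisation over nested boxes. Let `len n k` be the side of a box of
level `k`, growing doubly exponentially in `k`, and call a vertex heavy for level `k` when its
weight is at least `len n k ^ β`. The condition `γ < 2` is what permits `α / 2 < β < d / (τ - 1)`.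
The upper bound on `β` makes the expected number of heavy vertices in a box of side `M` at least a
positive power of `M`. The lower bound makes two vertices heavy for consecutive levels, of sides `L
< M ≤ L ^ (2 * β / α)`, adjacent at distance of order `M`, except with probability stretched
exponentially small in `M`: then `L ^ β ≥ M ^ (α / 2)`, and `M ^ (α / 2 + β - α)` is a positive
power of `M`.

In a good box the hub (the vertex of maximal weight) is adjacent to the hubs of all its good tiles,
so joining those hubs to it turns the trees of the tiles into one tree. Weights grow towards the
root because each hub is a maximum over its box. Each level adds one to the height, hence a diameter
of order `log log`. A box of level `k + 1` loses at most a fraction `2 ^ (-(k + 2))` of its tiles,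
so the density stays bounded below (`Good.le_ncard`). Cutting an edge detaches exactly the tree of a
smaller good box, and no other vertex of the tree lies in that box (`exists_isTreeBranch`); this is
the recursive clause, and `Good.isHCTree` collects everything. Independence of disjoint boxes gives
the recursion `measureReal_not_good_succ_le` for the failure probability, and
`exists_measureReal_not_good_le` solves it with the bound `exp (-(len n k) ^ ξ)`. For an arbitrary
side `m`, only the last branching number is changed.

For the infinite tree, the failure probabilities are summable, so along an increasing chain of boxes
all are good from some level on, and the union of their trees is infinite. To place such a tree in
every infinite component, reveal the percolation in the cubes `[-N, N]^d`. An infinite component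
reaches the surface of infinitely many cubes from inside, and from a surface vertex `z` there is a
chance bounded below, independent of the cube, that a chain of good boxes starts just outside and
`z` is joined to its first box. Lévy's 0-1 law (`ae_mem_attachEvent`) makes one of these attempts
succeed almost surely. -/

namespace SFP

open MeasureTheory ProbabilityTheory Filter Topology

/-! ### Trees given by parent maps, and what remains when an edge is cut. -/

section ParentForest

variable {α : Type*}

/-- `p` is a parent map on `V` (roots being the fixed points) without cycles, and any two vertices
have a common ancestor. -/
structure ParentForest (V : Set α) (p : α → α) : Prop where
  nonempty : V.Nonempty
  maps : ∀ v ∈ V, p v ∈ V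
  acyclic : ∀ v ∈ V, ∀ n, p^[n + 1] v = v → p v = v
  joined : ∀ u ∈ V, ∀ v ∈ V, ∃ n m, p^[n] u = p^[m] v

/-- The subgraph of `G` with vertex set `V` whose edges join the vertices to their parents. -/
def parentGraph (G : SimpleGraph α) (V : Set α) (p : α → α) : G.Subgraph where
  verts := V
  Adj u v := G.Adj u v ∧ u ∈ V ∧ v ∈ V ∧ (p u = v ∨ p v = u)
  adj_sub h := h.1
  edge_vert h := h.2.1
  symm := ⟨fun _ _ h => ⟨h.1.symm, h.2.2.1, h.2.1, h.2.2.2.symm⟩⟩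

/-- `S` consists of `u` and its descendants, and `u` is not a root. -/
structure IsBranch (V : Set α) (p : α → α) (S : Set α) (u : α) : Prop where
  subset : S ⊆ V
  mem : u ∈ S
  parent : p u ∉ S
  maps : ∀ w ∈ S, w ≠ u → p w ∈ S
  compl : ∀ w ∈ V, w ∉ S → p w ∉ S
  reach : ∀ w ∈ S, ∃ n, p^[n] w = u

theorem mem_of_reachable {H : SimpleGraph α} {S : Set α}
    (hS : ∀ a b, a ∈ S → H.Adj a b → b ∈ S) {a b : α} (h : H.Reachable a b) (ha : a ∈ S) :
    b ∈ S := by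
  obtain ⟨q⟩ := h
  induction q with
  | nil => exact ha
  | cons hab _ ih => exact ih (hS _ _ ha hab)

variable {G : SimpleGraph α} {V : Set α} {p : α → α}

theorem ParentForest.iterate_mem (hF : ParentForest V p) {v : α} (hv : v ∈ V) (n : ℕ) :
    p^[n] v ∈ V := by
  induction n with
  | zero => exact hv
  | succ n ih => rw [Function.iterate_succ_apply']; exact hF.maps _ ih

theorem ParentForest.reachable_iterate (hF : ParentForest V p)
    (hG : ∀ v ∈ V, p v ≠ v → G.Adj v (p v)) (n : ℕ) (v : (parentGraph G V p).verts) :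
    (parentGraph G V p).coe.Reachable v ⟨p^[n] v, hF.iterate_mem v.2 n⟩ := by
  induction n with
  | zero => exact SimpleGraph.Reachable.refl _
  | succ n ih =>
    refine ih.trans ?_
    by_cases h : p (p^[n] v) = p^[n] v
    · have : (⟨p^[n] v, hF.iterate_mem v.2 n⟩ : (parentGraph G V p).verts) =
          ⟨p^[n + 1] v, hF.iterate_mem v.2 (n + 1)⟩ := by
        apply Subtype.ext
        simp only [Function.iterate_succ_apply', h]
      rw [this]
    · refine SimpleGraph.Adj.reachable ?_
      have h1 := hF.iterate_mem v.2 n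
      simp only [SimpleGraph.Subgraph.coe_adj, Function.iterate_succ_apply']
      exact ⟨hG _ h1 h, h1, hF.maps _ h1, Or.inl rfl⟩

theorem ParentForest.connected (hF : ParentForest V p)
    (hG : ∀ v ∈ V, p v ≠ v → G.Adj v (p v)) : (parentGraph G V p).coe.Connected := by
  have : Nonempty (parentGraph G V p).verts := hF.nonempty.to_subtype
  refine ⟨fun u v => ?_⟩
  obtain ⟨n, m, h⟩ := hF.joined u u.2 v v.2
  refine (hF.reachable_iterate hG n u).trans ?_
  have : (⟨p^[n] u, hF.iterate_mem u.2 n⟩ : (parentGraph G V p).verts) =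
      ⟨p^[m] v, hF.iterate_mem v.2 m⟩ := Subtype.ext h
  rw [this]
  exact (hF.reachable_iterate hG m v).symm

/-- Every edge from `u` to its parent is a bridge: without it, the descendants of `u` are closed
under adjacency, and the parent of `u` is not among them since iterating `p` would return to `u`. -/
theorem ParentForest.isAcyclic (hF : ParentForest V p) : (parentGraph G V p).coe.IsAcyclic := by
  rw [SimpleGraph.isAcyclic_iff_forall_adj_isBridge]
  have key : ∀ u v : (parentGraph G V p).verts, (parentGraph G V p).coe.Adj u v → p u = v →
      (parentGraph G V p).coe.IsBridge s(u, v) := by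
    intro u v huv hp
    rw [SimpleGraph.isBridge_iff]
    intro hr
    have hne : (u : α) ≠ v := huv.1.ne
    have hmem : v ∈ {w : (parentGraph G V p).verts | ∃ n, p^[n] w = u} := by
      refine mem_of_reachable ?_ hr ⟨0, rfl⟩
      rintro a b ⟨n, hn⟩ hab
      rw [SimpleGraph.deleteEdges_adj] at hab
      obtain ⟨hab1, hab2⟩ := hab
      rcases hab1.2.2.2 with h | h
      · cases n with
        | zero =>
          exfalso
          have hau : a = u := Subtype.ext hn
          subst hau
          have hbv : b = v := Subtype.ext (h.symm.trans hp)
          subst hbv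
          exact hab2 rfl
        | succ n => exact ⟨n, by rw [← hn, Function.iterate_succ_apply, h]⟩
      · exact ⟨n + 1, by rw [Function.iterate_succ_apply, h, hn]⟩
    obtain ⟨n, hn⟩ := hmem
    have h2 := hF.acyclic u u.2 n (by rw [Function.iterate_succ_apply, hp, hn])
    exact hne (h2.symm.trans hp)
  intro u v huv
  rcases huv.2.2.2 with h | h
  · exact key u v huv h
  · rw [Sym2.eq_swap]; exact key v u huv.symm h

theorem ParentForest.isTree (hF : ParentForest V p)
    (hG : ∀ v ∈ V, p v ≠ v → G.Adj v (p v)) : (parentGraph G V p).coe.IsTree :=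
  ⟨hF.connected hG, hF.isAcyclic⟩

theorem deleteEdges_adj_iff {u v a b : α} :
    ((parentGraph G V p).deleteEdges {s(u, v)}).spanningCoe.Adj a b ↔
      (G.Adj a b ∧ a ∈ V ∧ b ∈ V ∧ (p a = b ∨ p b = a)) ∧ s(a, b) ≠ s(u, v) := by
  simp [parentGraph]

/-- The edge from `u` to its parent is the only one between `S` and the rest of `V`. -/
theorem IsBranch.closed {S : Set α} {u : α} (hB : IsBranch V p S u) {a b : α}
    (hab : ((parentGraph G V p).deleteEdges {s(u, p u)}).spanningCoe.Adj a b) (ha : a ∈ S) :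
    b ∈ S := by
  rw [deleteEdges_adj_iff] at hab
  obtain ⟨⟨-, haV, hbV, h | h⟩, hne⟩ := hab
  · by_cases hau : a = u
    · subst hau; exact absurd (by rw [h]) hne
    · rw [← h]; exact hB.maps a ha hau
  · by_contra hb
    exact hB.compl b hbV hb (h ▸ ha)

theorem IsBranch.side_verts {S : Set α} {u : α} (hB : IsBranch V p S u)
    (hG : ∀ v ∈ V, p v ≠ v → G.Adj v (p v)) :
    (side (parentGraph G V p) u (p u)).verts = S := by
  apply Set.Subset.antisymm
  · intro w hw
    exact mem_of_reachable (fun a b ha hab => hB.closed hab ha) hw hB.mem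
  · have key : ∀ n, ∀ w ∈ S, p^[n] w = u →
        ((parentGraph G V p).deleteEdges {s(u, p u)}).spanningCoe.Reachable w u := by
      intro n
      induction n with
      | zero => intro w _ h; exact (show w = u from h) ▸ SimpleGraph.Reachable.refl _
      | succ n ih =>
        intro w hw h
        by_cases hwu : w = u
        · rw [hwu]
        have hpw : p w ≠ w := fun h' => hwu (by rw [← h]; exact (Function.iterate_fixed h' _).symm)
        refine SimpleGraph.Reachable.trans (SimpleGraph.Adj.reachable ?_)
          (ih (p w) (hB.maps w hw hwu) (by rw [← h, Function.iterate_succ_apply]))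
        rw [deleteEdges_adj_iff]
        refine ⟨⟨hG w (hB.subset hw) hpw, hB.subset hw, hB.subset (hB.maps w hw hwu),
          Or.inl rfl⟩, fun h' => ?_⟩
        rcases Sym2.eq_iff.mp h' with h' | h'
        · exact hwu h'.1
        · exact hB.parent (h'.1 ▸ hw)
    intro w hw
    obtain ⟨n, hn⟩ := hB.reach w hw
    exact (key n w hw hn).symm

/-- The branch becomes a parent graph in its own right, rooted at `u`. This lets the detached piece
be recognised as the tree of a smaller box, whose own parent map is `p'`. -/
theorem IsBranch.side_eq {S : Set α} {u : α} {p' : α → α} (hB : IsBranch V p S u)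
    (hG : ∀ v ∈ V, p v ≠ v → G.Adj v (p v)) (hp : ∀ w ∈ S, w ≠ u → p' w = p w) (hu : p' u = u) :
    side (parentGraph G V p) u (p u) = parentGraph G S p' := by
  have hv := hB.side_verts hG
  refine SimpleGraph.Subgraph.ext hv ?_
  have key : ∀ a b, a ∈ S → b ∈ S → G.Adj a b → (p a = b ↔ p' a = b) := by
    intro a b ha hb hab
    by_cases hau : a = u
    · subst hau
      rw [hu]
      exact ⟨fun h => absurd (h ▸ hb) hB.parent, fun h => absurd h hab.ne⟩
    · rw [hp a ha hau]
  funext a b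
  apply propext
  have h1 : (side (parentGraph G V p) u (p u)).Adj a b ↔
      a ∈ (side (parentGraph G V p) u (p u)).verts ∧ b ∈ (side (parentGraph G V p) u (p u)).verts ∧
      ((parentGraph G V p).deleteEdges {s(u, p u)}).spanningCoe.Adj a b := Iff.rfl
  rw [h1, hv, deleteEdges_adj_iff]
  constructor
  · rintro ⟨ha, hb, ⟨hab, -, -, h⟩, -⟩
    refine ⟨hab, ha, hb, h.imp (key a b ha hb hab).mp (key b a hb ha hab.symm).mp⟩
  · rintro ⟨hab, ha, hb, h⟩
    refine ⟨ha, hb, ⟨hab, hB.subset ha, hB.subset hb,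
      h.imp (key a b ha hb hab).mpr (key b a hb ha hab.symm).mpr⟩, fun h' => ?_⟩
    rcases Sym2.eq_iff.mp h' with h' | h'
    · exact hB.parent (h'.2 ▸ hb)
    · exact hB.parent (h'.1 ▸ ha)

/-- The ancestors of a vertex outside `S` stay outside `S`, and one of them is also an ancestor of
`p u`, so the complement of the branch is connected without the cut edge. -/
theorem IsBranch.side_compl_verts {S : Set α} {u : α} (hB : IsBranch V p S u)
    (hF : ParentForest V p) (hG : ∀ v ∈ V, p v ≠ v → G.Adj v (p v)) :
    (side (parentGraph G V p) (p u) u).verts = V \ S := by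
  have hpu : p u ∈ V := hF.maps u (hB.subset hB.mem)
  have hdel : ∀ a b, ((parentGraph G V p).deleteEdges {s(p u, u)}).spanningCoe.Adj a b ↔
      ((parentGraph G V p).deleteEdges {s(u, p u)}).spanningCoe.Adj a b := by
    intro a b; rw [Sym2.eq_swap]
  apply Set.Subset.antisymm
  · intro w hw
    refine mem_of_reachable (S := V \ S) ?_ hw ⟨hpu, hB.parent⟩
    intro a b ha hab
    rw [hdel] at hab
    exact ⟨((deleteEdges_adj_iff).mp hab).1.2.2.1, fun hb => ha.2 (hB.closed hab.symm hb)⟩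
  · have key : ∀ n, ∀ w ∈ V \ S, p^[n] w ∈ V \ S ∧
        ((parentGraph G V p).deleteEdges {s(p u, u)}).spanningCoe.Reachable w (p^[n] w) := by
      intro n
      induction n with
      | zero => intro w hw; exact ⟨hw, SimpleGraph.Reachable.refl _⟩
      | succ n ih =>
        intro w hw
        have h1 := ih w hw
        rw [Function.iterate_succ_apply']
        refine ⟨⟨hF.maps _ h1.1.1, hB.compl _ h1.1.1 h1.1.2⟩, h1.2.trans ?_⟩
        by_cases h : p (p^[n] w) = p^[n] w
        · rw [h]
        · refine SimpleGraph.Adj.reachable ?_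
          rw [hdel, deleteEdges_adj_iff]
          refine ⟨⟨hG _ h1.1.1 h, h1.1.1, hF.maps _ h1.1.1, Or.inl rfl⟩, fun h' => ?_⟩
          rcases Sym2.eq_iff.mp h' with h' | h'
          · exact h1.1.2 (h'.1 ▸ hB.mem)
          · exact hB.compl _ h1.1.1 h1.1.2 (h'.2 ▸ hB.mem)
    intro w hw
    obtain ⟨n, m, h⟩ := hF.joined w hw.1 (p u) hpu
    have h1 := (key n w hw).2
    rw [h] at h1
    exact (key m (p u) ⟨hpu, hB.parent⟩).2.trans h1.symm

/-- Any two vertices are joined through the root, so the diameter is at most twice the height. -/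
theorem ParentForest.diam_le (hF : ParentForest V p)
    (hG : ∀ v ∈ V, p v ≠ v → G.Adj v (p v)) {r : α} {h : ℕ} (hr : r ∈ V)
    (hh : ∀ v ∈ V, ∃ m ≤ h, p^[m] v = r) : (parentGraph G V p).coe.diam ≤ 2 * h := by
  have key : ∀ m, ∀ v : (parentGraph G V p).verts, p^[m] v = r →
      (parentGraph G V p).coe.edist v ⟨r, hr⟩ ≤ m := by
    intro m
    induction m with
    | zero =>
      intro v hv
      have : v = ⟨r, hr⟩ := Subtype.ext hv
      rw [this, SimpleGraph.edist_self]
      simp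
    | succ m ih =>
      intro v hv
      have h1 := ih ⟨p v, hF.maps v v.2⟩ (by rw [← hv, Function.iterate_succ_apply])
      by_cases hpv : p v = v
      · have : (⟨p v, hF.maps v v.2⟩ : (parentGraph G V p).verts) = v := Subtype.ext hpv
        rw [this] at h1
        exact h1.trans (by exact_mod_cast Nat.le_succ m)
      · have hadj : (parentGraph G V p).coe.Adj v ⟨p v, hF.maps v v.2⟩ :=
          ⟨hG v v.2 hpv, v.2, hF.maps v v.2, Or.inl rfl⟩
        calc _ ≤ (parentGraph G V p).coe.edist v ⟨p v, hF.maps v v.2⟩ + _ :=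
              SimpleGraph.edist_triangle
          _ ≤ 1 + (m : ℕ∞) := by
              gcongr
              exact le_of_eq (SimpleGraph.edist_eq_one_iff_adj.mpr hadj)
          _ = ((m + 1 : ℕ) : ℕ∞) := by push_cast; rw [add_comm]
  have hle : (parentGraph G V p).coe.ediam ≤ ((2 * h : ℕ) : ℕ∞) := by
    rw [SimpleGraph.ediam_le_iff]
    intro u v
    obtain ⟨m, hm, hu⟩ := hh u u.2
    obtain ⟨m', hm', hv⟩ := hh v v.2
    calc _ ≤ (parentGraph G V p).coe.edist u ⟨r, hr⟩ + (parentGraph G V p).coe.edist ⟨r, hr⟩ v :=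
          SimpleGraph.edist_triangle
      _ ≤ (m : ℕ∞) + (m' : ℕ∞) := by
          gcongr
          · exact key m u hu
          · rw [SimpleGraph.edist_comm]; exact key m' v hv
      _ ≤ ((2 * h : ℕ) : ℕ∞) := by
          norm_cast
          omega
  exact ENat.toNat_le_of_le_natCast hle

theorem parentGraph_orderedWeights {W : α → ℝ} {r : α} (hr : r ∈ V) (hpr : p r = r)
    (hreach : ∀ v ∈ V, ∃ m, p^[m] v = r) (hmaps : ∀ v ∈ V, p v ∈ V)
    (hW : ∀ v ∈ V, W v ≤ W (p v)) : OrderedWeights W (parentGraph G V p) := by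
  refine ⟨⟨r, hr⟩, fun v => ?_, fun v q hq => ?_⟩
  · obtain ⟨m, hm⟩ := hreach v v.2
    have : ∀ m, ∀ w ∈ V, p^[m] w = r → W w ≤ W r := by
      intro m
      induction m with
      | zero => intro w _ h; exact (congrArg W h).le
      | succ m ih =>
        intro w hw h
        exact (hW w hw).trans (ih (p w) (hmaps w hw) (by rw [← h, Function.iterate_succ_apply]))
    exact this m v v.2 hm
  -- Invariant for the induction: the walk starts at the root, or the parent of its starting vertex
  -- is not on it. A path from the root can therefore only step from a parent to a child.
  · have key : ∀ (a b : (parentGraph G V p).verts) (q : (parentGraph G V p).coe.Walk a b),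
        q.IsPath → (p a = a ∨ ∀ c ∈ q.support, p a ≠ c) →
        q.support.IsChain fun a b => W b ≤ W a := by
      intro a b q
      induction q with
      | nil => intro _ _; simp
      | @cons a b c hab q ih =>
        intro hq hpa
        rw [SimpleGraph.Walk.cons_isPath_iff] at hq
        have hba : p b = a := by
          rcases hab.2.2.2 with h | h
          · exfalso
            rcases hpa with h' | h'
            · exact hab.1.ne (h'.symm.trans h)
            · exact h' b (by simp) h
          · exact h
        have h1 := ih hq.1 (Or.inr fun c hc h => hq.2 (by
          have : c = a := Subtype.ext (h.symm.trans hba)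
          exact this ▸ hc))
        rw [SimpleGraph.Walk.support_cons]
        have hs : q.support = b :: q.support.tail := (SimpleGraph.Walk.cons_tail_support q).symm
        rw [hs] at h1 ⊢
        refine List.IsChain.cons_cons ?_ h1
        have := hW b b.2
        rwa [hba] at this
    exact key _ _ q hq (Or.inl hpr)

end ParentForest

/-! ### Geometry of the nested boxes and their tilings. -/

section Boxes

variable {d : ℕ}

/-- The side lengths of the boxes of the successive levels, `n k` being the branching numbers. -/
def len (n : ℕ → ℕ) : ℕ → ℕ
  | 0 => n 0
  | k + 1 => len n k * n (k + 1)

/-- The corner of the tile with index `i` in the tiling, by boxes of side `L`, of a box at `x`. -/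
def tile (L : ℕ) (x : Fin d → ℤ) (i : Fin d → ℕ) : Fin d → ℤ := fun t => x t + L * i t

/-- The indices of the tiles of a box whose side is `N` times that of the tiles. -/
def tileIdx (d N : ℕ) : Finset (Fin d → ℕ) := Fintype.piFinset fun _ => Finset.range N

/-- The corner of the tile that contains `v`. -/
def tileAt (L : ℕ) (x v : Fin d → ℤ) : Fin d → ℤ := fun t => x t + L * ((v t - x t) / L)

theorem mem_tileIdx {N : ℕ} {i : Fin d → ℕ} : i ∈ tileIdx d N ↔ ∀ t, i t < N := by
  simp [tileIdx]

theorem card_tileIdx (N : ℕ) : (tileIdx d N).card = N ^ d := by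
  simp [tileIdx]

theorem len_pos {n : ℕ → ℕ} (hn : ∀ k, 0 < n k) (k : ℕ) : 0 < len n k := by
  induction k with
  | zero => exact hn 0
  | succ k ih => exact Nat.mul_pos ih (hn _)

theorem self_mem_box {m : ℕ} (hm : 0 < m) (x : Fin d → ℤ) : x ∈ box m x :=
  fun i => ⟨le_refl _, by have : (1 : ℤ) ≤ m := by exact_mod_cast hm
                          linarith⟩

theorem box_mono {m m' : ℕ} (h : m ≤ m') (x : Fin d → ℤ) : box m x ⊆ box m' x := by
  intro y hy i
  have : (m : ℤ) ≤ m' := by exact_mod_cast h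
  exact ⟨(hy i).1, by have := (hy i).2; linarith⟩

theorem tile_box_subset {L N : ℕ} (x : Fin d → ℤ) {i : Fin d → ℕ} (hi : i ∈ tileIdx d N) :
    box L (tile L x i) ⊆ box (L * N) x := by
  intro y hy t
  have h1 : (i t : ℤ) + 1 ≤ N := by exact_mod_cast mem_tileIdx.mp hi t
  obtain ⟨h2, h3⟩ := hy t
  simp only [tile] at h2 h3
  have h4 : (0 : ℤ) ≤ (L : ℤ) * i t := by positivity
  have h5 : (L : ℤ) * (i t + 1) ≤ L * N := by gcongr
  push_cast
  constructor <;> nlinarith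

theorem tileAt_eq {L : ℕ} {x v : Fin d → ℤ} {i : Fin d → ℕ} (hv : v ∈ box L (tile L x i)) :
    tileAt L x v = tile L x i := by
  funext t
  obtain ⟨h2, h3⟩ := hv t
  simp only [tile] at h2 h3
  have hL : (0 : ℤ) < L := by linarith
  have : (v t - x t) / (L : ℤ) = i t := by
    rw [Int.ediv_eq_iff_of_pos hL]
    constructor <;> nlinarith
  simp only [tileAt, tile, this]

theorem exists_tile {L N : ℕ} (hL : 0 < L) {x v : Fin d → ℤ} (hv : v ∈ box (L * N) x) :
    ∃ i ∈ tileIdx d N, v ∈ box L (tile L x i) := by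
  have hL' : (0 : ℤ) < L := by exact_mod_cast hL
  have h0 : ∀ t, 0 ≤ (v t - x t) / (L : ℤ) := fun t =>
    Int.ediv_nonneg (by have := (hv t).1; linarith) hL'.le
  refine ⟨fun t => ((v t - x t) / (L : ℤ)).toNat, mem_tileIdx.mpr fun t => ?_, fun t => ?_⟩
  · have h1 : (v t - x t) / (L : ℤ) < N := by
      rw [Int.ediv_lt_iff_lt_mul hL']
      have := (hv t).2
      push_cast at this
      linarith [mul_comm (L : ℤ) N]
    have := h0 t
    omega
  · simp only [tile]
    rw [Int.toNat_of_nonneg (h0 t)]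
    have h2 := Int.emod_add_mul_ediv (v t - x t) L
    have h3 := Int.emod_nonneg (v t - x t) hL'.ne'
    have h4 := Int.emod_lt_of_pos (v t - x t) hL'
    constructor <;> linarith

/-- `t` is the corner of one of the tiles of the box of level `k + 1` at `x`. -/
def IsTile (n : ℕ → ℕ) (k : ℕ) (x t : Fin d → ℤ) : Prop :=
  ∃ i ∈ tileIdx d (n (k + 1)), t = tile (len n k) x i

variable {n : ℕ → ℕ} {k : ℕ} {x t t' v : Fin d → ℤ}

theorem IsTile.subset (h : IsTile n k x t) : box (len n k) t ⊆ box (len n (k + 1)) x := by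
  obtain ⟨i, hi, rfl⟩ := h
  exact tile_box_subset x hi

theorem IsTile.tileAt_eq (h : IsTile n k x t) (hv : v ∈ box (len n k) t) :
    tileAt (len n k) x v = t := by
  obtain ⟨i, hi, rfl⟩ := h
  exact SFP.tileAt_eq hv

theorem IsTile.eq (h : IsTile n k x t) (h' : IsTile n k x t') (hv : v ∈ box (len n k) t)
    (hv' : v ∈ box (len n k) t') : t = t' :=
  (h.tileAt_eq hv).symm.trans (h'.tileAt_eq hv')

theorem tile_injective {L : ℕ} (hL : 0 < L) (x : Fin d → ℤ) :
    Function.Injective (tile L x) := by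
  intro i j h
  funext t
  have h1 := congrFun h t
  simp only [tile, add_right_inj] at h1
  have hL' : (L : ℤ) ≠ 0 := by exact_mod_cast hL.ne'
  exact_mod_cast mul_left_cancel₀ hL' h1

end Boxes

/-! ### Good boxes, their hubs and the trees built in them. -/

section Hierarchy

variable {d : ℕ}

open Classical in
/-- A box of level `0` is good when it contains a heavy vertex.  A box of level `k + 1` is good when
it contains a heavy vertex, few of its tiles are bad, and any two of its vertices that are heavy for
the levels `k` and `k + 1` are adjacent. -/
def Good (n : ℕ → ℕ) (w : ℕ → ℝ) (W : (Fin d → ℤ) → ℝ) (G : SimpleGraph (Fin d → ℤ)) :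
    ℕ → (Fin d → ℤ) → Prop
  | 0, x => ∃ v ∈ box (n 0) x, w 0 ≤ W v
  | k + 1, x =>
    (∃ v ∈ box (len n (k + 1)) x, w (k + 1) ≤ W v) ∧
    (((tileIdx d (n (k + 1))).filter fun i => ¬ Good n w W G k (tile (len n k) x i)).card : ℝ) ≤
      (n (k + 1) : ℝ) ^ d / 2 ^ (k + 2) ∧
    ∀ u ∈ box (len n (k + 1)) x, ∀ v ∈ box (len n (k + 1)) x, u ≠ v →
      w k ≤ W u → w (k + 1) ≤ W v → G.Adj u v

open Classical in
/-- A maximizer of `f` on the finite set `s`. -/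
noncomputable def argmax {β : Type*} (f : β → ℝ) (s : Finset β) (b : β) : β :=
  if h : s.Nonempty then (s.exists_max_image f h).choose else b

theorem argmax_mem {β : Type*} (f : β → ℝ) {s : Finset β} (b : β) (hs : s.Nonempty) :
    argmax f s b ∈ s := by
  rw [argmax, dif_pos hs]
  exact (s.exists_max_image f hs).choose_spec.1

theorem le_argmax {β : Type*} (f : β → ℝ) {s : Finset β} (b : β) {a : β} (ha : a ∈ s) :
    f a ≤ f (argmax f s b) := by
  have hs : s.Nonempty := ⟨a, ha⟩
  rw [argmax, dif_pos hs]
  exact (s.exists_max_image f hs).choose_spec.2 a ha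

/-- A vertex of maximal weight of the box of level `k` at `x`, chosen consistently. -/
noncomputable def hub (n : ℕ → ℕ) (W : (Fin d → ℤ) → ℝ) : ℕ → (Fin d → ℤ) → (Fin d → ℤ)
  | 0, x => argmax W (box_finite (n 0) x).toFinset x
  | k + 1, x => hub n W k (tile (len n k) x
      (argmax (fun i => W (hub n W k (tile (len n k) x i))) (tileIdx d (n (k + 1))) 0))

/-- The vertices of the tree in the box of level `k` at `x`: the hub and the vertices of the trees
of the good tiles. -/
def treeVerts (n : ℕ → ℕ) (w : ℕ → ℝ) (W : (Fin d → ℤ) → ℝ) (G : SimpleGraph (Fin d → ℤ)) :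
    ℕ → (Fin d → ℤ) → Set (Fin d → ℤ)
  | 0, x => {hub n W 0 x}
  | k + 1, x => {hub n W (k + 1) x} ∪
      {v | ∃ t, IsTile n k x t ∧ Good n w W G k t ∧ v ∈ treeVerts n w W G k t}

open Classical in
/-- The parents of the vertices of the tree in the box of level `k` at `x`. -/
noncomputable def treeParent (n : ℕ → ℕ) (W : (Fin d → ℤ) → ℝ) :
    ℕ → (Fin d → ℤ) → (Fin d → ℤ) → (Fin d → ℤ)
  | 0, _ => id
  | k + 1, x => fun v =>
      if v = hub n W (k + 1) x then v
      else if v = hub n W k (tileAt (len n k) x v) then hub n W (k + 1) x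
      else treeParent n W k (tileAt (len n k) x v) v

variable {n : ℕ → ℕ} {w : ℕ → ℝ} {W : (Fin d → ℤ) → ℝ} {G : SimpleGraph (Fin d → ℤ)}

theorem hub_mem (hn : ∀ k, 0 < n k) (k : ℕ) (x : Fin d → ℤ) : hub n W k x ∈ box (len n k) x := by
  induction k generalizing x with
  | zero =>
    have h := argmax_mem W (s := (box_finite (n 0) x).toFinset) x
      ⟨x, (Set.Finite.mem_toFinset _).mpr (self_mem_box (hn 0) x)⟩
    exact (Set.Finite.mem_toFinset _).mp h
  | succ k ih =>
    refine tile_box_subset x (argmax_mem _ _ ?_) (ih _)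
    exact ⟨0, mem_tileIdx.mpr fun _ => hn _⟩

theorem hub_max (hn : ∀ k, 0 < n k) (k : ℕ) {x v : Fin d → ℤ} (hv : v ∈ box (len n k) x) :
    W v ≤ W (hub n W k x) := by
  induction k generalizing x with
  | zero => exact le_argmax W x ((Set.Finite.mem_toFinset _).mpr hv)
  | succ k ih =>
    obtain ⟨i, hi, h⟩ := exists_tile (len_pos hn k) hv
    exact (ih h).trans (le_argmax (fun i => W (hub n W k (tile (len n k) x i))) 0 hi)

/-- The hub of a box is chosen among the hubs of its tiles. This consistency, needed when several
vertices share the maximal weight, keeps one root per box. -/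
theorem hub_succ_eq (hn : ∀ k, 0 < n k) {k : ℕ} {x t : Fin d → ℤ} (ht : IsTile n k x t)
    (h : hub n W (k + 1) x ∈ box (len n k) t) : hub n W (k + 1) x = hub n W k t := by
  have h1 : IsTile n k x (tile (len n k) x
      (argmax (fun i => W (hub n W k (tile (len n k) x i))) (tileIdx d (n (k + 1))) 0)) :=
    ⟨_, argmax_mem _ _ ⟨0, mem_tileIdx.mpr fun _ => hn _⟩, rfl⟩
  rw [ht.eq h1 h (hub_mem hn k _)]
  rfl

theorem Good.le_hub (hn : ∀ k, 0 < n k) {k : ℕ} {x : Fin d → ℤ} (h : Good n w W G k x) :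
    w k ≤ W (hub n W k x) := by
  cases k with
  | zero =>
    obtain ⟨v, hv, h⟩ := h
    exact h.trans (hub_max hn 0 hv)
  | succ k =>
    obtain ⟨v, hv, h⟩ := h.1
    exact h.trans (hub_max hn (k + 1) hv)

theorem hub_mem_treeVerts (k : ℕ) (x : Fin d → ℤ) : hub n W k x ∈ treeVerts n w W G k x := by
  cases k with
  | zero => exact rfl
  | succ k => exact Or.inl rfl

theorem treeVerts_subset (hn : ∀ k, 0 < n k) (k : ℕ) (x : Fin d → ℤ) :
    treeVerts n w W G k x ⊆ box (len n k) x := by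
  induction k generalizing x with
  | zero => rintro v rfl; exact hub_mem hn 0 x
  | succ k ih =>
    rintro v (rfl | ⟨t, ht, -, hv⟩)
    · exact hub_mem hn _ x
    · exact ht.subset (ih t hv)

theorem treeVerts_finite (hn : ∀ k, 0 < n k) (k : ℕ) (x : Fin d → ℤ) :
    (treeVerts n w W G k x).Finite :=
  (box_finite _ _).subset (treeVerts_subset hn k x)

theorem treeVerts_tile_subset {k : ℕ} {x t : Fin d → ℤ} (ht : IsTile n k x t)
    (hg : Good n w W G k t) : treeVerts n w W G k t ⊆ treeVerts n w W G (k + 1) x :=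
  fun _ hv => Or.inr ⟨t, ht, hg, hv⟩

/-- The tile may be bad: then the only candidate is the hub of the large box, which is the hub of
the tile as well. -/
theorem mem_treeVerts_tile (hn : ∀ k, 0 < n k) {k : ℕ} {x t v : Fin d → ℤ} (ht : IsTile n k x t)
    (hv : v ∈ treeVerts n w W G (k + 1) x) (hvt : v ∈ box (len n k) t) :
    v ∈ treeVerts n w W G k t := by
  rcases hv with rfl | ⟨t', ht', -, hv⟩
  · rw [hub_succ_eq hn ht hvt]; exact hub_mem_treeVerts k t
  · rwa [ht.eq ht' hvt (treeVerts_subset hn k t' hv)]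

theorem treeParent_hub (k : ℕ) (x : Fin d → ℤ) :
    treeParent n W k x (hub n W k x) = hub n W k x := by
  cases k with
  | zero => rfl
  | succ k => simp [treeParent]

theorem treeParent_tile_hub (hn : ∀ k, 0 < n k) {k : ℕ} {x t : Fin d → ℤ} (ht : IsTile n k x t) :
    treeParent n W (k + 1) x (hub n W k t) = hub n W (k + 1) x := by
  have h := ht.tileAt_eq (hub_mem (W := W) hn k t)
  simp only [treeParent, h]
  split_ifs with h1
  · exact h1
  · rfl

theorem treeParent_tile (hn : ∀ k, 0 < n k) {k : ℕ} {x t v : Fin d → ℤ} (ht : IsTile n k x t)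
    (hv : v ∈ box (len n k) t) (hne : v ≠ hub n W k t) :
    treeParent n W (k + 1) x v = treeParent n W k t v := by
  have h := ht.tileAt_eq hv
  have h1 : v ≠ hub n W (k + 1) x := by
    rintro rfl
    exact hne (hub_succ_eq hn ht hv)
  simp only [treeParent, h, if_neg h1, if_neg hne]

theorem treeParent_mem (hn : ∀ k, 0 < n k) {k : ℕ} {x v : Fin d → ℤ}
    (hv : v ∈ treeVerts n w W G k x) : treeParent n W k x v ∈ treeVerts n w W G k x := by
  induction k generalizing x v with
  | zero => exact hv
  | succ k ih =>
    rcases hv with rfl | ⟨t, ht, hg, hv⟩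
    · rw [treeParent_hub]; exact hub_mem_treeVerts _ _
    · by_cases h : v = hub n W k t
      · rw [h, treeParent_tile_hub hn ht]; exact hub_mem_treeVerts _ _
      · rw [treeParent_tile hn ht (treeVerts_subset hn k t hv) h]
        exact treeVerts_tile_subset ht hg (ih hv)

/-- Two parent maps that differ only at `r` agree along an orbit until it hits `r`. This compares
the parent maps of consecutive levels, which differ on a tile only at its hub. -/
theorem iterate_transfer {α : Type*} {S : Set α} {p q : α → α} {r : α}
    (hpq : ∀ v ∈ S, v ≠ r → p v = q v) (hq : ∀ v ∈ S, q v ∈ S) {m : ℕ} {v : α} (hv : v ∈ S)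
    (h : q^[m] v = r) : ∃ m' ≤ m, p^[m'] v = r := by
  induction m generalizing v with
  | zero => exact ⟨0, le_rfl, h⟩
  | succ m ih =>
    by_cases hvr : v = r
    · exact ⟨0, Nat.zero_le _, hvr⟩
    · obtain ⟨m', hm', h'⟩ := ih (hq v hv) (by rw [← h, Function.iterate_succ_apply])
      exact ⟨m' + 1, by omega, by rw [Function.iterate_succ_apply, hpq v hv hvr, h']⟩

theorem exists_iterate_treeParent (hn : ∀ k, 0 < n k) {k : ℕ} {x v : Fin d → ℤ}
    (hv : v ∈ treeVerts n w W G k x) : ∃ m ≤ k, (treeParent n W k x)^[m] v = hub n W k x := by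
  induction k generalizing x v with
  | zero => exact ⟨0, le_rfl, hv⟩
  | succ k ih =>
    rcases hv with rfl | ⟨t, ht, hg, hv⟩
    · exact ⟨0, Nat.zero_le _, rfl⟩
    · obtain ⟨m, hm, h⟩ := ih hv
      obtain ⟨m', hm', h'⟩ := iterate_transfer (S := treeVerts n w W G k t)
        (p := treeParent n W (k + 1) x)
        (fun v hv hne => treeParent_tile hn ht (treeVerts_subset hn k t hv) hne)
        (fun v hv => treeParent_mem hn hv) hv h
      exact ⟨m' + 1, by omega, by
        rw [Function.iterate_succ_apply', h', treeParent_tile_hub hn ht]⟩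

theorem eq_hub_of_treeParent_eq (hn : ∀ k, 0 < n k) {k : ℕ} {x v : Fin d → ℤ}
    (hv : v ∈ treeVerts n w W G k x) (h : treeParent n W k x v = v) : v = hub n W k x := by
  obtain ⟨m, -, hm⟩ := exists_iterate_treeParent hn hv
  rw [← hm, Function.iterate_fixed h]

theorem le_treeParent (hn : ∀ k, 0 < n k) {k : ℕ} {x v : Fin d → ℤ}
    (hv : v ∈ treeVerts n w W G k x) : W v ≤ W (treeParent n W k x v) := by
  induction k generalizing x v with
  | zero => exact le_rfl
  | succ k ih =>
    rcases hv with rfl | ⟨t, ht, hg, hv⟩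
    · rw [treeParent_hub]
    · have hvt := treeVerts_subset hn k t hv
      by_cases h : v = hub n W k t
      · rw [h, treeParent_tile_hub hn ht]
        exact hub_max hn (k + 1) (ht.subset (h ▸ hvt))
      · rw [treeParent_tile hn ht hvt h]
        exact ih hv

theorem Good.adj_treeParent (hn : ∀ k, 0 < n k) {k : ℕ} {x v : Fin d → ℤ}
    (hx : Good n w W G k x) (hv : v ∈ treeVerts n w W G k x) (hne : treeParent n W k x v ≠ v) :
    G.Adj v (treeParent n W k x v) := by
  induction k generalizing x v with
  | zero => exact absurd rfl hne
  | succ k ih =>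
    rcases hv with rfl | ⟨t, ht, hg, hv⟩
    · exact absurd (treeParent_hub _ _) hne
    · have hvt := treeVerts_subset hn k t hv
      by_cases h : v = hub n W k t
      · rw [h, treeParent_tile_hub hn ht] at hne ⊢
        exact hx.2.2 _ (ht.subset (hub_mem hn k t)) _ (hub_mem hn _ _) (Ne.symm hne)
          (hg.le_hub hn) (hx.le_hub hn)
      · rw [treeParent_tile hn ht hvt h] at hne ⊢
        exact ih hg hv hne

theorem treeParent_parentForest (hn : ∀ k, 0 < n k) (k : ℕ) (x : Fin d → ℤ) :
    ParentForest (treeVerts n w W G k x) (treeParent n W k x) where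
  nonempty := ⟨_, hub_mem_treeVerts k x⟩
  maps _ hv := treeParent_mem hn hv
  acyclic v hv a ha := by
    obtain ⟨m, -, hm⟩ := exists_iterate_treeParent hn hv
    -- A period repeated `m` times contains at least `m` steps, so the orbit has reached the hub and
    -- stays there; hence `v` is the hub.
    have h1 : (treeParent n W k x)^[(a + 1) * m] v = v := by
      rw [Function.iterate_mul]
      exact Function.iterate_fixed ha m
    rw [add_mul, one_mul, Function.iterate_add_apply, hm,
      Function.iterate_fixed (treeParent_hub k x)] at h1
    rw [← h1, treeParent_hub]
  joined u hu v hv := by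
    obtain ⟨m, -, hm⟩ := exists_iterate_treeParent hn hu
    obtain ⟨m', -, hm'⟩ := exists_iterate_treeParent hn hv
    exact ⟨m, m', hm.trans hm'.symm⟩

/-- The tree of the good box of level `j` at `y` is a branch of the forest given by `V` and `p`. -/
structure IsTreeBranch (n : ℕ → ℕ) (w : ℕ → ℝ) (W : (Fin d → ℤ) → ℝ) (G : SimpleGraph (Fin d → ℤ))
    (V : Set (Fin d → ℤ)) (p : (Fin d → ℤ) → (Fin d → ℤ)) (j : ℕ) (y : Fin d → ℤ) : Prop where
  good : Good n w W G j y
  subset : treeVerts n w W G j y ⊆ V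
  inter : ∀ v ∈ V, v ∈ box (len n j) y → v ∈ treeVerts n w W G j y
  eq : ∀ v ∈ treeVerts n w W G j y, v ≠ hub n W j y → p v = treeParent n W j y v
  compl : ∀ v ∈ V, v ∉ treeVerts n w W G j y → p v ∉ treeVerts n w W G j y
  parent : p (hub n W j y) ∉ treeVerts n w W G j y

theorem IsTreeBranch.isBranch (hn : ∀ k, 0 < n k) {V : Set (Fin d → ℤ)}
    {p : (Fin d → ℤ) → (Fin d → ℤ)} {j : ℕ} {y : Fin d → ℤ} (h : IsTreeBranch n w W G V p j y) :
    IsBranch V p (treeVerts n w W G j y) (hub n W j y) where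
  subset := h.subset
  mem := hub_mem_treeVerts j y
  parent := h.parent
  maps v hv hne := by rw [h.eq v hv hne]; exact treeParent_mem hn hv
  compl := h.compl
  reach v hv := by
    obtain ⟨m, -, hm⟩ := exists_iterate_treeParent hn hv
    obtain ⟨m', -, hm'⟩ := iterate_transfer h.eq (fun v hv => treeParent_mem hn hv) hv hm
    exact ⟨m', hm'⟩

theorem isTreeBranch_tile (hn : ∀ k, 0 < n k) {k : ℕ} {x t : Fin d → ℤ} (ht : IsTile n k x t)
    (hg : Good n w W G k t) (hne : hub n W k t ≠ hub n W (k + 1) x) :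
    IsTreeBranch n w W G (treeVerts n w W G (k + 1) x) (treeParent n W (k + 1) x) k t := by
  have hnot : hub n W (k + 1) x ∉ treeVerts n w W G k t := fun h =>
    hne (hub_succ_eq hn ht (treeVerts_subset hn k t h)).symm
  refine ⟨hg, treeVerts_tile_subset ht hg, fun v hv hvt => mem_treeVerts_tile hn ht hv hvt,
    fun v hv hvne => treeParent_tile hn ht (treeVerts_subset hn k t hv) hvne, ?_, ?_⟩
  · intro v hv hvt
    rcases hv with rfl | ⟨t', ht', hg', hv⟩
    · rwa [treeParent_hub]
    · have hvb := treeVerts_subset hn k t' hv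
      by_cases h : v = hub n W k t'
      · rwa [h, treeParent_tile_hub hn ht']
      · rw [treeParent_tile hn ht' hvb h]
        intro hp
        have := ht.eq ht' (treeVerts_subset hn k t hp)
          (treeVerts_subset hn k t' (treeParent_mem hn hv))
        exact hvt (this ▸ hv)
  · rwa [treeParent_tile_hub hn ht]

/-- Passing from a tile to the larger box changes the parent only at the hub of the tile. A branch
of the tree of the tile never contains that hub, since its own top vertex has a parent outside it.
-/
theorem IsTreeBranch.lift (hn : ∀ k, 0 < n k) {k j : ℕ} {x t y : Fin d → ℤ} (ht : IsTile n k x t)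
    (hg : Good n w W G k t) (hy : box (len n j) y ⊆ box (len n k) t)
    (h : IsTreeBranch n w W G (treeVerts n w W G k t) (treeParent n W k t) j y) :
    IsTreeBranch n w W G (treeVerts n w W G (k + 1) x) (treeParent n W (k + 1) x) j y := by
  have hjy : treeVerts n w W G j y ⊆ box (len n k) t := (treeVerts_subset hn j y).trans hy
  have h1 : hub n W k t ∉ treeVerts n w W G j y := by
    intro hmem
    by_cases he : hub n W k t = hub n W j y
    · apply h.parent
      rw [← he, treeParent_hub, he]
      exact hub_mem_treeVerts j y
    · have h2 := h.eq _ hmem he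
      rw [treeParent_hub] at h2
      exact he (eq_hub_of_treeParent_eq hn hmem h2.symm)
  have hnot : hub n W (k + 1) x ∉ treeVerts n w W G j y := fun hmem =>
    h1 (hub_succ_eq hn ht (hjy hmem) ▸ hmem)
  have hstep : ∀ v ∈ treeVerts n w W G j y,
      treeParent n W (k + 1) x v = treeParent n W k t v := fun v hv =>
    treeParent_tile hn ht (hjy hv) fun h2 => h1 (h2 ▸ hv)
  refine ⟨h.good, h.subset.trans (treeVerts_tile_subset ht hg),
    fun v hv hvy => h.inter v (mem_treeVerts_tile hn ht hv (hy hvy)) hvy,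
    fun v hv hne => (hstep v hv).trans (h.eq v hv hne), ?_, ?_⟩
  · intro v hv hvy
    rcases hv with rfl | ⟨t', ht', hg', hv⟩
    · rwa [treeParent_hub]
    · have hvb := treeVerts_subset hn k t' hv
      by_cases he : v = hub n W k t'
      · rwa [he, treeParent_tile_hub hn ht']
      · rw [treeParent_tile hn ht' hvb he]
        intro hp
        have := ht.eq ht' (hjy hp) (treeVerts_subset hn k t' (treeParent_mem hn hv))
        subst this
        exact h.compl v hv hvy hp
  · rw [hstep _ (hub_mem_treeVerts j y)]
    exact h.parent

/-- This is the source of the recursive clause: descending through the tiles that contain `v`, one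
stops at the first whose hub is `v`, and the descendants of `v` are the whole tree of that tile. -/
theorem exists_isTreeBranch (hn : ∀ k, 0 < n k) {k : ℕ} {x v : Fin d → ℤ}
    (hv : v ∈ treeVerts n w W G k x) (hne : v ≠ hub n W k x) :
    ∃ j < k, ∃ y, v = hub n W j y ∧ box (len n j) y ⊆ box (len n k) x ∧
      IsTreeBranch n w W G (treeVerts n w W G k x) (treeParent n W k x) j y := by
  induction k generalizing x v with
  | zero => exact absurd hv hne
  | succ k ih =>
    rcases hv with rfl | ⟨t, ht, hg, hv⟩
    · exact absurd rfl hne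
    · by_cases h : v = hub n W k t
      · exact ⟨k, Nat.lt_succ_self k, t, h, ht.subset, isTreeBranch_tile hn ht hg (h ▸ hne)⟩
      · obtain ⟨j, hj, y, h1, h2, h3⟩ := ih hv h
        exact ⟨j, hj.trans (Nat.lt_succ_self k), y, h1, h2.trans ht.subset, h3.lift hn ht hg h2⟩

/-- A tree of level `0` has one vertex in `n 0 ^ d`. The factor `1 / 2 + 1 / 2 ^ (k + 1)` is a
decreasing lower bound that absorbs the loss of bad tiles at each level without falling below one
half. -/
theorem Good.le_ncard (hn : ∀ k, 0 < n k) {k : ℕ} {x : Fin d → ℤ} (hx : Good n w W G k x) :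
    (1 / 2 + 1 / 2 ^ (k + 1)) * ((len n k : ℝ) / n 0) ^ d ≤ (treeVerts n w W G k x).ncard := by
  classical
  induction k generalizing x with
  | zero =>
    have h0 : (n 0 : ℝ) ≠ 0 := by exact_mod_cast (hn 0).ne'
    simp only [treeVerts, Set.ncard_singleton, len, div_self h0]
    norm_num
  | succ k ih =>
    set I := (tileIdx d (n (k + 1))).filter fun i => Good n w W G k (tile (len n k) x i) with hI
    set B := (tileIdx d (n (k + 1))).filter fun i => ¬ Good n w W G k (tile (len n k) x i) with hB
    have hsum : (I.card : ℝ) + B.card = (n (k + 1) : ℝ) ^ d := by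
      have := Finset.card_filter_add_card_filter_not (s := tileIdx d (n (k + 1)))
        (fun i => Good n w W G k (tile (len n k) x i))
      rw [card_tileIdx] at this
      exact_mod_cast this
    have hBle : (B.card : ℝ) ≤ (n (k + 1) : ℝ) ^ d / 2 ^ (k + 2) := hx.2.1
    set F : (Fin d → ℕ) → Finset (Fin d → ℤ) := fun i =>
      (treeVerts_finite (w := w) (W := W) (G := G) hn k (tile (len n k) x i)).toFinset with hF
    have hcardF : ∀ i, (F i).card = (treeVerts n w W G k (tile (len n k) x i)).ncard := fun i =>
      (Set.ncard_eq_toFinset_card _ _).symm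
    have hdisj : (I : Set (Fin d → ℕ)).PairwiseDisjoint F := by
      intro i hi j hj hij
      rw [Function.onFun, Finset.disjoint_left]
      intro v hvi hvj
      rw [hF, Set.Finite.mem_toFinset] at hvi hvj
      have hi' : IsTile n k x (tile (len n k) x i) := ⟨i, (Finset.mem_filter.mp hi).1, rfl⟩
      have hj' : IsTile n k x (tile (len n k) x j) := ⟨j, (Finset.mem_filter.mp hj).1, rfl⟩
      exact hij (tile_injective (len_pos hn k) x
        (hi'.eq hj' (treeVerts_subset hn k _ hvi) (treeVerts_subset hn k _ hvj)))
    have hle : (I.biUnion F).card ≤ (treeVerts n w W G (k + 1) x).ncard := by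
      rw [← Set.ncard_coe_finset]
      refine Set.ncard_le_ncard ?_ (treeVerts_finite hn _ _)
      intro v hv
      rw [Finset.mem_coe, Finset.mem_biUnion] at hv
      obtain ⟨i, hi, hv⟩ := hv
      rw [hF, Set.Finite.mem_toFinset] at hv
      exact treeVerts_tile_subset ⟨i, (Finset.mem_filter.mp hi).1, rfl⟩
        (Finset.mem_filter.mp hi).2 hv
    rw [Finset.card_biUnion hdisj] at hle
    set A : ℝ := (1 / 2 + 1 / 2 ^ (k + 1)) * ((len n k : ℝ) / n 0) ^ d with hA
    have hIle : (I.card : ℝ) * A ≤ ∑ i ∈ I, ((F i).card : ℝ) := by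
      rw [← nsmul_eq_mul]
      refine Finset.card_nsmul_le_sum _ _ _ fun i hi => ?_
      rw [hcardF]
      exact ih (Finset.mem_filter.mp hi).2
    have hA0 : 0 ≤ A := by positivity
    have hP : (0 : ℝ) ≤ ((len n k : ℝ) / n 0) ^ d * (n (k + 1) : ℝ) ^ d := by positivity
    have hpow : (1 : ℝ) / 2 ^ (k + 2) = 1 / 2 ^ (k + 1) / 2 := by rw [pow_succ]; field_simp
    have hs1 : (1 : ℝ) / 2 ^ (k + 1) ≤ 1 / 2 := by
      rw [pow_succ]
      have : (1 : ℝ) ≤ 2 ^ k := one_le_pow₀ (by norm_num)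
      rw [div_le_div_iff₀ (by positivity) (by positivity)]
      linarith
    have hs0 : (0 : ℝ) < 1 / 2 ^ (k + 1) := by positivity
    calc (1 / 2 + 1 / 2 ^ (k + 1 + 1)) * ((len n (k + 1) : ℝ) / n 0) ^ d
        = (1 / 2 + 1 / 2 ^ (k + 1) / 2) *
            (((len n k : ℝ) / n 0) ^ d * (n (k + 1) : ℝ) ^ d) := by
          rw [← hpow, ← mul_pow]; simp only [len]; push_cast; ring_nf
      -- With `s = 1 / 2 ^ (k + 1)` the inequality `1 / 2 + s / 2 ≤ (1 / 2 + s) * (1 - s / 2)`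
      -- amounts to `s ≤ 1 / 2`.
      _ ≤ ((1 / 2 + 1 / 2 ^ (k + 1)) * (1 - 1 / 2 ^ (k + 1) / 2)) *
            (((len n k : ℝ) / n 0) ^ d * (n (k + 1) : ℝ) ^ d) := by
          refine mul_le_mul_of_nonneg_right ?_ hP
          nlinarith
      _ = ((n (k + 1) : ℝ) ^ d - (n (k + 1) : ℝ) ^ d / 2 ^ (k + 2)) * A := by
          rw [hA, ← hpow]; ring
      _ ≤ I.card * A := by
          refine mul_le_mul_of_nonneg_right ?_ hA0
          linarith
      _ ≤ ∑ i ∈ I, ((F i).card : ℝ) := hIle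
      _ ≤ (treeVerts n w W G (k + 1) x).ncard := by exact_mod_cast hle

end Hierarchy

/-! ### Trees of good boxes are hierarchically clustered. -/

section Trees

variable {d : ℕ} {n : ℕ → ℕ} {w : ℕ → ℝ} {W : (Fin d → ℤ) → ℝ} {G : SimpleGraph (Fin d → ℤ)}

/-- The tree in the box of level `k` at `x`. -/
noncomputable def hierTree (n : ℕ → ℕ) (w : ℕ → ℝ) (W : (Fin d → ℤ) → ℝ) (G : SimpleGraph (Fin d → ℤ))
    (k : ℕ) (x : Fin d → ℤ) : G.Subgraph :=
  parentGraph G (treeVerts n w W G k x) (treeParent n W k x)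

theorem IsTreeBranch.side_eq (hn : ∀ k, 0 < n k) {V : Set (Fin d → ℤ)}
    {p : (Fin d → ℤ) → (Fin d → ℤ)} {j : ℕ} {y : Fin d → ℤ} (h : IsTreeBranch n w W G V p j y)
    (hG : ∀ v ∈ V, p v ≠ v → G.Adj v (p v)) :
    side (parentGraph G V p) (hub n W j y) (p (hub n W j y)) = hierTree n w W G j y :=
  (h.isBranch hn).side_eq hG (fun v hv hne => (h.eq v hv hne).symm) (treeParent_hub j y)

theorem len_mono (hn : ∀ k, 0 < n k) : Monotone (len n) :=
  monotone_nat_of_le_succ fun k => Nat.le_mul_of_pos_right _ (hn (k + 1))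

/-- The side `m` is kept separate from `len n k`, since statement (1) concerns boxes whose side is
not one of the scales. For the pieces detached by an edge the witness is the side `len n j` of their
own box. As `n 0` is at least `2`, even the one-vertex trees of level `0` fall under the second
alternative of the definition. -/
theorem Good.isHCTree (hn : ∀ k, 0 < n k) (h2 : 2 ≤ n 0) {ρ K : ℝ}
    (hρ : ρ ≤ 1 / 2 / (n 0 : ℝ) ^ d) {k : ℕ}
    (hK : ∀ j < k, 2 * (j : ℝ) ≤ K * max 1 (Real.log (Real.log (len n j))))
    {x : Fin d → ℤ} (hx : Good n w W G k x) {m : ℕ} (hm : len n k ≤ m)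
    (hρm : ρ * (m : ℝ) ^ d < (treeVerts n w W G k x).ncard)
    (hKm : 2 * (k : ℝ) ≤ K * max 1 (Real.log (Real.log m))) :
    IsHCTree W ρ K x m (hierTree n w W G k x) := by
  induction k using Nat.strong_induction_on generalizing x m with
  | _ k ih =>
  have hG : ∀ v ∈ treeVerts n w W G k x, treeParent n W k x v ≠ v →
      G.Adj v (treeParent n W k x v) := fun v hv hne => hx.adj_treeParent hn hv hne
  have hF := treeParent_parentForest (w := w) (W := W) (G := G) hn k x
  have hm2 : 2 ≤ m := (h2.trans (len_mono hn (Nat.zero_le k))).trans hm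
  have hbox : treeVerts n w W G k x ⊆ box m x :=
    (treeVerts_subset hn k x).trans (box_mono hm x)
  have key : ∀ u ∈ treeVerts n w W G k x, treeParent n W k x u ≠ u →
      ∃ m' ≤ m, ∃ x' ∈ box m x,
        IsHCTree W ρ K x' m' (side (hierTree n w W G k x) u (treeParent n W k x u)) ∧
        Disjoint (box m' x') (side (hierTree n w W G k x) (treeParent n W k x u) u).verts := by
    intro u hu hne
    obtain ⟨j, hj, y, rfl, hsub, hB⟩ := exists_isTreeBranch hn hu
      (fun h => hne (by rw [h, treeParent_hub]))
    refine ⟨len n j, (len_mono hn hj.le).trans hm, y,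
      box_mono hm x (hsub (self_mem_box (len_pos hn j) y)), ?_, ?_⟩
    · rw [hierTree, hB.side_eq hn hG]
      refine ih j hj (fun i hi => hK i (hi.trans hj)) hB.good le_rfl ?_ (hK j hj)
      refine lt_of_lt_of_le ?_ (hB.good.le_ncard hn)
      have hn0 : (0 : ℝ) < n 0 := by exact_mod_cast hn 0
      have hl : (0 : ℝ) < (len n j : ℝ) ^ d := by
        have : (0 : ℝ) < len n j := by exact_mod_cast len_pos hn j
        positivity
      rw [div_pow]
      calc ρ * (len n j : ℝ) ^ d ≤ 1 / 2 / (n 0 : ℝ) ^ d * (len n j : ℝ) ^ d := by gcongr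
        _ = 1 / 2 * ((len n j : ℝ) ^ d / (n 0 : ℝ) ^ d) := by ring
        _ < _ := by
            have : (0 : ℝ) < 1 / 2 ^ (j + 1) := by positivity
            gcongr
            linarith
    · rw [hierTree, (hB.isBranch hn).side_compl_verts hF hG, Set.disjoint_left]
      exact fun v hv hv' => hv'.2 (hB.inter v hv'.1 hv)
  rw [IsHCTree]
  refine Or.inr ⟨hm2, hF.isTree hG, hbox, hρm, ?_, ?_, ?_⟩
  · refine le_trans ?_ hKm
    have := hF.diam_le hG (hub_mem_treeVerts k x) fun v hv => exists_iterate_treeParent hn hv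
    exact_mod_cast this
  · exact parentGraph_orderedWeights (hub_mem_treeVerts k x) (treeParent_hub k x)
      (fun v hv => by
        obtain ⟨m, -, h⟩ := exists_iterate_treeParent hn hv
        exact ⟨m, h⟩)
      (fun v hv => treeParent_mem hn hv) (fun v hv => le_treeParent hn hv)
  · intro u v huv
    obtain ⟨hadj, hu, hv, h | h⟩ := huv
    · obtain ⟨m', hm', x', hx', h1, h2⟩ := key u hu (h ▸ hadj.ne')
      rw [h] at h1 h2
      exact ⟨m', hm', x', hx', Or.inl ⟨h1, h2⟩⟩
    · obtain ⟨m', hm', x', hx', h1, h2⟩ := key v hv (h ▸ hadj.ne)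
      rw [h] at h1 h2
      exact ⟨m', hm', x', hx', Or.inr ⟨h1, h2⟩⟩

theorem Good.isHCTree_self (hn : ∀ k, 0 < n k) (h2 : 2 ≤ n 0) {ρ K : ℝ}
    (hρ : ρ ≤ 1 / 2 / (n 0 : ℝ) ^ d)
    (hK : ∀ j : ℕ, 2 * (j : ℝ) ≤ K * max 1 (Real.log (Real.log (len n j))))
    {k : ℕ} {x : Fin d → ℤ} (hx : Good n w W G k x) :
    IsHCTree W ρ K x (len n k) (hierTree n w W G k x) := by
  refine hx.isHCTree hn h2 hρ (fun j _ => hK j) le_rfl ?_ (hK k)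
  refine lt_of_lt_of_le ?_ (hx.le_ncard hn)
  have hn0 : (0 : ℝ) < n 0 := by exact_mod_cast hn 0
  have hl : (0 : ℝ) < (len n k : ℝ) ^ d := by
    have : (0 : ℝ) < len n k := by exact_mod_cast len_pos hn k
    positivity
  rw [div_pow]
  calc ρ * (len n k : ℝ) ^ d ≤ 1 / 2 / (n 0 : ℝ) ^ d * (len n k : ℝ) ^ d := by gcongr
    _ = 1 / 2 * ((len n k : ℝ) ^ d / (n 0 : ℝ) ^ d) := by ring
    _ < _ := by
        have : (0 : ℝ) < 1 / 2 ^ (k + 1) := by positivity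
        gcongr
        linarith

/-! ### The infinite tree along an increasing chain of good boxes. -/

section Infinite

/-- The vertices of the union of the trees along a chain of boxes. -/
def chainVerts (n : ℕ → ℕ) (w : ℕ → ℝ) (W : (Fin d → ℤ) → ℝ) (G : SimpleGraph (Fin d → ℤ))
    (y : ℕ → Fin d → ℤ) (j : ℕ) : Set (Fin d → ℤ) :=
  {v | ∃ k ≥ j, v ∈ treeVerts n w W G k (y k)}

open Classical in
/-- The parents in the union of the trees along a chain of boxes. -/
noncomputable def chainParent (n : ℕ → ℕ) (w : ℕ → ℝ) (W : (Fin d → ℤ) → ℝ)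
    (G : SimpleGraph (Fin d → ℤ)) (y : ℕ → Fin d → ℤ) (j : ℕ) (v : Fin d → ℤ) : Fin d → ℤ :=
  if h : ∃ k ≥ j, v ∈ treeVerts n w W G k (y k) ∧ treeParent n W k (y k) v ≠ v then
    treeParent n W h.choose (y h.choose) v else v

variable {y : ℕ → Fin d → ℤ} {j : ℕ}

theorem treeVerts_chain_mono (hy : ∀ k, IsTile n k (y (k + 1)) (y k))
    (hg : ∀ k ≥ j, Good n w W G k (y k)) {k l : ℕ} (hjk : j ≤ k) (hkl : k ≤ l) :
    treeVerts n w W G k (y k) ⊆ treeVerts n w W G l (y l) := by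
  induction l, hkl using Nat.le_induction with
  | base => exact le_rfl
  | succ l hl ih => exact ih.trans (treeVerts_tile_subset (hy l) (hg l (hjk.trans hl)))

theorem treeParent_chain (hn : ∀ k, 0 < n k) (hy : ∀ k, IsTile n k (y (k + 1)) (y k))
    (hg : ∀ k ≥ j, Good n w W G k (y k)) {k l : ℕ} (hjk : j ≤ k) (hkl : k ≤ l) {v : Fin d → ℤ}
    (hv : v ∈ treeVerts n w W G k (y k)) (hne : treeParent n W k (y k) v ≠ v) :
    treeParent n W l (y l) v = treeParent n W k (y k) v := by
  induction l, hkl using Nat.le_induction with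
  | base => rfl
  | succ l hl ih =>
    have hvl := treeVerts_chain_mono hy hg hjk hl hv
    rw [← ih, treeParent_tile hn (hy l) (treeVerts_subset hn l _ hvl)]
    rintro rfl
    apply hne
    rw [← ih, treeParent_hub]

theorem chainParent_eq (hn : ∀ k, 0 < n k) (hy : ∀ k, IsTile n k (y (k + 1)) (y k))
    (hg : ∀ k ≥ j, Good n w W G k (y k)) {k : ℕ} (hjk : j ≤ k) {v : Fin d → ℤ}
    (hv : v ∈ treeVerts n w W G k (y k)) (hne : treeParent n W k (y k) v ≠ v) :
    chainParent n w W G y j v = treeParent n W k (y k) v := by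
  have h : ∃ k ≥ j, v ∈ treeVerts n w W G k (y k) ∧ treeParent n W k (y k) v ≠ v :=
    ⟨k, hjk, hv, hne⟩
  rw [chainParent, dif_pos h]
  obtain ⟨h1, h2, h3⟩ := h.choose_spec
  rcases le_total h.choose k with hle | hle
  · exact (treeParent_chain hn hy hg h1 hle h2 h3).symm
  · exact treeParent_chain hn hy hg hjk hle hv hne

/-- A vertex has a fixed weight while the hubs of good boxes are at least as heavy as `w k`, which
tends to infinity. So each vertex eventually stops being a hub of the chain, and from then on its
parent no longer changes. -/
theorem exists_treeParent_ne (hn : ∀ k, 0 < n k) (hw : Filter.Tendsto w Filter.atTop Filter.atTop)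
    (hy : ∀ k, IsTile n k (y (k + 1)) (y k))
    (hg : ∀ k ≥ j, Good n w W G k (y k)) {v : Fin d → ℤ} (hv : v ∈ chainVerts n w W G y j) :
    ∃ k ≥ j, ∀ l ≥ k, v ∈ treeVerts n w W G l (y l) ∧ treeParent n W l (y l) v ≠ v ∧
      chainParent n w W G y j v = treeParent n W l (y l) v := by
  obtain ⟨k, hk, hvk⟩ := hv
  obtain ⟨a, ha⟩ := (Filter.tendsto_atTop.mp hw (W v + 1)).exists_forall_of_atTop
  refine ⟨max k a, hk.trans (le_max_left _ _), fun l hl => ?_⟩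
  have hkl : k ≤ l := (le_max_left _ _).trans hl
  have hvl := treeVerts_chain_mono hy hg hk hkl hvk
  have hne : treeParent n W l (y l) v ≠ v := by
    intro h
    have h1 := eq_hub_of_treeParent_eq hn hvl h
    have h2 := (hg l (hk.le.trans hkl)).le_hub hn
    rw [← h1] at h2
    have h3 := ha l ((le_max_right _ _).trans hl)
    linarith
  exact ⟨hvl, hne, chainParent_eq hn hy hg (hk.le.trans hkl) hvl hne⟩

/-- Finitely many steps in the infinite tree can be read off in one sufficiently large box, which
transfers acyclicity from the finite trees. -/
theorem exists_iterate_chainParent_eq (hn : ∀ k, 0 < n k)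
    (hw : Filter.Tendsto w Filter.atTop Filter.atTop)
    (hy : ∀ k, IsTile n k (y (k + 1)) (y k))
    (hg : ∀ k ≥ j, Good n w W G k (y k)) {v : Fin d → ℤ} (hv : v ∈ chainVerts n w W G y j)
    (m : ℕ) : (chainParent n w W G y j)^[m] v ∈ chainVerts n w W G y j ∧
      ∃ k ≥ j, ∀ l ≥ k, (chainParent n w W G y j)^[m] v = (treeParent n W l (y l))^[m] v := by
  induction m with
  | zero => exact ⟨hv, j, le_rfl, fun _ _ => rfl⟩
  | succ m ih =>
    obtain ⟨h1, k, hk, h2⟩ := ih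
    obtain ⟨k', hk', h3⟩ := exists_treeParent_ne hn hw hy hg h1
    simp only [Function.iterate_succ_apply']
    refine ⟨⟨k', hk', ?_⟩, max k k', hk.trans (le_max_left _ _), fun l hl => ?_⟩
    · rw [(h3 k' le_rfl).2.2]
      exact treeParent_mem hn (h3 k' le_rfl).1
    · rw [(h3 l ((le_max_right _ _).trans hl)).2.2, h2 l ((le_max_left _ _).trans hl)]

theorem exists_iterate_chainParent_hub (hn : ∀ k, 0 < n k)
    (hy : ∀ k, IsTile n k (y (k + 1)) (y k))
    (hg : ∀ k ≥ j, Good n w W G k (y k)) {k : ℕ} (hk : j ≤ k) {v : Fin d → ℤ}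
    (hv : v ∈ treeVerts n w W G k (y k)) :
    ∃ m, (chainParent n w W G y j)^[m] v = hub n W k (y k) := by
  obtain ⟨m, -, hm⟩ := exists_iterate_treeParent hn hv
  obtain ⟨m', -, hm'⟩ := iterate_transfer (S := treeVerts n w W G k (y k))
    (p := chainParent n w W G y j)
    (fun v hv hne => chainParent_eq hn hy hg hk hv
      fun h => hne (eq_hub_of_treeParent_eq hn hv h)) (fun v hv => treeParent_mem hn hv) hv hm
  exact ⟨m', hm'⟩

theorem chainParent_parentForest (hn : ∀ k, 0 < n k)
    (hw : Filter.Tendsto w Filter.atTop Filter.atTop)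
    (hy : ∀ k, IsTile n k (y (k + 1)) (y k)) (hg : ∀ k ≥ j, Good n w W G k (y k)) :
    ParentForest (chainVerts n w W G y j) (chainParent n w W G y j) where
  nonempty := ⟨_, j, le_rfl, hub_mem_treeVerts j (y j)⟩
  maps v hv := (exists_iterate_chainParent_eq hn hw hy hg hv 1).1
  acyclic v hv a ha := by
    obtain ⟨k, hk, h1⟩ := exists_treeParent_ne hn hw hy hg hv
    obtain ⟨-, k', hk', h2⟩ := exists_iterate_chainParent_eq hn hw hy hg hv (a + 1)
    obtain ⟨h3, h4, -⟩ := h1 (max k k') (le_max_left _ _)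
    have h5 := h2 (max k k') (le_max_right _ _)
    exact absurd ((treeParent_parentForest (w := w) (G := G) hn _ _).acyclic v h3 a
      (h5.symm.trans ha)) h4
  joined u hu v hv := by
    obtain ⟨k, hk, hu⟩ := hu
    obtain ⟨k', hk', hv⟩ := hv
    have hkm := hk.le.trans (le_max_left k k')
    obtain ⟨a, ha⟩ := exists_iterate_chainParent_hub hn hy hg hkm
      (treeVerts_chain_mono hy hg hk (le_max_left k k') hu)
    obtain ⟨b, hb⟩ := exists_iterate_chainParent_hub hn hy hg hkm
      (treeVerts_chain_mono hy hg hk' (le_max_right k k') hv)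
    exact ⟨a, b, ha.trans hb.symm⟩

theorem adj_chainParent (hn : ∀ k, 0 < n k)
    (hw : Filter.Tendsto w Filter.atTop Filter.atTop)
    (hy : ∀ k, IsTile n k (y (k + 1)) (y k)) (hg : ∀ k ≥ j, Good n w W G k (y k))
    {v : Fin d → ℤ} (hv : v ∈ chainVerts n w W G y j) : G.Adj v (chainParent n w W G y j v) := by
  obtain ⟨k, hk, h1⟩ := exists_treeParent_ne hn hw hy hg hv
  obtain ⟨h2, h3, h4⟩ := h1 k le_rfl
  rw [h4]
  exact (hg k hk).adj_treeParent hn h2 h3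

theorem chainVerts_infinite (hn : ∀ k, 0 < n k)
    (hw : Filter.Tendsto w Filter.atTop Filter.atTop)
    (hg : ∀ k ≥ j, Good n w W G k (y k)) :
    (chainVerts n w W G y j).Infinite := by
  intro hfin
  obtain ⟨M, hM⟩ := (hfin.image W).bddAbove
  obtain ⟨a, ha⟩ := (Filter.tendsto_atTop.mp hw (M + 1)).exists_forall_of_atTop
  have h1 := ha (max a j) (le_max_left _ _)
  have h2 := (hg (max a j) (le_max_right _ _)).le_hub hn
  have h3 := hM (Set.mem_image_of_mem W (show hub n W (max a j) (y (max a j)) ∈ _ from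
    ⟨max a j, le_max_right _ _, hub_mem_treeVerts _ _⟩))
  linarith

/-- In the infinite tree there is no root, so every vertex is the top of a finite branch. The branch
found in one box of the chain survives in all larger ones by `IsTreeBranch.lift`. -/
theorem exists_isTreeBranch_chain (hn : ∀ k, 0 < n k)
    (hw : Filter.Tendsto w Filter.atTop Filter.atTop)
    (hy : ∀ k, IsTile n k (y (k + 1)) (y k)) (hg : ∀ k ≥ j, Good n w W G k (y k))
    {v : Fin d → ℤ} (hv : v ∈ chainVerts n w W G y j) :
    ∃ i x, v = hub n W i x ∧
      IsTreeBranch n w W G (chainVerts n w W G y j) (chainParent n w W G y j) i x := by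
  obtain ⟨k, hk, h1⟩ := exists_treeParent_ne hn hw hy hg hv
  obtain ⟨h2, h3, h4⟩ := h1 k le_rfl
  obtain ⟨i, -, x, rfl, hsub, hB⟩ := exists_isTreeBranch hn h2
    (fun h => h3 (by rw [h, treeParent_hub]))
  have hlift : ∀ l ≥ k, box (len n i) x ⊆ box (len n l) (y l) ∧
      IsTreeBranch n w W G (treeVerts n w W G l (y l)) (treeParent n W l (y l)) i x := by
    intro l hl
    induction l, hl using Nat.le_induction with
    | base => exact ⟨hsub, hB⟩
    | succ l hl ih =>
      exact ⟨ih.1.trans (hy l).subset, ih.2.lift hn (hy l) (hg l (hk.le.trans hl)) ih.1⟩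
  refine ⟨i, x, rfl, hB.good, fun v hv => ⟨k, hk, hB.subset hv⟩, ?_, ?_, ?_, ?_⟩
  · rintro v hv hvx
    obtain ⟨k', hk', h5⟩ := exists_treeParent_ne hn hw hy hg hv
    exact (hlift (max k k') (le_max_left _ _)).2.inter v (h5 _ (le_max_right _ _)).1 hvx
  · intro v hv hne
    have h5 := hB.eq v hv hne
    rw [← h5]
    refine chainParent_eq hn hy hg hk (hB.subset hv) fun h => hne ?_
    exact eq_hub_of_treeParent_eq hn hv (h5.symm.trans h)
  · intro v hv hvx
    obtain ⟨k', hk', h5⟩ := exists_treeParent_ne hn hw hy hg hv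
    obtain ⟨h6, -, h7⟩ := h5 (max k k') (le_max_right _ _)
    rw [h7]
    exact (hlift (max k k') (le_max_left _ _)).2.compl v h6 hvx
  · rw [h4]
    exact hB.parent

theorem isInfiniteHCTree_chain (hn : ∀ k, 0 < n k) (h2 : 2 ≤ n 0) {ρ K : ℝ}
    (hρ : ρ ≤ 1 / 2 / (n 0 : ℝ) ^ d)
    (hK : ∀ j : ℕ, 2 * (j : ℝ) ≤ K * max 1 (Real.log (Real.log (len n j))))
    (hw : Filter.Tendsto w Filter.atTop Filter.atTop)
    (hy : ∀ k, IsTile n k (y (k + 1)) (y k)) (hg : ∀ k ≥ j, Good n w W G k (y k)) :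
    IsInfiniteHCTree W ρ K
      (parentGraph G (chainVerts n w W G y j) (chainParent n w W G y j)) := by
  have hF := chainParent_parentForest hn hw hy hg
  have hG : ∀ v ∈ chainVerts n w W G y j, chainParent n w W G y j v ≠ v →
      G.Adj v (chainParent n w W G y j v) := fun v hv _ => adj_chainParent hn hw hy hg hv
  have hinf := chainVerts_infinite hn hw hg
  have key : ∀ u ∈ chainVerts n w W G y j,
      (side (parentGraph G (chainVerts n w W G y j) (chainParent n w W G y j)) u
        (chainParent n w W G y j u)).verts.Finite ∧
      (side (parentGraph G (chainVerts n w W G y j) (chainParent n w W G y j))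
        (chainParent n w W G y j u) u).verts.Infinite ∧
      ∃ (x : Fin d → ℤ) (m : ℕ), 1 ≤ m ∧ IsHCTree W ρ K x m
        (side (parentGraph G (chainVerts n w W G y j) (chainParent n w W G y j)) u
          (chainParent n w W G y j u)) := by
    intro u hu
    obtain ⟨i, x, rfl, hB⟩ := exists_isTreeBranch_chain hn hw hy hg hu
    rw [hB.side_eq hn hG, (hB.isBranch hn).side_compl_verts hF hG]
    exact ⟨treeVerts_finite hn i x, hinf.sdiff (treeVerts_finite hn i x), x, len n i,
      len_pos hn i, hB.good.isHCTree_self hn h2 hρ hK⟩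
  refine ⟨hinf, hF.isTree hG, fun u v huv => ?_⟩
  obtain ⟨-, hu, hv, h | h⟩ := huv
  · have := key u hu
    rw [h] at this
    exact Or.inl this
  · have := key v hv
    rw [h] at this
    exact Or.inr this

/-- The tree along a chain of good boxes lies in the component of each of its vertices. -/
theorem reachable_chainVerts (hn : ∀ k, 0 < n k)
    (hw : Filter.Tendsto w Filter.atTop Filter.atTop)
    (hy : ∀ k, IsTile n k (y (k + 1)) (y k)) (hg : ∀ k ≥ j, Good n w W G k (y k))
    {u v : Fin d → ℤ} (hu : u ∈ chainVerts n w W G y j) (hv : v ∈ chainVerts n w W G y j) :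
    G.Reachable u v := by
  have hc := (chainParent_parentForest hn hw hy hg).connected (G := G)
    (fun v hv _ => adj_chainParent hn hw hy hg hv)
  exact (hc.preconnected ⟨u, hu⟩ ⟨v, hv⟩).map (SimpleGraph.Subgraph.hom _)

end Infinite

end Trees

/-! ### Independence of events depending on disjoint sets of weights and marks. -/

section Coordinates

variable {d : ℕ}

/-- The σ-algebra generated by one coordinate, a weight or a mark, of the sample. -/
abbrev coordSigma (d : ℕ) : (Fin d → ℤ) ⊕ Sym2 (Fin d → ℤ) → MeasurableSpace (Sample d)
  | .inl v => MeasurableSpace.comap (fun ω => ω.1 v) inferInstance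
  | .inr e => MeasurableSpace.comap (fun ω => ω.2 e) inferInstance

/-- The σ-algebra generated by a set of coordinates of the sample. -/
abbrev sigmaOn (I : Set ((Fin d → ℤ) ⊕ Sym2 (Fin d → ℤ))) : MeasurableSpace (Sample d) :=
  ⨆ i ∈ I, coordSigma d i

/-- The coordinates that live in `S`: the weights of the vertices of `S` and the marks of the pairs
of vertices of `S`. -/
def coordsIn (S : Set (Fin d → ℤ)) : Set ((Fin d → ℤ) ⊕ Sym2 (Fin d → ℤ)) :=
  {i | Sum.elim (fun v => v ∈ S) (fun e => ∀ v ∈ e, v ∈ S) i}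

theorem coordSigma_le (i : (Fin d → ℤ) ⊕ Sym2 (Fin d → ℤ)) :
    coordSigma d i ≤ (inferInstance : MeasurableSpace (Sample d)) := by
  cases i with
  | inl v => exact Measurable.comap_le (by fun_prop)
  | inr e => exact Measurable.comap_le (by fun_prop)

theorem sigmaOn_le (I : Set ((Fin d → ℤ) ⊕ Sym2 (Fin d → ℤ))) :
    sigmaOn I ≤ (inferInstance : MeasurableSpace (Sample d)) :=
  iSup₂_le fun i _ => coordSigma_le i

theorem sigmaOn_mono {I J : Set ((Fin d → ℤ) ⊕ Sym2 (Fin d → ℤ))} (h : I ⊆ J) :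
    sigmaOn I ≤ sigmaOn J :=
  biSup_mono fun _ hi => h hi

theorem coordsIn_mono {S T : Set (Fin d → ℤ)} (h : S ⊆ T) : coordsIn S ⊆ coordsIn T := by
  rintro (v | e) hi
  · exact h hi
  · exact fun v hv => h (hi v hv)

theorem coordsIn_disjoint {S T : Set (Fin d → ℤ)} (h : Disjoint S T) :
    Disjoint (coordsIn S) (coordsIn T) := by
  rw [Set.disjoint_left] at h ⊢
  rintro (v | e) hi hj
  · exact h hi hj
  · induction e with
    | h x y => exact h (hi x (Sym2.mem_mk_left x y)) (hj x (Sym2.mem_mk_left x y))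

theorem measurable_weight {I : Set ((Fin d → ℤ) ⊕ Sym2 (Fin d → ℤ))} {v : Fin d → ℤ}
    (hv : Sum.inl v ∈ I) : Measurable[sigmaOn I] (fun ω : Sample d => ω.1 v) :=
  Measurable.of_comap_le (le_iSup₂_of_le (f := fun i (_ : i ∈ I) => coordSigma d i) _ hv le_rfl)

theorem measurable_mark {I : Set ((Fin d → ℤ) ⊕ Sym2 (Fin d → ℤ))} {e : Sym2 (Fin d → ℤ)}
    (he : Sum.inr e ∈ I) : Measurable[sigmaOn I] (fun ω : Sample d => ω.2 e) :=
  Measurable.of_comap_le (le_iSup₂_of_le (f := fun i (_ : i ∈ I) => coordSigma d i) _ he le_rfl)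

theorem measurable_sample {Ω : Type*} [MeasurableSpace Ω] {X : Ω → Sample d}
    (h1 : ∀ v, Measurable fun ω => (X ω).1 v) (h2 : ∀ e, Measurable fun ω => (X ω).2 e) :
    Measurable X :=
  (measurable_pi_lambda (fun ω => (X ω).1) h1).prodMk (measurable_pi_lambda (fun ω => (X ω).2) h2)

theorem sigmaOn_univ :
    sigmaOn (Set.univ : Set ((Fin d → ℤ) ⊕ Sym2 (Fin d → ℤ))) =
      (inferInstance : MeasurableSpace (Sample d)) := by
  refine le_antisymm (sigmaOn_le _) ?_
  have h := @measurable_sample d (Sample d) (sigmaOn Set.univ) id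
    (fun v => measurable_weight (Set.mem_univ _)) (fun e => measurable_mark (Set.mem_univ _))
  intro s hs
  exact h hs

instance law_isProbabilityMeasure (ν : Measure ℝ) [IsProbabilityMeasure ν] :
    IsProbabilityMeasure (law d ν) := by
  unfold law; infer_instance

theorem law_rect (ν : Measure ℝ) [IsProbabilityMeasure ν] (s : Finset (Fin d → ℤ))
    (s' : Finset (Sym2 (Fin d → ℤ))) (A : (Fin d → ℤ) → Set ℝ)
    (B : Sym2 (Fin d → ℤ) → Set unitInterval) (hA : ∀ v ∈ s, MeasurableSet (A v))
    (hB : ∀ e ∈ s', MeasurableSet (B e)) :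
    law d ν {ω | (∀ v ∈ s, ω.1 v ∈ A v) ∧ ∀ e ∈ s', ω.2 e ∈ B e} =
      (∏ v ∈ s, ν (A v)) * ∏ e ∈ s', volume (B e) := by
  have : {ω : Sample d | (∀ v ∈ s, ω.1 v ∈ A v) ∧ ∀ e ∈ s', ω.2 e ∈ B e} =
      (Set.pi s A) ×ˢ (Set.pi s' B) := by
    ext ω; simp [Set.mem_pi]
  rw [this, law, Measure.prod_prod, Measure.infinitePi_pi _ hA, Measure.infinitePi_pi _ hB]

/-- Finite intersections of coordinate events are rectangles, whose measure factorises by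
`law_rect`. Weights and marks are indexed together by a sum type so that independence of blocks
follows at once. -/
theorem iIndep_coordSigma (ν : Measure ℝ) [IsProbabilityMeasure ν] :
    iIndep (coordSigma d) (law d ν) := by
  classical
  rw [iIndep_iff]
  intro s f hf
  have hA : ∀ v : Fin d → ℤ, ∃ A : Set ℝ, MeasurableSet A ∧
      (Sum.inl v ∈ s → f (Sum.inl v) = {ω | ω.1 v ∈ A}) := by
    intro v
    by_cases hv : Sum.inl v ∈ s
    · obtain ⟨A, hA, h⟩ := hf _ hv
      exact ⟨A, hA, fun _ => h.symm⟩
    · exact ⟨∅, MeasurableSet.empty, fun h => absurd h hv⟩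
  have hB : ∀ e : Sym2 (Fin d → ℤ), ∃ B : Set unitInterval, MeasurableSet B ∧
      (Sum.inr e ∈ s → f (Sum.inr e) = {ω | ω.2 e ∈ B}) := by
    intro v
    by_cases hv : Sum.inr v ∈ s
    · obtain ⟨A, hA, h⟩ := hf _ hv
      exact ⟨A, hA, fun _ => h.symm⟩
    · exact ⟨∅, MeasurableSet.empty, fun h => absurd h hv⟩
  choose A hAm hA using hA
  choose B hBm hB using hB
  have h1 : ⋂ i ∈ s, f i = {ω : Sample d | (∀ v ∈ s.toLeft, ω.1 v ∈ A v) ∧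
      ∀ e ∈ s.toRight, ω.2 e ∈ B e} := by
    ext ω
    simp only [Set.mem_iInter, Sum.forall, Finset.mem_toLeft, Finset.mem_toRight, Set.mem_ofPred_eq]
    refine and_congr (forall_congr' fun v => forall_congr' fun hv => ?_)
      (forall_congr' fun v => forall_congr' fun hv => ?_)
    · rw [hA v hv]; rfl
    · rw [hB v hv]; rfl
  have h2 : ∀ v ∈ s.toLeft, law d ν (f (Sum.inl v)) = ν (A v) := by
    intro v hv
    rw [hA v (Finset.mem_toLeft.mp hv)]
    have := law_rect ν {v} ∅ A B (fun v _ => hAm v) (fun e _ => hBm e)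
    simpa using this
  have h3 : ∀ v ∈ s.toRight, law d ν (f (Sum.inr v)) = volume (B v) := by
    intro v hv
    rw [hB v (Finset.mem_toRight.mp hv)]
    have := law_rect ν ∅ {v} A B (fun v _ => hAm v) (fun e _ => hBm e)
    simpa using this
  rw [h1, law_rect ν _ _ A B (fun v _ => hAm v) (fun e _ => hBm e), ← Finset.prod_congr rfl h2,
    ← Finset.prod_congr rfl h3]
  conv_rhs => rw [← s.toLeft_disjSum_toRight]
  rw [Finset.prod_disjSum]

theorem indep_sigmaOn (ν : Measure ℝ) [IsProbabilityMeasure ν]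
    {I J : Set ((Fin d → ℤ) ⊕ Sym2 (Fin d → ℤ))} (h : Disjoint I J) :
    Indep (sigmaOn I) (sigmaOn J) (law d ν) :=
  indep_iSup_of_disjoint coordSigma_le (iIndep_coordSigma ν) h

theorem measureReal_inter_sigmaOn (ν : Measure ℝ) [IsProbabilityMeasure ν]
    {I J : Set ((Fin d → ℤ) ⊕ Sym2 (Fin d → ℤ))} (h : Disjoint I J) {A B : Set (Sample d)}
    (hA : MeasurableSet[sigmaOn I] A) (hB : MeasurableSet[sigmaOn J] B) :
    (law d ν).real (A ∩ B) = (law d ν).real A * (law d ν).real B := by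
  have := (Indep_iff _ _ _).mp (indep_sigmaOn ν h) A B hA hB
  rw [measureReal_def, this, ENNReal.toReal_mul]
  rfl

theorem measurableSet_biInter_sigmaOn {ι : Type*} (s : Finset ι)
    {J : ι → Set ((Fin d → ℤ) ⊕ Sym2 (Fin d → ℤ))} {E : ι → Set (Sample d)}
    (hE : ∀ i ∈ s, MeasurableSet[sigmaOn (J i)] (E i)) :
    MeasurableSet[sigmaOn (⋃ i ∈ s, J i)] (⋂ i ∈ s, E i) :=
  @Finset.measurableSet_biInter _ _ (sigmaOn (⋃ i ∈ s, J i)) _ s fun i hi =>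
    sigmaOn_mono (Set.subset_biUnion_of_mem (u := J) hi) _ (hE i hi)

theorem measureReal_biInter_sigmaOn (ν : Measure ℝ) [IsProbabilityMeasure ν] {ι : Type*}
    (s : Finset ι) {J : ι → Set ((Fin d → ℤ) ⊕ Sym2 (Fin d → ℤ))}
    (hJ : (s : Set ι).PairwiseDisjoint J) {E : ι → Set (Sample d)}
    (hE : ∀ i ∈ s, MeasurableSet[sigmaOn (J i)] (E i)) :
    (law d ν).real (⋂ i ∈ s, E i) = ∏ i ∈ s, (law d ν).real (E i) := by
  classical
  induction s using Finset.induction_on with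
  | empty => simp
  | insert a s ha ih =>
    rw [Finset.set_biInter_insert, Finset.prod_insert ha,
      measureReal_inter_sigmaOn ν ?_ (hE a (Finset.mem_insert_self a s))
        (measurableSet_biInter_sigmaOn s fun i hi => hE i (Finset.mem_insert_of_mem hi)),
      ih (hJ.subset (by simp)) fun i hi => hE i (Finset.mem_insert_of_mem hi)]
    rw [Set.disjoint_iUnion₂_right]
    intro i hi
    refine hJ (by simp) (by simp [hi]) ?_
    rintro rfl
    exact ha hi

end Coordinates

/-! ### Measurability with respect to partial information. -/

section Measurability

variable {d : ℕ} {Ω : Type*} [MeasurableSpace Ω]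

theorem measurableSet_reachable {β : Type*} [Countable β] {H : Ω → SimpleGraph β}
    (hH : ∀ u v, MeasurableSet {ω | (H ω).Adj u v}) (x z : β) :
    MeasurableSet {ω | (H ω).Reachable x z} := by
  have h1 : ∀ m : ℕ, ∀ x, MeasurableSet {ω | ∃ q : (H ω).Walk x z, q.length = m} := by
    intro m
    induction m with
    | zero =>
      intro x
      have : {ω | ∃ q : (H ω).Walk x z, q.length = 0} = {_ω | x = z} := by
        ext ω
        constructor
        · rintro ⟨q, hq⟩; exact SimpleGraph.Walk.eq_of_length_eq_zero hq
        · rintro (rfl : x = z); exact ⟨SimpleGraph.Walk.nil, rfl⟩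
      rw [this]
      exact MeasurableSet.const _
    | succ m ih =>
      intro x
      have : {ω | ∃ q : (H ω).Walk x z, q.length = m + 1} =
          ⋃ y, ({ω | (H ω).Adj x y} ∩ {ω | ∃ q : (H ω).Walk y z, q.length = m}) := by
        ext ω
        simp only [Set.mem_ofPred_eq, Set.mem_iUnion, Set.mem_inter_iff]
        constructor
        · rintro ⟨q, hq⟩
          cases q with
          | nil => simp at hq
          | cons h q => exact ⟨_, h, q, by simpa using hq⟩
        · rintro ⟨y, hy, q, hq⟩
          exact ⟨SimpleGraph.Walk.cons hy q, by simp [hq]⟩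
      rw [this]
      exact MeasurableSet.iUnion fun y => (hH x y).inter (ih y)
  have : {ω | (H ω).Reachable x z} = ⋃ m, {ω | ∃ q : (H ω).Walk x z, q.length = m} := by
    ext ω
    simp only [Set.mem_ofPred_eq, Set.mem_iUnion]
    exact ⟨fun ⟨q⟩ => ⟨_, q, rfl⟩, fun ⟨_, q, _⟩ => ⟨q⟩⟩
  rw [this]
  exact MeasurableSet.iUnion fun m => h1 m x

theorem measurableSet_adj {α lam : ℝ} {X : Ω → Sample d} {u v : Fin d → ℤ}
    (hu : Measurable fun ω => (X ω).1 u) (hv : Measurable fun ω => (X ω).1 v)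
    (he : Measurable fun ω => (X ω).2 s(u, v)) :
    MeasurableSet {ω | (openGraph α lam (X ω)).Adj u v} := by
  refine (MeasurableSet.const (u ≠ v)).inter ?_
  refine measurableSet_lt (measurable_subtype_coe.comp he) ?_
  unfold edgeProb
  exact measurable_const.sub
    (Real.measurable_exp.comp ((measurable_const.mul ((hu.mul hv).div_const _)).neg))

theorem measurableSet_exists_le {X : Ω → Sample d} {m : ℕ} {x : Fin d → ℤ} (a : ℝ)
    (h : ∀ v ∈ box m x, Measurable fun ω => (X ω).1 v) :
    MeasurableSet {ω | ∃ v ∈ box m x, a ≤ (X ω).1 v} := by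
  have : {ω | ∃ v ∈ box m x, a ≤ (X ω).1 v} = ⋃ v ∈ box m x, {ω | a ≤ (X ω).1 v} := by
    ext ω; simp
  rw [this]
  exact MeasurableSet.biUnion (box_finite m x).countable fun v hv =>
    measurableSet_le measurable_const (h v hv)

/-- The space `Ω` and the map `X` are left free so that `Ω` can be the sample space with the
σ-algebra of a single box; goodness of a box is then seen to depend only on the weights and marks
inside it. -/
theorem measurableSet_good {α lam : ℝ} {n : ℕ → ℕ} {w : ℕ → ℝ} {X : Ω → Sample d}
    (k : ℕ) (x : Fin d → ℤ)
    (h1 : ∀ v ∈ box (len n k) x, Measurable fun ω => (X ω).1 v)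
    (h2 : ∀ u ∈ box (len n k) x, ∀ v ∈ box (len n k) x, Measurable fun ω => (X ω).2 s(u, v)) :
    MeasurableSet {ω | Good n w (X ω).1 (openGraph α lam (X ω)) k x} := by
  classical
  induction k generalizing x with
  | zero => exact measurableSet_exists_le (w 0) h1
  | succ k ih =>
    refine (measurableSet_exists_le _ h1).inter (MeasurableSet.inter ?_ ?_)
    · have hmeas : Measurable fun ω => ∑ i ∈ tileIdx d (n (k + 1)),
          Set.indicator {ω | ¬ Good n w (X ω).1 (openGraph α lam (X ω)) k (tile (len n k) x i)}
            (fun _ => (1 : ℝ)) ω := by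
        refine Finset.measurable_sum _ fun i hi => measurable_const.indicator ?_
        have hsub := (show IsTile n k x _ from ⟨i, hi, rfl⟩).subset
        exact (ih _ (fun v hv => h1 v (hsub hv))
          (fun u hu v hv => h2 u (hsub hu) v (hsub hv))).compl
      have heq : ∀ ω, (((tileIdx d (n (k + 1))).filter fun i =>
          ¬ Good n w (X ω).1 (openGraph α lam (X ω)) k (tile (len n k) x i)).card : ℝ) =
          ∑ i ∈ tileIdx d (n (k + 1)),
          Set.indicator {ω | ¬ Good n w (X ω).1 (openGraph α lam (X ω)) k (tile (len n k) x i)}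
            (fun _ => (1 : ℝ)) ω := by
        intro ω
        rw [Finset.card_filter]
        push_cast
        exact Finset.sum_congr rfl fun i _ => by simp [Set.indicator_apply]
      have := measurableSet_le hmeas (measurable_const (a := (n (k + 1) : ℝ) ^ d / 2 ^ (k + 2)))
      refine this.congr ?_
      ext ω
      simp only [Set.mem_ofPred_eq, ← heq]
      exact Iff.of_eq (by congr!)
    · have : {ω | ∀ u ∈ box (len n (k + 1)) x, ∀ v ∈ box (len n (k + 1)) x, u ≠ v →
          w k ≤ (X ω).1 u → w (k + 1) ≤ (X ω).1 v → (openGraph α lam (X ω)).Adj u v} =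
          ⋂ u ∈ box (len n (k + 1)) x, ⋂ v ∈ box (len n (k + 1)) x,
            ({_ω | u ≠ v} ∩ ({ω | w k ≤ (X ω).1 u} ∩
              ({ω | w (k + 1) ≤ (X ω).1 v} ∩ {ω | (openGraph α lam (X ω)).Adj u v}ᶜ)))ᶜ := by
        ext ω
        simp only [Set.mem_ofPred_eq, Set.mem_iInter, Set.mem_compl_iff, Set.mem_inter_iff]
        refine forall₄_congr fun u _ v _ => ?_
        tauto
      refine MeasurableSet.congr ?_ this.symm
      refine MeasurableSet.biInter (box_finite _ x).countable fun u hu =>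
        MeasurableSet.biInter (box_finite _ x).countable fun v hv => ?_
      exact ((MeasurableSet.const _).inter
        ((measurableSet_le measurable_const (h1 u hu)).inter
        ((measurableSet_le measurable_const (h1 v hv)).inter
          (measurableSet_adj (h1 u hu) (h1 v hv) (h2 u hu v hv)).compl))).compl

end Measurability

/-! ### Probability estimates for one level of the hierarchy. -/

section Bounds

variable {d : ℕ}

/-- The box of side `m` at `x` as a finset. -/
def boxFinset (m : ℕ) (x : Fin d → ℤ) : Finset (Fin d → ℤ) := (tileIdx d m).image (tile 1 x)

theorem card_boxFinset (m : ℕ) (x : Fin d → ℤ) : (boxFinset m x).card = m ^ d := by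
  rw [boxFinset, Finset.card_image_of_injective _ (tile_injective one_pos x), card_tileIdx]

theorem mem_boxFinset {m : ℕ} {x v : Fin d → ℤ} : v ∈ boxFinset m x ↔ v ∈ box m x := by
  rw [boxFinset, Finset.mem_image]
  constructor
  · rintro ⟨i, hi, rfl⟩
    have := tile_box_subset (L := 1) x hi (self_mem_box one_pos _)
    rwa [one_mul] at this
  · intro hv
    obtain ⟨i, hi, h⟩ := exists_tile (L := 1) (N := m) one_pos (by rwa [one_mul])
    refine ⟨i, hi, funext fun t => ?_⟩
    obtain ⟨h1, h2⟩ := h t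
    push_cast at h2
    linarith

variable (ν : Measure ℝ) [IsProbabilityMeasure ν]

theorem measureReal_forall_lt_le {t p : ℝ} (hp : p ≤ ν.real (Set.Ici t)) (m : ℕ) (x : Fin d → ℤ) :
    (law d ν).real {ω | ∀ v ∈ box m x, ω.1 v < t} ≤ Real.exp (-((m : ℝ) ^ d * p)) := by
  have h := law_rect ν (boxFinset m x) ∅ (fun _ => Set.Iio t) (fun _ => Set.univ)
    (fun _ _ => measurableSet_Iio) (fun _ _ => MeasurableSet.univ)
  have h1 : {ω : Sample d | (∀ v ∈ boxFinset m x, ω.1 v ∈ Set.Iio t) ∧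
      ∀ e ∈ (∅ : Finset (Sym2 (Fin d → ℤ))), ω.2 e ∈ Set.univ} =
      {ω | ∀ v ∈ box m x, ω.1 v < t} := by
    ext ω; simp [mem_boxFinset]
  rw [h1, Finset.prod_const, Finset.prod_empty, mul_one, card_boxFinset] at h
  rw [measureReal_def, h, ENNReal.toReal_pow, ← measureReal_def]
  have h2 : ν.real (Set.Iio t) = 1 - ν.real (Set.Ici t) := by
    rw [← Set.compl_Ici, probReal_compl_eq_one_sub measurableSet_Ici]
  have h3 : ν.real (Set.Iio t) ≤ Real.exp (-p) := by
    rw [h2]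
    have := Real.one_sub_le_exp_neg p
    linarith
  calc ν.real (Set.Iio t) ^ (m ^ d) ≤ Real.exp (-p) ^ (m ^ d) :=
        pow_le_pow_left₀ measureReal_nonneg h3 _
    _ = Real.exp (-((m : ℝ) ^ d * p)) := by
        rw [← Real.exp_nat_mul]; push_cast; ring_nf

theorem volume_le_coe {q : ℝ} (h0 : 0 ≤ q) (h1 : q ≤ 1) :
    (volume : Measure unitInterval) {t | q ≤ (t : ℝ)} = ENNReal.ofReal (1 - q) := by
  have := unitInterval.volume_Ici (x := ⟨q, h0, h1⟩)
  rw [← this]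
  rfl

theorem volume_coe_lt {q : ℝ} (h0 : 0 ≤ q) (h1 : q ≤ 1) :
    (volume : Measure unitInterval) {t | (t : ℝ) < q} = ENNReal.ofReal q := by
  have := unitInterval.volume_Iio (x := ⟨q, h0, h1⟩)
  rw [← this]
  rfl

theorem l1Dist_pos {x y : Fin d → ℤ} (h : x ≠ y) : 0 < l1Dist x y := by
  obtain ⟨i, hi⟩ := Function.ne_iff.mp h
  refine Finset.sum_pos' (fun _ _ => abs_nonneg _) ⟨i, Finset.mem_univ i, abs_pos.mpr ?_⟩
  rw [sub_ne_zero]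
  exact_mod_cast hi

theorem l1Dist_le {x y : Fin d → ℤ} {m : ℕ} (h : ∀ i, |x i - y i| ≤ m) :
    l1Dist x y ≤ d * m := by
  have : ∀ i ∈ Finset.univ, |(x i : ℝ) - y i| ≤ m := fun i _ => by exact_mod_cast h i
  simpa [l1Dist] using Finset.sum_le_card_nsmul _ _ _ this

theorem l1Dist_le_of_mem_box {x u v : Fin d → ℤ} {m : ℕ} (hu : u ∈ box m x) (hv : v ∈ box m x) :
    l1Dist u v ≤ d * m :=
  l1Dist_le fun i => by
    obtain ⟨h1, h2⟩ := hu i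
    obtain ⟨h3, h4⟩ := hv i
    rw [abs_le]; constructor <;> linarith

theorem le_edgeProb {α lam a b D : ℝ} (hα : 0 < α) (hlam : 0 < lam) (ha : 0 ≤ a) (hb : 0 ≤ b)
    {W : (Fin d → ℤ) → ℝ} {u v : Fin d → ℤ} (huv : u ≠ v) (hD : l1Dist u v ≤ D)
    (hu : a ≤ W u) (hv : b ≤ W v) :
    1 - Real.exp (-(lam * (a * b / D ^ α))) ≤ edgeProb α lam W u v := by
  have h0 := l1Dist_pos huv
  have h1 : 0 < l1Dist u v ^ α := Real.rpow_pos_of_pos h0 _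
  have h2 : l1Dist u v ^ α ≤ D ^ α := Real.rpow_le_rpow h0.le hD hα.le
  have h3 : a * b / D ^ α ≤ W u * W v / l1Dist u v ^ α :=
    div_le_div₀ (mul_nonneg (ha.trans hu) (hb.trans hv)) (mul_le_mul hu hv hb (ha.trans hu)) h1 h2
  unfold edgeProb
  gcongr

/-- By Tonelli it suffices to fix the weights. If both are heavy, a missing edge forces its mark to
be at least `q`; otherwise the event is empty. -/
theorem measureReal_not_adj_le {α lam a b D : ℝ} (hα : 0 < α) (hlam : 0 < lam) (ha : 0 ≤ a)
    (hb : 0 ≤ b) {u v : Fin d → ℤ} (huv : u ≠ v) (hD : l1Dist u v ≤ D) :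
    (law d ν).real {ω | a ≤ ω.1 u ∧ b ≤ ω.1 v ∧ ¬ (openGraph α lam ω).Adj u v} ≤
      Real.exp (-(lam * (a * b / D ^ α))) := by
  set q : ℝ := 1 - Real.exp (-(lam * (a * b / D ^ α))) with hq
  have hm : MeasurableSet {ω : Sample d | a ≤ ω.1 u ∧ b ≤ ω.1 v ∧
      ¬ (openGraph α lam ω).Adj u v} := by
    have h1 : ∀ z, Measurable fun ω : Sample d => ω.1 z := fun z =>
      (measurable_pi_apply z).comp measurable_fst
    have h2 : Measurable fun ω : Sample d => ω.2 s(u, v) :=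
      (measurable_pi_apply s(u, v)).comp measurable_snd
    exact (measurableSet_le measurable_const (h1 u)).inter
      ((measurableSet_le measurable_const (h1 v)).inter
        (measurableSet_adj (X := id) (h1 u) (h1 v) h2).compl)
  have hD0 : 0 ≤ D := (l1Dist_pos huv).le.trans hD
  have hq0 : 0 ≤ q := by
    have : Real.exp (-(lam * (a * b / D ^ α))) ≤ 1 := by
      rw [Real.exp_le_one_iff, neg_nonpos]
      have := Real.rpow_nonneg hD0 α
      positivity
    linarith
  have hq1 : q ≤ 1 := by linarith [Real.exp_pos (-(lam * (a * b / D ^ α)))]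
  have hle : law d ν {ω | a ≤ ω.1 u ∧ b ≤ ω.1 v ∧ ¬ (openGraph α lam ω).Adj u v} ≤
      ENNReal.ofReal (1 - q) := by
    rw [law, Measure.prod_apply hm]
    calc _ ≤ ∫⁻ _ : (Fin d → ℤ) → ℝ, ENNReal.ofReal (1 - q)
          ∂(Measure.infinitePi fun _ : Fin d → ℤ => ν) := by
          refine lintegral_mono fun W => ?_
          have hsub : Prod.mk W ⁻¹' {ω : Sample d | a ≤ ω.1 u ∧ b ≤ ω.1 v ∧
              ¬ (openGraph α lam ω).Adj u v} ⊆
              Function.eval s(u, v) ⁻¹' {t : unitInterval | q ≤ (t : ℝ)} := by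
            rintro U ⟨h1, h2, h3⟩
            have h4 := le_edgeProb hα hlam ha hb huv hD h1 h2
            by_contra h5
            exact h3 ⟨huv, lt_of_lt_of_le (not_le.mp h5) h4⟩
          refine (measure_mono hsub).trans ?_
          rw [(measurePreserving_eval_infinitePi _ s(u, v)).measure_preimage
            (measurableSet_le measurable_const measurable_subtype_coe).nullMeasurableSet,
            volume_le_coe hq0 hq1]
      _ = _ := by simp
  rw [measureReal_def]
  refine ENNReal.toReal_le_of_le_ofReal (Real.exp_pos _).le (hle.trans (le_of_eq ?_))
  rw [hq, sub_sub_cancel]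

/-- Union bound over all subsets of more than `a` indices. The crude count `2 ^ I.card` of subsets
is affordable because `q` will be very small. -/
theorem measureReal_card_gt_le {Ω ι : Type*} [MeasurableSpace Ω] (μ : Measure Ω)
    [IsProbabilityMeasure μ] (I : Finset ι) (E : ι → Set Ω)
    [∀ ω, DecidablePred fun i => ω ∈ E i] {q a : ℝ} (hq0 : 0 ≤ q) (hq1 : q ≤ 1)
    (ha : 0 < a) (hE : ∀ s ⊆ I, μ.real (⋂ i ∈ s, E i) ≤ q ^ s.card) :
    μ.real {ω | a < ((I.filter fun i => ω ∈ E i).card : ℝ)} ≤ 2 ^ I.card * q ^ a := by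
  have hsub : {ω | a < ((I.filter fun i => ω ∈ E i).card : ℝ)} ⊆
      ⋃ s ∈ I.powerset.filter fun s => a < (s.card : ℝ), ⋂ i ∈ s, E i := by
    intro ω hω
    simp only [Set.mem_iUnion, Finset.mem_filter, Finset.mem_powerset]
    refine ⟨I.filter fun i => ω ∈ E i, ⟨Finset.filter_subset _ _, hω⟩, ?_⟩
    simp only [Set.mem_iInter, Finset.mem_filter]
    exact fun i hi => hi.2
  calc μ.real {ω | a < ((I.filter fun i => ω ∈ E i).card : ℝ)}
      ≤ μ.real (⋃ s ∈ I.powerset.filter fun s => a < (s.card : ℝ), ⋂ i ∈ s, E i) :=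
        measureReal_mono hsub (measure_ne_top _ _)
    _ ≤ ∑ s ∈ I.powerset.filter fun s => a < (s.card : ℝ), μ.real (⋂ i ∈ s, E i) :=
        measureReal_biUnion_finset_le _ _
    _ ≤ ∑ _s ∈ I.powerset.filter fun s => a < (s.card : ℝ), q ^ a := by
        refine Finset.sum_le_sum fun s hs => ?_
        rw [Finset.mem_filter, Finset.mem_powerset] at hs
        refine (hE s hs.1).trans ?_
        rcases hq0.eq_or_lt with rfl | hq0
        · have : s.card ≠ 0 := by
            rintro h
            rw [h] at hs
            exact absurd (ha.trans hs.2) (by simp)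
          rw [zero_pow this, Real.zero_rpow ha.ne']
        · rw [← Real.rpow_natCast]
          exact Real.rpow_le_rpow_of_exponent_ge hq0 hq1 hs.2.le
    _ ≤ ∑ _s ∈ I.powerset, q ^ a :=
        Finset.sum_le_sum_of_subset_of_nonneg (Finset.filter_subset _ _)
          fun _ _ _ => Real.rpow_nonneg hq0 _
    _ = 2 ^ I.card * q ^ a := by
        rw [Finset.sum_const, Finset.card_powerset, nsmul_eq_mul]; push_cast; rfl

variable {n : ℕ → ℕ} {w : ℕ → ℝ} {α lam : ℝ}

theorem measurableSet_goodEvent (n : ℕ → ℕ) (w : ℕ → ℝ) (α lam : ℝ) (k : ℕ) (x : Fin d → ℤ) :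
    MeasurableSet[sigmaOn (coordsIn (box (len n k) x))]
      {ω : Sample d | Good n w ω.1 (openGraph α lam ω) k x} := by
  refine @measurableSet_good d (Sample d) (sigmaOn (coordsIn (box (len n k) x))) α lam n w id k x
    (fun v hv => measurable_weight hv) (fun u hu v hv => measurable_mark ?_)
  intro z hz
  rcases Sym2.mem_iff.mp hz with rfl | rfl
  · exact hu
  · exact hv

theorem measureReal_not_good_zero_le {p : ℝ} (hp : p ≤ ν.real (Set.Ici (w 0))) (x : Fin d → ℤ) :
    (law d ν).real {ω | ¬ Good n w ω.1 (openGraph α lam ω) 0 x} ≤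
      Real.exp (-((len n 0 : ℝ) ^ d * p)) := by
  refine le_trans (measureReal_mono ?_) (measureReal_forall_lt_le ν hp (n 0) x)
  intro ω hω v hv
  by_contra h
  exact hω ⟨v, hv, not_lt.mp h⟩

/-- The three terms correspond to the three ways to fail: no heavy vertex, too many bad tiles
(independent, as the tiles are disjoint), or a missing edge between two heavy vertices. -/
theorem measureReal_not_good_succ_le (hα : 0 < α) (hlam : 0 < lam) (hn : ∀ k, 0 < n k)
    (hw : ∀ k, 0 ≤ w k) {k : ℕ} {p q : ℝ} (hp : p ≤ ν.real (Set.Ici (w (k + 1))))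
    (hq1 : q ≤ 1) (hq : ∀ x : Fin d → ℤ,
      (law d ν).real {ω | ¬ Good n w ω.1 (openGraph α lam ω) k x} ≤ q) (x : Fin d → ℤ) :
    (law d ν).real {ω | ¬ Good n w ω.1 (openGraph α lam ω) (k + 1) x} ≤
      Real.exp (-((len n (k + 1) : ℝ) ^ d * p)) +
      2 ^ (n (k + 1) ^ d) * q ^ ((n (k + 1) : ℝ) ^ d / 2 ^ (k + 2)) +
      ((len n (k + 1) : ℝ) ^ d) ^ 2 *
        Real.exp (-(lam * (w k * w (k + 1) / (d * len n (k + 1)) ^ α))) := by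
  classical
  set M := len n (k + 1) with hM
  set E : (Fin d → ℕ) → Set (Sample d) := fun i =>
    {ω | ¬ Good n w ω.1 (openGraph α lam ω) k (tile (len n k) x i)} with hE
  set a : ℝ := (n (k + 1) : ℝ) ^ d / 2 ^ (k + 2) with ha
  have hn' : (0 : ℝ) < n (k + 1) := by exact_mod_cast hn (k + 1)
  have ha0 : 0 < a := by positivity
  have hq0 : 0 ≤ q := measureReal_nonneg.trans (hq x)
  have hA := measureReal_forall_lt_le ν hp M x
  have hB : (law d ν).real {ω | a < (((tileIdx d (n (k + 1))).filter fun i => ω ∈ E i).card : ℝ)} ≤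
      2 ^ (n (k + 1) ^ d) * q ^ a := by
    have hgt := measureReal_card_gt_le (law d ν) (tileIdx d (n (k + 1))) E hq0 hq1 ha0
    rw [card_tileIdx] at hgt
    refine hgt fun s hs => ?_
    have hEm : ∀ i, MeasurableSet[sigmaOn (coordsIn (box (len n k) (tile (len n k) x i)))] (E i) :=
      fun i => @MeasurableSet.compl _ _ (sigmaOn (coordsIn (box (len n k) (tile (len n k) x i))))
        (measurableSet_goodEvent n w α lam k _)
    have hJ : (s : Set (Fin d → ℕ)).PairwiseDisjoint
        fun i => coordsIn (box (len n k) (tile (len n k) x i)) := by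
      intro i hi j hj hij
      refine coordsIn_disjoint (Set.disjoint_left.mpr fun v hvi hvj => hij ?_)
      have hi' : IsTile n k x (tile (len n k) x i) := ⟨i, hs hi, rfl⟩
      have hj' : IsTile n k x (tile (len n k) x j) := ⟨j, hs hj, rfl⟩
      exact tile_injective (len_pos hn k) x (hi'.eq hj' hvi hvj)
    have heq := measureReal_biInter_sigmaOn ν s hJ fun i _ => hEm i
    rw [heq, ← Finset.prod_const]
    exact Finset.prod_le_prod (fun _ _ => measureReal_nonneg) fun i _ => hq _
  set F : (Fin d → ℤ) × (Fin d → ℤ) → Set (Sample d) := fun z =>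
    {ω | w k ≤ ω.1 z.1 ∧ w (k + 1) ≤ ω.1 z.2 ∧ ¬ (openGraph α lam ω).Adj z.1 z.2} with hF
  set P := ((boxFinset M x) ×ˢ (boxFinset M x)).filter fun z => z.1 ≠ z.2 with hP
  have hC : (law d ν).real (⋃ z ∈ P, F z) ≤
      ((M : ℝ) ^ d) ^ 2 * Real.exp (-(lam * (w k * w (k + 1) / (d * M) ^ α))) := by
    refine (measureReal_biUnion_finset_le _ _).trans ?_
    have hle : ∀ z ∈ P, (law d ν).real (F z) ≤
        Real.exp (-(lam * (w k * w (k + 1) / (d * M) ^ α))) := by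
      intro z hz
      rw [hP, Finset.mem_filter, Finset.mem_product, mem_boxFinset, mem_boxFinset] at hz
      exact measureReal_not_adj_le ν hα hlam (hw k) (hw (k + 1)) hz.2
        (l1Dist_le_of_mem_box hz.1.1 hz.1.2)
    refine (Finset.sum_le_card_nsmul _ _ _ hle).trans ?_
    rw [nsmul_eq_mul]
    refine mul_le_mul_of_nonneg_right ?_ (Real.exp_pos _).le
    have : P.card ≤ (M ^ d) ^ 2 := by
      refine (Finset.card_filter_le _ _).trans ?_
      rw [Finset.card_product, card_boxFinset, sq]
    exact_mod_cast this
  have hsub : {ω | ¬ Good n w ω.1 (openGraph α lam ω) (k + 1) x} ⊆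
      ({ω | ∀ v ∈ box M x, ω.1 v < w (k + 1)} ∪
      {ω | a < (((tileIdx d (n (k + 1))).filter fun i => ω ∈ E i).card : ℝ)}) ∪
      ⋃ z ∈ P, F z := by
    intro ω hω
    by_contra hcon
    rw [Set.mem_union, Set.mem_union, not_or, not_or] at hcon
    obtain ⟨⟨h1, h2⟩, h3⟩ := hcon
    apply hω
    refine ⟨?_, ?_, ?_⟩
    · by_contra h
      apply h1
      intro v hv
      by_contra hlt
      exact h ⟨v, hv, not_lt.mp hlt⟩
    · by_contra hlt
      apply h2
      have := not_le.mp hlt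
      refine lt_of_lt_of_eq this (congrArg (fun s : Finset (Fin d → ℕ) => (s.card : ℝ)) ?_)
      ext i
      simp [hE]
    · intro u hu v hv huv hwu hwv
      by_contra hadj
      apply h3
      simp only [Set.mem_iUnion]
      refine ⟨(u, v), ?_, hwu, hwv, hadj⟩
      rw [hP, Finset.mem_filter, Finset.mem_product, mem_boxFinset, mem_boxFinset]
      exact ⟨⟨hu, hv⟩, huv⟩
  calc _ ≤ _ := measureReal_mono hsub (measure_ne_top _ _)
    _ ≤ _ := measureReal_union_le _ _
    _ ≤ _ := add_le_add ((measureReal_union_le _ _).trans (add_le_add hA hB)) hC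

end Bounds

/-! ### Solving the recursion for the failure probability. -/

theorem eventually_rpow_mul_exp_le {a s ξ : ℝ} (ha : 0 < a) (hξ : 0 < ξ) (hs : ξ < s) (b : ℝ) :
    ∀ᶠ M : ℝ in atTop, M ^ b * Real.exp (-(a * M ^ s)) ≤ Real.exp (-M ^ ξ) / 3 := by
  have hs0 : 0 < s := hξ.trans hs
  have h1 : ∀ᶠ M : ℝ in atTop, 3 / a ≤ M ^ (s - ξ) :=
    (tendsto_rpow_atTop (by linarith)).eventually_ge_atTop _
  have h2 : ∀ᶠ M : ℝ in atTop, Real.log 3 * 3 / a ≤ M ^ s :=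
    (tendsto_rpow_atTop hs0).eventually_ge_atTop _
  have h3 : ∀ᶠ M : ℝ in atTop, ‖Real.log M‖ ≤ a / (3 * (|b| + 1)) * ‖M ^ s‖ :=
    (isLittleO_log_rpow_atTop hs0).bound (by positivity)
  filter_upwards [h1, h2, h3, eventually_gt_atTop 1] with M h1 h2 h3 hM
  have hM0 : 0 < M := by linarith
  have hMs : 0 < M ^ s := Real.rpow_pos_of_pos hM0 s
  have hMξ : 0 < M ^ ξ := Real.rpow_pos_of_pos hM0 ξ
  -- The exponent `a * M ^ s` is split into three thirds, paying for `M ^ ξ`, for the factor `1 / 3`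
  -- and for the polynomial `M ^ b`. The factor `1 / 3` leaves room for the sum of three failure
  -- terms.
  have e1 : M ^ ξ ≤ a / 3 * M ^ s := by
    have : M ^ s = M ^ ξ * M ^ (s - ξ) := by rw [← Real.rpow_add hM0]; ring_nf
    rw [this]
    have h4 : 1 ≤ a / 3 * M ^ (s - ξ) := by
      rw [div_le_iff₀ ha] at h1
      linarith
    nlinarith
  have e2 : Real.log 3 ≤ a / 3 * M ^ s := by
    rw [div_le_iff₀ ha] at h2
    linarith
  have e3 : b * Real.log M ≤ a / 3 * M ^ s := by
    have hlog : 0 ≤ Real.log M := Real.log_nonneg hM.le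
    rw [Real.norm_of_nonneg hlog, Real.norm_of_nonneg hMs.le] at h3
    have hb : b ≤ |b| + 1 := (le_abs_self b).trans (by linarith)
    calc b * Real.log M ≤ (|b| + 1) * Real.log M := mul_le_mul_of_nonneg_right hb hlog
      _ ≤ (|b| + 1) * (a / (3 * (|b| + 1)) * M ^ s) := by gcongr
      _ = a / 3 * M ^ s := by
          have : |b| + 1 ≠ 0 := by positivity
          field_simp
  rw [Real.rpow_def_of_pos hM0, ← Real.exp_add]
  have h5 : Real.exp (-M ^ ξ) / 3 = Real.exp (-M ^ ξ - Real.log 3) := by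
    rw [Real.exp_sub, Real.exp_log (by norm_num)]
  rw [h5, Real.exp_le_exp]
  linarith [mul_comm b (Real.log M)]

theorem rpow_pow_le_len {n : ℕ → ℕ} {η : ℝ} (hη : 0 < η) (k : ℕ)
    (h : ∀ j < k, (len n j : ℝ) ^ (1 + η) ≤ len n (j + 1)) :
    (n 0 : ℝ) ^ ((1 + η) ^ k) ≤ len n k := by
  induction k with
  | zero => simp [len]
  | succ k ih =>
    refine le_trans ?_ (h k (Nat.lt_succ_self k))
    rw [pow_succ, Real.rpow_mul (by positivity)]
    exact Real.rpow_le_rpow (by positivity) (ih fun j hj => h j (hj.trans (Nat.lt_succ_self k)))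
      (by linarith)

/-- Bernoulli's inequality `1 + k * η ≤ (1 + η) ^ k` reduces doubly exponential growth to a
geometric one. The bound ensures that allowing only a fraction `2 ^ (-(k + 2))` of bad tiles costs
little. -/
theorem two_pow_le_len_rpow {n : ℕ → ℕ} (hn : ∀ k, 0 < n k) {η ξ : ℝ} (hη : 0 < η) (hξ : 0 < ξ)
    (h8 : 8 ≤ (n 0 : ℝ) ^ ξ) (h2 : 2 ≤ (n 0 : ℝ) ^ (ξ * η)) (k : ℕ)
    (h : ∀ j < k, (len n j : ℝ) ^ (1 + η) ≤ len n (j + 1)) :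
    (2 : ℝ) ^ (k + 3) ≤ (len n k : ℝ) ^ ξ := by
  have hn0 : (1 : ℝ) ≤ n 0 := by exact_mod_cast hn 0
  have hb : 1 + (k : ℝ) * η ≤ (1 + η) ^ k := one_add_mul_le_pow (by linarith) k
  calc (2 : ℝ) ^ (k + 3) = 8 * 2 ^ k := by ring
    _ ≤ (n 0 : ℝ) ^ ξ * ((n 0 : ℝ) ^ (ξ * η)) ^ k := by gcongr
    _ = (n 0 : ℝ) ^ ((1 + (k : ℝ) * η) * ξ) := by
        rw [← Real.rpow_natCast, ← Real.rpow_mul (by positivity), ← Real.rpow_add (by linarith)]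
        ring_nf
    _ ≤ (n 0 : ℝ) ^ ((1 + η) ^ k * ξ) :=
        Real.rpow_le_rpow_of_exponent_le hn0 (by gcongr)
    _ = ((n 0 : ℝ) ^ ((1 + η) ^ k)) ^ ξ := by rw [Real.rpow_mul (by positivity)]
    _ ≤ (len n k : ℝ) ^ ξ :=
        Real.rpow_le_rpow (by positivity) (rpow_pow_le_len hη k h) hξ.le

/-- The sequence of heavy-weight thresholds. -/
noncomputable def thr (n : ℕ → ℕ) (β : ℝ) (k : ℕ) : ℝ := (len n k : ℝ) ^ β

/-- Both `ξ` and `m` are chosen before the scales, and only the scales up to level `k` are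
constrained. This uniformity allows the last scale to be adapted later to a prescribed side. -/
theorem exists_measureReal_not_good_le {d : ℕ} (hd : 1 ≤ d) {α τ lam c β η : ℝ} (hα : 0 < α)
    (hτ : 1 < τ) (hlam : 0 < lam) (hc : 0 < c) (hβ1 : α / 2 < β) (hβ2 : β * (τ - 1) < d)
    (hη : 0 < η) (ν : Measure ℝ) [IsProbabilityMeasure ν]
    (hν : ∀ w : ℝ, 0 < w → min (c * w ^ (-(τ - 1))) 1 ≤ ν.real (Set.Ici w)) :
    ∃ ξ : ℝ, 0 < ξ ∧ ∃ m : ℕ, ∀ n : ℕ → ℕ, (∀ k, 0 < n k) → m ≤ n 0 → ∀ k,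
      (∀ j < k, (len n j : ℝ) ^ (1 + η) ≤ len n (j + 1) ∧
        (len n (j + 1) : ℝ) ≤ (len n j : ℝ) ^ (2 * β / α)) →
      (2 : ℝ) ^ (k + 3) ≤ (len n k : ℝ) ^ ξ ∧
      ∀ x : Fin d → ℤ,
        (law d ν).real {ω | ¬ Good n (thr n β) ω.1 (openGraph α lam ω) k x} ≤
          Real.exp (-(len n k : ℝ) ^ ξ) := by
  have hd0 : (0 : ℝ) < d := by exact_mod_cast hd
  have hβ0 : 0 < β := by linarith
  set κ := 2 * β / α with hκ
  have hκ0 : 0 < κ := by positivity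
  set δ := d - β * (τ - 1) with hδ
  have hδ0 : 0 < δ := by linarith
  set ε := β - α / 2 with hε
  have hε0 : 0 < ε := by linarith
  -- The three failure terms decay like `exp` of minus a constant times `M ^ δ`, `M ^ (η / κ)` and
  -- `M ^ ε`, the last up to a polynomial factor; `ξ` lies below all three exponents.
  obtain ⟨ξ, hξ0, hξ⟩ : ∃ ξ : ℝ, 0 < ξ ∧ ξ < min δ (min (η / κ) ε) :=
    exists_between (lt_min hδ0 (lt_min (by positivity) hε0))
  rw [lt_min_iff, lt_min_iff] at hξ
  obtain ⟨hξ1, hξ2, hξ3⟩ := hξ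
  have hc1 : 0 < min c 1 := lt_min hc one_pos
  have ev1 := eventually_rpow_mul_exp_le hc1 hξ0 hξ1 0
  have ev2 := eventually_rpow_mul_exp_le one_pos hξ0 hξ2 0
  have ev3 := eventually_rpow_mul_exp_le (a := lam / (d : ℝ) ^ α) (by positivity) hξ0 hξ3
    ((d : ℝ) * 2)
  have ev4 : ∀ᶠ M : ℝ in atTop, 8 ≤ M ^ ξ := (tendsto_rpow_atTop hξ0).eventually_ge_atTop _
  have ev5 : ∀ᶠ M : ℝ in atTop, 2 ≤ M ^ (ξ * η) :=
    (tendsto_rpow_atTop (by positivity)).eventually_ge_atTop _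
  obtain ⟨R, hR⟩ := (ev1.and (ev2.and (ev3.and (ev4.and ev5)))).exists_forall_of_atTop
  refine ⟨ξ, hξ0, ⌈R⌉₊, fun n hn hnR => ?_⟩
  have hn0R : R ≤ n 0 := (Nat.le_ceil R).trans (by exact_mod_cast hnR)
  have hlenR : ∀ k, R ≤ len n k := fun k =>
    hn0R.trans (by exact_mod_cast len_mono hn (Nat.zero_le k))
  have hlen1 : ∀ k, (1 : ℝ) ≤ len n k := fun k => by exact_mod_cast len_pos hn k
  have htwo : ∀ k, (∀ j < k, (len n j : ℝ) ^ (1 + η) ≤ len n (j + 1) ∧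
      (len n (j + 1) : ℝ) ≤ (len n j : ℝ) ^ κ) → (2 : ℝ) ^ (k + 3) ≤ (len n k : ℝ) ^ ξ :=
    fun k h => two_pow_le_len_rpow hn hη hξ0 (hR _ hn0R).2.2.2.1 (hR _ hn0R).2.2.2.2 k
      fun j hj => (h j hj).1
  have hthr : ∀ k, 0 < thr n β k := fun k => by
    have := hlen1 k
    unfold thr
    positivity
  have hpa : ∀ k, Real.exp (-((len n k : ℝ) ^ d * min (c * (thr n β k) ^ (-(τ - 1))) 1)) ≤
      Real.exp (-(len n k : ℝ) ^ ξ) / 3 := by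
    intro k
    have h1 := (hR _ (hlenR k)).1
    rw [Real.rpow_zero, one_mul] at h1
    refine le_trans ?_ h1
    rw [Real.exp_le_exp, neg_le_neg_iff]
    have hM := hlen1 k
    set M : ℝ := (len n k : ℝ)
    have hM0 : 0 < M := by linarith
    have e1 : M ^ d * (c * (thr n β k) ^ (-(τ - 1))) = c * M ^ δ := by
      rw [thr, ← Real.rpow_mul hM0.le, ← Real.rpow_natCast, mul_left_comm, ← Real.rpow_add hM0, hδ]
      ring_nf
    have e2 : M ^ δ ≤ M ^ d := by
      rw [← Real.rpow_natCast]
      refine Real.rpow_le_rpow_of_exponent_le hM ?_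
      have : 0 < β * (τ - 1) := mul_pos hβ0 (by linarith)
      linarith
    have e3 : 0 < M ^ δ := Real.rpow_pos_of_pos hM0 _
    rw [mul_min_of_nonneg _ _ (by positivity), e1, mul_one]
    refine le_min ?_ ?_
    · exact mul_le_mul_of_nonneg_right (min_le_left _ _) e3.le
    · refine le_trans ?_ e2
      exact mul_le_of_le_one_left e3.le (min_le_right _ _)
  intro k
  induction k with
  | zero =>
    intro h
    refine ⟨htwo 0 h, fun x => ?_⟩
    refine (measureReal_not_good_zero_le ν (hν _ (hthr 0)) x).trans ((hpa 0).trans ?_)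
    linarith [Real.exp_pos (-(len n 0 : ℝ) ^ ξ)]
  | succ k ih =>
    intro h
    refine ⟨htwo (k + 1) h, fun x => ?_⟩
    obtain ⟨ih1, ih2⟩ := ih fun j hj => h j (hj.trans (Nat.lt_succ_self k))
    obtain ⟨hk1, hk2⟩ := h k (Nat.lt_succ_self k)
    have hq1 : Real.exp (-(len n k : ℝ) ^ ξ) ≤ 1 := by
      rw [Real.exp_le_one_iff]
      have := Real.rpow_nonneg (zero_le_one.trans (hlen1 k)) ξ
      linarith
    refine (measureReal_not_good_succ_le ν hα hlam hn (fun k => (hthr k).le)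
      (hν _ (hthr (k + 1))) hq1 ih2 x).trans ?_
    obtain ⟨-, hR2, hR3, -⟩ := hR _ (hlenR (k + 1))
    rw [Real.rpow_zero, one_mul] at hR2
    have hL1 := hlen1 k
    have hM1 := hlen1 (k + 1)
    have hlen : (len n (k + 1) : ℝ) = len n k * n (k + 1) := by simp [len]
    have hT := hpa (k + 1)
    set M : ℝ := (len n (k + 1) : ℝ) with hMdef
    set L : ℝ := (len n k : ℝ) with hLdef
    have hM0 : 0 < M := by linarith
    have hL0 : 0 < L := by linarith
    have hLM : M ^ (1 / κ) ≤ L := by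
      calc M ^ (1 / κ) ≤ (L ^ κ) ^ (1 / κ) := Real.rpow_le_rpow hM0.le hk2 (by positivity)
        _ = L := by rw [← Real.rpow_mul hL0.le, mul_one_div_cancel hκ0.ne', Real.rpow_one]
    have hN : M ^ (η / κ) ≤ (n (k + 1) : ℝ) ^ d := by
      have e1 : L ^ η ≤ n (k + 1) := by
        have : L * L ^ η ≤ L * n (k + 1) := by
          rw [← hlen]
          refine le_trans (le_of_eq ?_) hk1
          rw [Real.rpow_add hL0, Real.rpow_one]
        exact le_of_mul_le_mul_left this hL0
      have e2 : (n (k + 1) : ℝ) ≤ (n (k + 1) : ℝ) ^ d := by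
        have : (1 : ℝ) ≤ n (k + 1) := by exact_mod_cast hn (k + 1)
        exact le_self_pow₀ this (by omega)
      calc M ^ (η / κ) = (M ^ (1 / κ)) ^ η := by
            rw [← Real.rpow_mul hM0.le]; ring_nf
        _ ≤ L ^ η := Real.rpow_le_rpow (by positivity) hLM hη.le
        _ ≤ _ := e1.trans e2
    have hb : (2 : ℝ) ^ (n (k + 1) ^ d) *
        Real.exp (-L ^ ξ) ^ ((n (k + 1) : ℝ) ^ d / 2 ^ (k + 2)) ≤ Real.exp (-M ^ ξ) / 3 := by
      set N : ℝ := (n (k + 1) : ℝ) ^ d with hNdef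
      have hN0 : 0 ≤ N := by positivity
      have e1 : (2 : ℝ) ^ (n (k + 1) ^ d) ≤ Real.exp N := by
        have h2e : (2 : ℝ) ≤ Real.exp 1 := by
          have := Real.add_one_le_exp 1
          linarith
        calc (2 : ℝ) ^ (n (k + 1) ^ d) ≤ Real.exp 1 ^ (n (k + 1) ^ d) :=
              pow_le_pow_left₀ (by norm_num) h2e _
          _ = Real.exp N := by rw [← Real.exp_nat_mul, hNdef]; push_cast; ring_nf
      -- The bound `2 ^ (k + 3) ≤ L ^ ξ` yields the exponent `2 * N`, which beats the number `2 ^ N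
      -- ≤ exp N` of sets of tiles.
      have e2 : Real.exp (-L ^ ξ) ^ (N / 2 ^ (k + 2)) ≤ Real.exp (-(2 * N)) := by
        rw [← Real.exp_mul, Real.exp_le_exp]
        have e3 : 2 ^ (k + 3) * (N / 2 ^ (k + 2)) = 2 * N := by
          rw [pow_succ (2 : ℝ) (k + 2)]; field_simp
        have : 2 ^ (k + 3) * (N / 2 ^ (k + 2)) ≤ L ^ ξ * (N / 2 ^ (k + 2)) := by gcongr
        linarith
      calc _ ≤ Real.exp N * Real.exp (-(2 * N)) :=
            mul_le_mul e1 e2 (Real.rpow_nonneg (Real.exp_pos _).le _) (Real.exp_pos _).le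
        _ = Real.exp (-N) := by rw [← Real.exp_add]; ring_nf
        _ ≤ Real.exp (-(1 * M ^ (η / κ))) := by
            rw [Real.exp_le_exp, one_mul]; linarith
        _ ≤ _ := hR2
    have hcc : (M ^ d) ^ 2 * Real.exp (-(lam * (thr n β k * thr n β (k + 1) / (d * M) ^ α))) ≤
        Real.exp (-M ^ ξ) / 3 := by
      have e1 : (M ^ d) ^ 2 = M ^ ((d : ℝ) * 2) := by
        rw [Real.rpow_mul hM0.le, Real.rpow_natCast]
        norm_cast
      have e2 : lam / (d : ℝ) ^ α * M ^ ε ≤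
          lam * (thr n β k * thr n β (k + 1) / (d * M) ^ α) := by
        -- This is where `M ≤ L ^ (2 * β / α)` enters: the lighter endpoint still has weight at
        -- least `M ^ (α / 2)`.
        have e3 : M ^ (α / 2) ≤ thr n β k := by
          calc M ^ (α / 2) = (M ^ (1 / κ)) ^ β := by
                rw [← Real.rpow_mul hM0.le, hκ]; congr 1; field_simp
            _ ≤ L ^ β := Real.rpow_le_rpow (by positivity) hLM hβ0.le
        have e4 : M ^ ε = M ^ (α / 2) * M ^ β / M ^ α := by
          rw [← Real.rpow_add hM0, ← Real.rpow_sub hM0, hε]; ring_nf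
        rw [e4, Real.mul_rpow hd0.le hM0.le]
        have e5 : thr n β (k + 1) = M ^ β := rfl
        rw [e5]
        calc lam / (d : ℝ) ^ α * (M ^ (α / 2) * M ^ β / M ^ α)
            = lam * (M ^ (α / 2) * M ^ β / ((d : ℝ) ^ α * M ^ α)) := by field_simp
          _ ≤ _ := by gcongr
      rw [e1]
      refine le_trans ?_ hR3
      gcongr
    linarith

/-- Scales growing at a rate between `1 + (θ - 1) / 2` and `θ`. -/
theorem exists_scales {θ : ℝ} (hθ : 1 < θ) (m : ℕ) :
    ∃ n : ℕ → ℕ, m ≤ n 0 ∧ (∀ k, 0 < n k) ∧ ∀ k,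
      (len n k : ℝ) ^ (1 + (θ - 1) / 2) ≤ len n (k + 1) ∧
      (len n (k + 1) : ℝ) ≤ (len n k : ℝ) ^ θ := by
  have hθ' : 0 < (θ - 1) / 2 := by linarith
  obtain ⟨R, hR⟩ := ((tendsto_rpow_atTop hθ').eventually_ge_atTop 2).exists_forall_of_atTop
  set m0 : ℕ := max m (max 1 ⌈R⌉₊) with hm0
  have hm0R : R ≤ m0 := (Nat.le_ceil R).trans (by
    exact_mod_cast (le_max_right _ _).trans (le_max_right _ _))
  have hm01 : 1 ≤ m0 := (le_max_left _ _).trans (le_max_right _ _)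
  -- The branching number depends on the side already reached, so the sides `f` are defined
  -- recursively and `n` is read off from them.
  let g : ℕ → ℕ := fun L => ⌊(L : ℝ) ^ (θ - 1)⌋₊
  let f : ℕ → ℕ := fun k => Nat.rec m0 (fun _ L => L * g L) k
  let n : ℕ → ℕ := fun k => match k with
    | 0 => m0
    | j + 1 => g (f j)
  have hlen : ∀ k, len n k = f k := by
    intro k
    induction k with
    | zero => rfl
    | succ k ih => simp only [len, ih]; rfl
  have hstep : ∀ L : ℕ, m0 ≤ L → 0 < ⌊(L : ℝ) ^ (θ - 1)⌋₊ ∧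
      (L : ℝ) ^ (1 + (θ - 1) / 2) ≤ (L * ⌊(L : ℝ) ^ (θ - 1)⌋₊ : ℕ) ∧
      ((L * ⌊(L : ℝ) ^ (θ - 1)⌋₊ : ℕ) : ℝ) ≤ (L : ℝ) ^ θ := by
    intro L hL
    have hLR : R ≤ L := hm0R.trans (by exact_mod_cast hL)
    have hL0 : (0 : ℝ) < L := by exact_mod_cast (Nat.lt_of_lt_of_le hm01 hL)
    have h2 := hR _ hLR
    have hsq : (L : ℝ) ^ (θ - 1) = (L : ℝ) ^ ((θ - 1) / 2) * (L : ℝ) ^ ((θ - 1) / 2) := by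
      rw [← Real.rpow_add hL0]; ring_nf
    -- With `y = L ^ ((θ - 1) / 2) ≥ 2`, rounding down costs less than one and `y ^ 2 - 1 ≥ y`.
    have hfl : (L : ℝ) ^ ((θ - 1) / 2) ≤ ⌊(L : ℝ) ^ (θ - 1)⌋₊ := by
      have := Nat.lt_floor_add_one ((L : ℝ) ^ (θ - 1))
      rw [hsq] at this ⊢
      nlinarith
    refine ⟨?_, ?_, ?_⟩
    · have : (0 : ℝ) < ⌊(L : ℝ) ^ (θ - 1)⌋₊ := by linarith
      exact_mod_cast this
    · push_cast
      rw [Real.rpow_add hL0, Real.rpow_one]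
      gcongr
    · push_cast
      calc (L : ℝ) * ⌊(L : ℝ) ^ (θ - 1)⌋₊ ≤ L * (L : ℝ) ^ (θ - 1) := by
            gcongr
            exact Nat.floor_le (by positivity)
        _ = (L : ℝ) ^ (1 + (θ - 1)) := by rw [Real.rpow_add hL0, Real.rpow_one]
        _ = (L : ℝ) ^ θ := by ring_nf
  have hfm : ∀ k, m0 ≤ f k := by
    intro k
    induction k with
    | zero => exact le_rfl
    | succ k ih => exact ih.trans (Nat.le_mul_of_pos_right _ (hstep _ ih).1)
  refine ⟨n, le_max_left _ _, fun k => ?_, fun k => ?_⟩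
  · cases k with
    | zero => exact hm01
    | succ k => exact (hstep _ (hfm k)).1
  · rw [hlen, hlen]
    exact (hstep _ (hfm k)).2

/-- Doubly exponential growth of the sides turns the height `k` into an iterated logarithm; `3 ≤ n
0` is used to have `1 ≤ log (n 0)`. -/
theorem mul_log_le_log_log_len {n : ℕ → ℕ} {η : ℝ} (hη : 0 < η) (h3 : 3 ≤ n 0) (k : ℕ)
    (h : ∀ j < k, (len n j : ℝ) ^ (1 + η) ≤ len n (j + 1)) :
    k * Real.log (1 + η) ≤ Real.log (Real.log (len n k)) := by
  have h1 := rpow_pow_le_len hη k h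
  have hn0 : (3 : ℝ) ≤ n 0 := by exact_mod_cast h3
  have hlog : 1 ≤ Real.log (n 0) := by
    rw [Real.le_log_iff_exp_le (by linarith)]
    have := Real.exp_one_lt_d9
    linarith
  have hp : 0 < (1 + η) ^ k := by positivity
  have h2 : (1 + η) ^ k ≤ Real.log (len n k) := by
    calc (1 + η) ^ k ≤ (1 + η) ^ k * Real.log (n 0) := le_mul_of_one_le_right hp.le hlog
      _ = Real.log ((n 0 : ℝ) ^ ((1 + η) ^ k)) := by rw [Real.log_rpow (by linarith)]
      _ ≤ Real.log (len n k) :=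
          Real.log_le_log (Real.rpow_pos_of_pos (by linarith) _) h1
  calc k * Real.log (1 + η) = Real.log ((1 + η) ^ k) := by rw [Real.log_pow]
    _ ≤ _ := Real.log_le_log hp h2

/-! ### Boxes of arbitrary side: the finite statement. -/

theorem len_update {n : ℕ → ℕ} {k j : ℕ} (N : ℕ) (hj : j ≤ k) :
    len (Function.update n (k + 1) N) j = len n j := by
  induction j with
  | zero => simp [len]
  | succ j ih =>
    simp only [len, ih (by omega)]
    rw [Function.update_of_ne (by omega)]

theorem exists_scale_between {n : ℕ → ℕ} {θ : ℝ} (hθ : 1 < θ) (hn : ∀ k, 0 < n k)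
    (h2 : 2 ≤ n 0) (hθn : ∀ k, (len n k : ℝ) ^ (1 + (θ - 1) / 2) ≤ len n (k + 1)) {m : ℕ}
    (hm : len n 1 ≤ m) : ∃ k, len n (k + 1) ≤ m ∧ m < len n (k + 2) := by
  have hstrict : StrictMono (len n) := by
    refine strictMono_nat_of_lt_succ fun k => ?_
    have hL : (1 : ℝ) < len n k := by
      have : 2 ≤ len n k := h2.trans (len_mono hn (Nat.zero_le k))
      exact_mod_cast this
    have h3 : (len n k : ℝ) < (len n k : ℝ) ^ (1 + (θ - 1) / 2) := by
      conv_lhs => rw [← Real.rpow_one (len n k : ℝ)]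
      exact Real.rpow_lt_rpow_of_exponent_lt hL (by linarith)
    exact_mod_cast h3.trans_le (hθn k)
  have hex : ∃ k, m < len n (k + 2) :=
    ⟨m, lt_of_lt_of_le (by omega : m < m + 2) (hstrict.id_le (m + 2))⟩
  classical
  refine ⟨Nat.find hex, ?_, Nat.find_spec hex⟩
  by_contra hlt
  push Not at hlt
  rcases Nat.eq_zero_or_pos (Nat.find hex) with h0 | h0
  · rw [h0] at hlt; simp at hlt; omega
  · refine Nat.find_min hex (Nat.sub_lt h0 one_pos) ?_
    have : Nat.find hex - 1 + 2 = Nat.find hex + 1 := by omega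
    rw [this]
    exact hlt

theorem measurableSet_good_event {d : ℕ} (n : ℕ → ℕ) (w : ℕ → ℝ) (α lam : ℝ) (k : ℕ)
    (x : Fin d → ℤ) : MeasurableSet {ω : Sample d | Good n w ω.1 (openGraph α lam ω) k x} :=
  sigmaOn_le _ _ (measurableSet_goodEvent n w α lam k x)

/-- For `len n (k + 1) ≤ m < len n (k + 2)` the branching number of level `k + 1` is replaced by `m
/ len n k`, which brings the side of that level to within a factor `2` of `m` and leaves all lower
levels unchanged. -/
theorem one_sub_exp_le_measureReal_hcTree {d : ℕ} {α lam β θ ξ ρ : ℝ}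
    (hθ : 1 < θ) (hθκ : θ ^ 2 ≤ 2 * β / α) (hξ : 0 < ξ) (ν : Measure ℝ)
    [IsProbabilityMeasure ν] {m₀ : ℕ}
    (hbound : ∀ n : ℕ → ℕ, (∀ k, 0 < n k) → m₀ ≤ n 0 → ∀ k,
      (∀ j < k, (len n j : ℝ) ^ (1 + (θ - 1) / 2) ≤ len n (j + 1) ∧
        (len n (j + 1) : ℝ) ≤ (len n j : ℝ) ^ (2 * β / α)) →
      ∀ x : Fin d → ℤ,
        (law d ν).real {ω | ¬ Good n (thr n β) ω.1 (openGraph α lam ω) k x} ≤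
          Real.exp (-(len n k : ℝ) ^ ξ))
    {n : ℕ → ℕ} (hn : ∀ k, 0 < n k) (hn0 : m₀ ≤ n 0) (hn3 : 3 ≤ n 0)
    (hscale : ∀ k, (len n k : ℝ) ^ (1 + (θ - 1) / 2) ≤ len n (k + 1) ∧
      (len n (k + 1) : ℝ) ≤ (len n k : ℝ) ^ θ)
    (hρ1 : ρ ≤ 1 / 2 / (2 * (n 0 : ℝ)) ^ d) (hρ2 : ρ ≤ 1 / 2 ^ ξ)
    {m : ℕ} (hm : len n 1 ≤ m) :
    1 - Real.exp (-(ρ * (m : ℝ) ^ ξ)) ≤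
      (law d ν).real {ω | ∃ T : (openGraph α lam ω).Subgraph,
        IsHCTree ω.1 ρ (2 / Real.log (1 + (θ - 1) / 2)) 0 m T} := by
  have hη : 0 < (θ - 1) / 2 := by linarith
  set η := (θ - 1) / 2 with hηdef
  obtain ⟨k, hk1, hk2⟩ := exists_scale_between hθ hn (by omega) (fun k => (hscale k).1) hm
  set N := m / len n k with hN
  set n' := Function.update n (k + 1) N with hn'
  have hlenk := len_pos hn k
  have hnN : n (k + 1) ≤ N := by
    rw [hN, Nat.le_div_iff_mul_le hlenk, mul_comm]
    exact hk1
  have hN0 : 0 < N := (hn (k + 1)).trans_le hnN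
  have hn'pos : ∀ j, 0 < n' j := by
    intro j
    by_cases hj : j = k + 1
    · rw [hj, hn', Function.update_self]; exact hN0
    · rw [hn', Function.update_of_ne hj]; exact hn j
  have hn'0 : n' 0 = n 0 := by rw [hn', Function.update_of_ne (by omega)]
  have hlen' : ∀ j ≤ k, len n' j = len n j := fun j hj => len_update N hj
  have hlast : len n' (k + 1) = len n k * N := by
    rw [len, hlen' k le_rfl, hn', Function.update_self]
  have hle : len n' (k + 1) ≤ m := by rw [hlast]; exact Nat.mul_div_le m _
  have hge : len n (k + 1) ≤ len n' (k + 1) := by rw [hlast]; exact Nat.mul_le_mul_left _ hnN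
  have hlt2 : m < 2 * len n' (k + 1) := by
    have h1 := Nat.lt_mul_div_succ m hlenk
    rw [← hN, mul_add, mul_one] at h1
    have h2 : len n k ≤ len n k * N := Nat.le_mul_of_pos_right _ hN0
    rw [hlast]; omega
  have hcond : ∀ j < k + 1, (len n' j : ℝ) ^ (1 + η) ≤ len n' (j + 1) ∧
      (len n' (j + 1) : ℝ) ≤ (len n' j : ℝ) ^ (2 * β / α) := by
    intro j hj
    have hL1 : (1 : ℝ) ≤ len n j := by exact_mod_cast len_pos hn j
    have hθ2 : θ ≤ 2 * β / α := le_trans (by nlinarith) hθκ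
    rcases Nat.lt_succ_iff_lt_or_eq.mp hj with hj | rfl
    · rw [hlen' j hj.le, hlen' (j + 1) hj]
      exact ⟨(hscale j).1, (hscale j).2.trans (Real.rpow_le_rpow_of_exponent_le hL1 hθ2)⟩
    · rw [hlen' j le_rfl]
      refine ⟨(hscale j).1.trans (by exact_mod_cast hge), ?_⟩
      -- The modified step may cover up to two original steps, each of exponent at most `θ`; hence
      -- the requirement `θ ^ 2 ≤ 2 * β / α`.
      calc (len n' (j + 1) : ℝ) ≤ len n (j + 2) := by exact_mod_cast hle.trans hk2.le
        _ ≤ (len n (j + 1) : ℝ) ^ θ := (hscale (j + 1)).2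
        _ ≤ ((len n j : ℝ) ^ θ) ^ θ :=
            Real.rpow_le_rpow (by positivity) (hscale j).2 (by linarith)
        _ = (len n j : ℝ) ^ (θ ^ 2) := by rw [← Real.rpow_mul (by positivity), sq]
        _ ≤ _ := Real.rpow_le_rpow_of_exponent_le hL1 hθκ
  have hlogη : 0 < Real.log (1 + η) := Real.log_pos (by linarith)
  have hKm : ∀ (j m : ℕ), j * Real.log (1 + η) ≤ Real.log (Real.log m) →
      2 * (j : ℝ) ≤ 2 / Real.log (1 + η) * max 1 (Real.log (Real.log m)) := by
    intro j m h
    calc 2 * (j : ℝ) = 2 / Real.log (1 + η) * (j * Real.log (1 + η)) := by field_simp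
      _ ≤ _ := by
          gcongr
          exact h.trans (le_max_right _ _)
  have hprob := hbound n' hn'pos (hn'0 ▸ hn0) (k + 1) hcond 0
  have hsub : {ω | Good n' (thr n' β) ω.1 (openGraph α lam ω) (k + 1) 0} ⊆
      {ω : Sample d | ∃ T : (openGraph α lam ω).Subgraph,
        IsHCTree ω.1 ρ (2 / Real.log (1 + η)) 0 m T} := by
    intro ω hω
    have hn0pos : (0 : ℝ) < n 0 := by exact_mod_cast hn 0
    refine ⟨_, Good.isHCTree hn'pos (by omega) ?_ (k := k + 1) ?_ hω hle ?_ ?_⟩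
    · rw [hn'0]
      refine hρ1.trans ?_
      gcongr
      linarith
    · exact fun j hj => hKm j _ (mul_log_le_log_log_len hη (by omega) j
        fun i hi => (hcond i (hi.trans hj)).1)
    · refine lt_of_lt_of_le ?_ (Good.le_ncard hn'pos hω)
      rw [hn'0]
      have hM0 : (0 : ℝ) < len n' (k + 1) := by exact_mod_cast len_pos hn'pos (k + 1)
      have hm2 : (m : ℝ) ≤ 2 * len n' (k + 1) := by exact_mod_cast hlt2.le
      calc ρ * (m : ℝ) ^ d ≤ 1 / 2 / (2 * (n 0 : ℝ)) ^ d * (2 * len n' (k + 1)) ^ d := by gcongr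
        _ = 1 / 2 * ((len n' (k + 1) : ℝ) / n 0) ^ d := by
            rw [mul_pow, mul_pow, div_pow]; field_simp
        _ < _ := by
            gcongr
            have : (0 : ℝ) < 1 / 2 ^ (k + 1 + 1) := by positivity
            linarith
    · refine hKm (k + 1) m ((mul_log_le_log_log_len hη (by omega) (k + 1)
        fun i hi => (hcond i hi).1).trans ?_)
      have hM3 : (3 : ℝ) ≤ len n' (k + 1) := by
        have : n' 0 ≤ len n' (k + 1) := len_mono hn'pos (Nat.zero_le _)
        exact_mod_cast (by omega : 3 ≤ len n' (k + 1))
      have hlog : 0 < Real.log (len n' (k + 1)) := Real.log_pos (by linarith)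
      refine Real.log_le_log hlog (Real.log_le_log (by linarith) (by exact_mod_cast hle))
  have hcompl : (law d ν).real {ω | Good n' (thr n' β) ω.1 (openGraph α lam ω) (k + 1) 0} =
      1 - (law d ν).real {ω | ¬ Good n' (thr n' β) ω.1 (openGraph α lam ω) (k + 1) 0} := by
    have := probReal_compl_eq_one_sub (μ := law d ν)
      (measurableSet_good_event n' (thr n' β) α lam (k + 1) (0 : Fin d → ℤ))
    have h2 : {ω : Sample d | ¬ Good n' (thr n' β) ω.1 (openGraph α lam ω) (k + 1) 0} =
      {ω : Sample d | Good n' (thr n' β) ω.1 (openGraph α lam ω) (k + 1) 0}ᶜ := rfl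
    rw [h2, this]
    ring
  calc 1 - Real.exp (-(ρ * (m : ℝ) ^ ξ)) ≤ 1 - Real.exp (-(len n' (k + 1) : ℝ) ^ ξ) := by
        gcongr
        have hm2 : (m : ℝ) ≤ 2 * len n' (k + 1) := by exact_mod_cast hlt2.le
        calc ρ * (m : ℝ) ^ ξ ≤ 1 / 2 ^ ξ * (2 * len n' (k + 1) : ℝ) ^ ξ := by gcongr
          _ = (len n' (k + 1) : ℝ) ^ ξ := by
              rw [Real.mul_rpow (by norm_num) (by positivity)]
              have : (2 : ℝ) ^ ξ ≠ 0 := (Real.rpow_pos_of_pos (by norm_num) ξ).ne'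
              field_simp
    _ ≤ (law d ν).real {ω | Good n' (thr n' β) ω.1 (openGraph α lam ω) (k + 1) 0} := by
        rw [hcompl]; linarith
    _ ≤ _ := measureReal_mono hsub (measure_ne_top _ _)

/-! ### Chains of good boxes in a half-space next to a given vertex. -/

section Fresh

variable {d : ℕ}

/-- The corners of the boxes of a chain that starts next to `z` and grows away from `z` in the
positive (`true`) or negative (`false`) direction of the coordinate `i`. -/
def dirChain (n : ℕ → ℕ) (z : Fin d → ℤ) (i : Fin d) : Bool → ℕ → Fin d → ℤ
  | true, _ => Function.update z i (z i + 1)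
  | false, k => Function.update z i (z i - len n k)

/-- The half-space on the positive or negative side of `z` in the direction of the coordinate
`i`. -/
def halfSpace (z : Fin d → ℤ) (i : Fin d) : Bool → Set (Fin d → ℤ)
  | true => {v | z i < v i}
  | false => {v | v i < z i}

theorem dirChain_isTile {n : ℕ → ℕ} (hn : ∀ k, 0 < n k) (z : Fin d → ℤ) (i : Fin d) (b : Bool)
    (k : ℕ) : IsTile n k (dirChain n z i b (k + 1)) (dirChain n z i b k) := by
  cases b with
  | true =>
    refine ⟨0, mem_tileIdx.mpr fun _ => hn _, funext fun t => ?_⟩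
    simp [dirChain, tile]
  | false =>
    refine ⟨Function.update 0 i (n (k + 1) - 1), mem_tileIdx.mpr fun t => ?_, funext fun t => ?_⟩
    · have := hn (k + 1)
      by_cases h : t = i
      · subst h; rw [Function.update_self]; omega
      · rw [Function.update_of_ne h]; exact this
    · by_cases h : t = i
      · subst h
        simp only [dirChain, tile, Function.update_self, len]
        push_cast [Nat.cast_sub (hn (k + 1))]
        ring
      · simp [dirChain, tile, Function.update_of_ne h]

theorem box_dirChain_subset (n : ℕ → ℕ) (z : Fin d → ℤ) (i : Fin d) (b : Bool) (k : ℕ) :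
    box (len n k) (dirChain n z i b k) ⊆ halfSpace z i b := by
  intro v hv
  obtain ⟨h1, h2⟩ := hv i
  cases b <;> simp only [dirChain, Function.update_self] at h1 h2 <;>
    simp only [halfSpace, Set.mem_ofPred_eq] <;> linarith

theorem notMem_halfSpace (z : Fin d → ℤ) (i : Fin d) (b : Bool) : z ∉ halfSpace z i b := by
  cases b <;> simp [halfSpace]

theorem l1Dist_le_of_mem_dirChain {n : ℕ → ℕ} (z : Fin d → ℤ) (i : Fin d) (b : Bool)
    {u : Fin d → ℤ} (hu : u ∈ box (len n 0) (dirChain n z i b 0)) :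
    l1Dist z u ≤ d * (n 0 : ℕ) := by
  refine l1Dist_le fun t => ?_
  obtain ⟨h1, h2⟩ := hu t
  have h0 : (len n 0 : ℤ) = n 0 := rfl
  rw [h0] at h2
  rw [abs_le]
  by_cases h : t = i
  · subst h
    cases b <;> simp only [dirChain, Function.update_self] at h1 h2
    · rw [h0] at h1 h2; constructor <;> linarith
    · constructor <;> linarith
  · cases b <;> simp only [dirChain, Function.update_of_ne h] at h1 h2 <;> constructor <;> linarith

/-- All boxes of a chain starting next to `z` are good, and the marks of the edges from `z` to the
first box are less than `p`. -/
def freshEvent (n : ℕ → ℕ) (w : ℕ → ℝ) (α lam p : ℝ) (z : Fin d → ℤ) (i : Fin d) (b : Bool) :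
    Set (Sample d) :=
  {ω | ∀ k, Good n w ω.1 (openGraph α lam ω) k (dirChain n z i b k)} ∩
    {ω | ∀ u ∈ box (len n 0) (dirChain n z i b 0), (ω.2 s(z, u) : ℝ) < p}

/-- The marks of the edges from `z` to the points of `S`. -/
def starCoords (z : Fin d → ℤ) (S : Set (Fin d → ℤ)) : Set ((Fin d → ℤ) ⊕ Sym2 (Fin d → ℤ)) :=
  {j | ∃ u ∈ S, j = Sum.inr s(z, u)}

variable {n : ℕ → ℕ} {w : ℕ → ℝ} {α lam p : ℝ}

theorem measurableSet_chain_good (n : ℕ → ℕ) (w : ℕ → ℝ) (α lam : ℝ) (z : Fin d → ℤ) (i : Fin d)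
    (b : Bool) : MeasurableSet[sigmaOn (coordsIn (halfSpace z i b))]
      {ω : Sample d | ∀ k, Good n w ω.1 (openGraph α lam ω) k (dirChain n z i b k)} := by
  have h : {ω : Sample d | ∀ k, Good n w ω.1 (openGraph α lam ω) k (dirChain n z i b k)} =
      ⋂ k, {ω | Good n w ω.1 (openGraph α lam ω) k (dirChain n z i b k)} := by
    ext ω; simp
  rw [h]
  exact @MeasurableSet.iInter _ _ (sigmaOn (coordsIn (halfSpace z i b))) _ _ fun k =>
    sigmaOn_mono (coordsIn_mono (box_dirChain_subset n z i b k)) _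
      (measurableSet_goodEvent n w α lam k _)

theorem measurableSet_marks_lt (p : ℝ) (z : Fin d → ℤ) (m : ℕ) (y : Fin d → ℤ) :
    MeasurableSet[sigmaOn (starCoords z (box m y))]
      {ω : Sample d | ∀ u ∈ box m y, (ω.2 s(z, u) : ℝ) < p} := by
  have h : {ω : Sample d | ∀ u ∈ box m y, (ω.2 s(z, u) : ℝ) < p} =
      ⋂ u ∈ box m y, {ω | (ω.2 s(z, u) : ℝ) < p} := by
    ext ω; simp
  rw [h]
  refine @MeasurableSet.biInter _ _ (sigmaOn (starCoords z (box m y))) _ _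
    (box_finite m y).countable fun u hu => ?_
  have hu' : Sum.inr s(z, u) ∈ starCoords z (box m y) := ⟨u, hu, rfl⟩
  have hp : MeasurableSet {t : unitInterval | (t : ℝ) < p} :=
    measurableSet_lt measurable_subtype_coe measurable_const
  exact measurable_mark hu' hp

theorem measurableSet_freshEvent (n : ℕ → ℕ) (w : ℕ → ℝ) (α lam p : ℝ) (z : Fin d → ℤ) (i : Fin d)
    (b : Bool) :
    MeasurableSet[sigmaOn (coordsIn (halfSpace z i b) ∪
      starCoords z (box (len n 0) (dirChain n z i b 0)))] (freshEvent n w α lam p z i b) :=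
  @MeasurableSet.inter _ (sigmaOn (coordsIn (halfSpace z i b) ∪
      starCoords z (box (len n 0) (dirChain n z i b 0)))) _ _
    (sigmaOn_mono Set.subset_union_left _ (measurableSet_chain_good n w α lam z i b))
    (sigmaOn_mono Set.subset_union_right _ (measurableSet_marks_lt p z _ _))

variable (ν : Measure ℝ) [IsProbabilityMeasure ν]

/-- The failure probabilities `(1 / 2) ^ (k + 2)` sum to `1 / 2`. -/
theorem half_le_measureReal_chain_good
    (hb : ∀ k (x : Fin d → ℤ), (law d ν).real {ω | ¬ Good n w ω.1 (openGraph α lam ω) k x} ≤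
      (1 / 2) ^ (k + 2)) (y : ℕ → Fin d → ℤ) :
    1 / 2 ≤ (law d ν).real {ω | ∀ k, Good n w ω.1 (openGraph α lam ω) k (y k)} := by
  set A : Set (Sample d) := {ω | ∀ k, Good n w ω.1 (openGraph α lam ω) k (y k)} with hA
  have hAm : MeasurableSet A := by
    have : A = ⋂ k, {ω | Good n w ω.1 (openGraph α lam ω) k (y k)} := by ext ω; simp [hA]
    rw [this]
    exact MeasurableSet.iInter fun k => measurableSet_good_event n w α lam k _
  have hsum : HasSum (fun k : ℕ => (1 / 2 : ℝ) ^ (k + 2)) (1 / 2) := by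
    have h := hasSum_geometric_two.mul_left (1 / 4 : ℝ)
    have h2 : (fun k : ℕ => (1 / 2 : ℝ) ^ (k + 2)) = fun k : ℕ => 1 / 4 * (1 / 2 : ℝ) ^ k := by
      funext k; ring
    rw [h2]
    norm_num at h ⊢
    exact h
  have hle : law d ν Aᶜ ≤ ENNReal.ofReal (1 / 2) := by
    have h1 : Aᶜ ⊆ ⋃ k, {ω | ¬ Good n w ω.1 (openGraph α lam ω) k (y k)} := by
      intro ω hω
      simp only [hA, Set.mem_compl_iff, Set.mem_ofPred_eq, not_forall] at hω
      simpa using hω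
    calc law d ν Aᶜ ≤ ∑' k, law d ν {ω | ¬ Good n w ω.1 (openGraph α lam ω) k (y k)} :=
          (measure_mono h1).trans (measure_iUnion_le _)
      _ ≤ ∑' k : ℕ, ENNReal.ofReal ((1 / 2) ^ (k + 2)) := by
          refine ENNReal.tsum_le_tsum fun k => ?_
          rw [ENNReal.le_ofReal_iff_toReal_le (measure_ne_top _ _) (by positivity)]
          exact hb k _
      _ = ENNReal.ofReal (1 / 2) := by
          rw [← ENNReal.ofReal_tsum_of_nonneg (fun k => by positivity) hsum.summable,
            hsum.tsum_eq]
  have h2 : (law d ν).real Aᶜ ≤ 1 / 2 :=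
    ENNReal.toReal_le_of_le_ofReal (by norm_num) hle
  have h3 := probReal_compl_eq_one_sub (μ := law d ν) hAm
  linarith

theorem ae_eventually_good
    (hb : ∀ k (x : Fin d → ℤ), (law d ν).real {ω | ¬ Good n w ω.1 (openGraph α lam ω) k x} ≤
      (1 / 2) ^ (k + 2)) (y : ℕ → Fin d → ℤ) :
    ∀ᵐ ω ∂(law d ν), ∀ᶠ k in atTop, Good n w ω.1 (openGraph α lam ω) k (y k) := by
  have hsum : Summable fun k : ℕ => (1 / 2 : ℝ) ^ (k + 2) :=
    (summable_nat_add_iff 2).mpr summable_geometric_two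
  have h := ae_eventually_notMem (μ := law d ν)
    (s := fun k => {ω | ¬ Good n w ω.1 (openGraph α lam ω) k (y k)}) ?_
  · filter_upwards [h] with ω hω
    filter_upwards [hω] with k hk
    exact not_not.mp hk
  · refine ne_top_of_le_ne_top (hsum.tsum_ofReal_ne_top) (ENNReal.tsum_le_tsum fun k => ?_)
    rw [ENNReal.le_ofReal_iff_toReal_le (measure_ne_top _ _) (by positivity)]
    exact hb k _

theorem pow_le_measureReal_marks_lt (hp0 : 0 ≤ p) (hp1 : p ≤ 1) (z : Fin d → ℤ) (m : ℕ)
    (y : Fin d → ℤ) :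
    p ^ (m ^ d) ≤ (law d ν).real {ω | ∀ u ∈ box m y, (ω.2 s(z, u) : ℝ) < p} := by
  classical
  have h := law_rect ν ∅ ((boxFinset m y).image fun u => s(z, u)) (fun _ => Set.univ)
    (fun _ => {t : unitInterval | (t : ℝ) < p}) (fun _ _ => MeasurableSet.univ)
    (fun _ _ => measurableSet_lt measurable_subtype_coe measurable_const)
  have h1 : {ω : Sample d | (∀ v ∈ (∅ : Finset (Fin d → ℤ)), ω.1 v ∈ Set.univ) ∧
      ∀ e ∈ (boxFinset m y).image fun u => s(z, u), ω.2 e ∈ {t : unitInterval | (t : ℝ) < p}} =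
      {ω | ∀ u ∈ box m y, (ω.2 s(z, u) : ℝ) < p} := by
    ext ω; simp [mem_boxFinset]
  rw [h1, Finset.prod_empty, Finset.prod_const, one_mul, volume_coe_lt hp0 hp1] at h
  rw [measureReal_def, h, ENNReal.toReal_pow, ENNReal.toReal_ofReal hp0]
  refine pow_le_pow_of_le_one hp0 hp1 ?_
  rw [← card_boxFinset m y]
  exact Finset.card_image_le

theorem disjoint_coordsIn_starCoords {H : Set (Fin d → ℤ)} {z : Fin d → ℤ} (hz : z ∉ H)
    (S : Set (Fin d → ℤ)) : Disjoint (coordsIn H) (starCoords z S) := by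
  rw [Set.disjoint_left]
  rintro j hj ⟨u, -, rfl⟩
  exact hz (hj z (Sym2.mem_mk_left z u))

/-- The chain lies in a half-space that misses `z`, so its goodness is independent of the marks at
`z`. The bound depends neither on `z` nor on the direction, as Lévy's law will need. -/
theorem le_measureReal_freshEvent (hp0 : 0 ≤ p) (hp1 : p ≤ 1)
    (hb : ∀ k (x : Fin d → ℤ), (law d ν).real {ω | ¬ Good n w ω.1 (openGraph α lam ω) k x} ≤
      (1 / 2) ^ (k + 2)) (z : Fin d → ℤ) (i : Fin d) (b : Bool) :
    1 / 2 * p ^ (n 0 ^ d) ≤ (law d ν).real (freshEvent n w α lam p z i b) := by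
  rw [freshEvent, measureReal_inter_sigmaOn ν
    (disjoint_coordsIn_starCoords (notMem_halfSpace z i b) _)
    (measurableSet_chain_good n w α lam z i b) (measurableSet_marks_lt p z _ _)]
  exact mul_le_mul (half_le_measureReal_chain_good ν hb _)
    (pow_le_measureReal_marks_lt ν hp0 hp1 z _ _) (by positivity) measureReal_nonneg

end Fresh

/-! ### Exploring a component cube by cube. -/

section Exploration

variable {d : ℕ}

/-- The cube `[-N, N]^d`. -/
def cube (d N : ℕ) : Set (Fin d → ℤ) := {v | ∀ t, |v t| ≤ N}

theorem cube_mono {N M : ℕ} (h : N ≤ M) : cube d N ⊆ cube d M :=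
  fun _ hv t => (hv t).trans (by exact_mod_cast h)

theorem exists_mem_cube (v : Fin d → ℤ) : ∃ N, v ∈ cube d N := by
  refine ⟨∑ t, (v t).natAbs, fun t => ?_⟩
  rw [Int.abs_eq_natAbs]
  exact_mod_cast Finset.single_le_sum (f := fun t => (v t).natAbs) (fun _ _ => Nat.zero_le _)
    (Finset.mem_univ t)

theorem cube_finite (N : ℕ) : (cube d N).Finite := by
  refine (Set.finite_Icc (fun _ => -(N : ℤ)) (fun _ => (N : ℤ))).subset fun v hv => ?_
  exact ⟨fun t => (abs_le.mp (hv t)).1, fun t => (abs_le.mp (hv t)).2⟩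

/-- The graph `G` with the edges inside `S` only. -/
def within (G : SimpleGraph (Fin d → ℤ)) (S : Set (Fin d → ℤ)) : SimpleGraph (Fin d → ℤ) where
  Adj u v := G.Adj u v ∧ u ∈ S ∧ v ∈ S
  symm := ⟨fun _ _ h => ⟨h.1.symm, h.2.2, h.2.1⟩⟩
  loopless := ⟨fun _ h => h.1.ne rfl⟩

theorem within_le (G : SimpleGraph (Fin d → ℤ)) (S : Set (Fin d → ℤ)) : within G S ≤ G :=
  fun _ _ h => h.1

theorem reachable_within {G : SimpleGraph (Fin d → ℤ)} {S : Set (Fin d → ℤ)} {x y : Fin d → ℤ}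
    (q : G.Walk x y) (h : ∀ v ∈ q.support, v ∈ S) {z : Fin d → ℤ} (hz : z ∈ q.support) :
    (within G S).Reachable x z := by
  induction q with
  | nil =>
    rw [SimpleGraph.Walk.support_nil, List.mem_singleton] at hz
    rw [hz]
  | @cons a b c hab q ih =>
    rw [SimpleGraph.Walk.support_cons, List.mem_cons] at hz
    rcases hz with rfl | hz
    · exact SimpleGraph.Reachable.refl _
    · have hb : (within G S).Adj a b := ⟨hab, h a (by simp), h b (by simp)⟩
      exact hb.reachable.trans (ih (fun v hv => h v (by simp [hv])) hz)

/-- An infinite component reaches, inside infinitely many of the cubes, a vertex on the surface. -/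
theorem exists_reachable_surface {G : SimpleGraph (Fin d → ℤ)} {x : Fin d → ℤ}
    (hinf : {z | G.Reachable x z}.Infinite) (N₀ : ℕ) :
    ∃ N ≥ N₀, ∃ z ∈ cube d N, (within G (cube d N)).Reachable x z ∧
      ∃ i, z i = N ∨ z i = -N := by
  classical
  obtain ⟨y, hy, hyN⟩ := hinf.exists_notMem_finite (cube_finite (d := d) N₀)
  obtain ⟨q⟩ := hy
  have hex : ∃ N, ∀ v ∈ q.support, v ∈ cube d N := by
    have : ∀ l : List (Fin d → ℤ), ∃ N, ∀ v ∈ l, v ∈ cube d N := by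
      intro l
      induction l with
      | nil => exact ⟨0, by simp⟩
      | cons a l ih =>
        obtain ⟨N, hN⟩ := ih
        obtain ⟨M, hM⟩ := exists_mem_cube a
        refine ⟨max N M, fun v hv => ?_⟩
        rcases List.mem_cons.mp hv with rfl | hv
        · exact cube_mono (le_max_right _ _) hM
        · exact cube_mono (le_max_left _ _) (hN v hv)
    exact this _
  -- In the smallest cube that contains the walk, some vertex of the walk lies on the surface. The
  -- cube is larger than the prescribed one because the walk ends outside the latter.
  set N := Nat.find hex with hN
  have hspec := Nat.find_spec hex
  have hlt : N₀ < N := by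
    by_contra hle
    exact hyN (cube_mono (not_lt.mp hle) (hspec y q.end_mem_support))
  have hmin := Nat.find_min hex (m := N - 1) (by omega)
  push Not at hmin
  obtain ⟨z, hz, hzN⟩ := hmin
  refine ⟨N, hlt.le, z, hspec z hz, reachable_within q hspec hz, ?_⟩
  have h1 : ∃ t, ¬ |z t| ≤ ((N - 1 : ℕ) : ℤ) := not_forall.mp hzN
  obtain ⟨t, ht⟩ := h1
  refine ⟨t, ?_⟩
  have h2 : |z t| ≤ (N : ℤ) := hspec z hz t
  have h3 : |z t| = (N : ℤ) := by omega
  exact (abs_eq (by positivity)).mp h3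

theorem measurableSet_within_adj {α lam : ℝ} {S : Set (Fin d → ℤ)} (u v : Fin d → ℤ) :
    MeasurableSet[sigmaOn (coordsIn S)]
      {ω : Sample d | (within (openGraph α lam ω) S).Adj u v} := by
  by_cases h : u ∈ S ∧ v ∈ S
  · have h1 : {ω : Sample d | (within (openGraph α lam ω) S).Adj u v} =
        {ω | (openGraph α lam ω).Adj u v} := by
      ext ω; simp [within, h.1, h.2]
    rw [h1]
    refine @measurableSet_adj d (Sample d) (sigmaOn (coordsIn S)) α lam id u v
      (measurable_weight h.1) (measurable_weight h.2) (measurable_mark ?_)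
    intro z hz
    rcases Sym2.mem_iff.mp hz with rfl | rfl
    · exact h.1
    · exact h.2
  · have h1 : {ω : Sample d | (within (openGraph α lam ω) S).Adj u v} = ∅ := by
      ext ω; simp only [within, Set.mem_ofPred_eq, Set.mem_empty_iff_false, iff_false]; tauto
    rw [h1]
    exact @MeasurableSet.empty _ (sigmaOn (coordsIn S))

theorem measurableSet_within_reachable (α lam : ℝ) (S : Set (Fin d → ℤ)) (x z : Fin d → ℤ) :
    MeasurableSet[sigmaOn (coordsIn S)]
      {ω : Sample d | (within (openGraph α lam ω) S).Reachable x z} :=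
  @measurableSet_reachable (Sample d) (sigmaOn (coordsIn S)) _ _ _
    (fun u v => measurableSet_within_adj u v) x z

/-- The filtration of the information inside the cubes. -/
def cubeFiltration (d : ℕ) : Filtration ℕ (inferInstance : MeasurableSpace (Sample d)) where
  seq N := sigmaOn (coordsIn (cube d N))
  mono' _ _ h := sigmaOn_mono (coordsIn_mono (cube_mono h))
  le' _ := sigmaOn_le _

theorem iSup_cubeFiltration :
    ⨆ N, cubeFiltration d N = (inferInstance : MeasurableSpace (Sample d)) := by
  refine le_antisymm (iSup_le fun N => (cubeFiltration d).le N) ?_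
  refine (le_of_eq sigmaOn_univ.symm).trans (iSup₂_le fun j _ => ?_)
  have hj : ∃ N, j ∈ coordsIn (cube d N) := by
    rcases j with v | e
    · exact exists_mem_cube v
    · induction e with
      | h u v =>
        obtain ⟨N, hN⟩ := exists_mem_cube u
        obtain ⟨M, hM⟩ := exists_mem_cube v
        refine ⟨max N M, fun a ha => ?_⟩
        rcases Sym2.mem_iff.mp ha with rfl | rfl
        · exact cube_mono (le_max_left _ _) hN
        · exact cube_mono (le_max_right _ _) hM
  obtain ⟨N, hN⟩ := hj
  exact (le_iSup₂_of_le (f := fun i (_ : i ∈ coordsIn (cube d N)) => coordSigma d i) j hN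
    le_rfl).trans (le_iSup (fun N => cubeFiltration d N) N)

variable {n : ℕ → ℕ} {w : ℕ → ℝ} {α lam p : ℝ}

/-- The half-space beyond a face of the cube misses the cube, and each edge from `z` into it has an
endpoint outside, so nothing about the fresh event has been revealed. -/
theorem disjoint_fresh_cube {N : ℕ} {z : Fin d → ℤ} {i : Fin d} {b : Bool}
    (hz : z i = if b then (N : ℤ) else -N) :
    Disjoint (coordsIn (halfSpace z i b) ∪
      starCoords z (box (len n 0) (dirChain n z i b 0))) (coordsIn (cube d N)) := by
  have hH : Disjoint (halfSpace z i b) (cube d N) := by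
    rw [Set.disjoint_left]
    intro v hv hv'
    have h1 := abs_le.mp (hv' i)
    cases b <;> simp only [halfSpace, Set.mem_ofPred_eq] at hv <;> simp at hz <;> linarith
  rw [Set.disjoint_union_left]
  refine ⟨coordsIn_disjoint hH, Set.disjoint_left.mpr ?_⟩
  rintro j ⟨u, hu, rfl⟩ hj
  exact Set.disjoint_left.mp hH (box_dirChain_subset n z i b 0 hu) (hj u (Sym2.mem_mk_right z u))

/-- A vertex of the component of `x` is next to a chain of good boxes. -/
def attachEvent (n : ℕ → ℕ) (w : ℕ → ℝ) (α lam p : ℝ) (x : Fin d → ℤ) : Set (Sample d) :=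
  ⋃ (z : Fin d → ℤ) (i : Fin d) (b : Bool),
    {ω | (openGraph α lam ω).Reachable x z} ∩ freshEvent n w α lam p z i b

theorem measurableSet_attachEvent (n : ℕ → ℕ) (w : ℕ → ℝ) (α lam p : ℝ) (x : Fin d → ℤ) :
    MeasurableSet (attachEvent n w α lam p x) := by
  refine MeasurableSet.iUnion fun z => MeasurableSet.iUnion fun i => MeasurableSet.iUnion fun b =>
    MeasurableSet.inter ?_ (sigmaOn_le _ _ (measurableSet_freshEvent n w α lam p z i b))
  refine measurableSet_reachable (fun u v => ?_) x z
  exact measurableSet_adj (X := id) ((measurable_pi_apply u).comp measurable_fst)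
    ((measurable_pi_apply v).comp measurable_fst) ((measurable_pi_apply s(u, v)).comp measurable_snd)

variable (ν : Measure ℝ) [IsProbabilityMeasure ν]

/-- Reaching `z` inside the cube is known at time `N`, so its indicator comes out of the conditional
expectation; the fresh event is independent of that information and keeps its probability. -/
theorem ae_le_condExp_attachEvent {δ : ℝ}
    (hδ : ∀ (z : Fin d → ℤ) i b, δ ≤ (law d ν).real (freshEvent n w α lam p z i b))
    (x : Fin d → ℤ) {N : ℕ} {z : Fin d → ℤ} {i : Fin d} {b : Bool}
    (hz : z i = if b then (N : ℤ) else -N) :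
    ∀ᵐ ω ∂(law d ν), (within (openGraph α lam ω) (cube d N)).Reachable x z →
      δ ≤ ((law d ν)[(attachEvent n w α lam p x).indicator (fun _ => (1 : ℝ)) |
        cubeFiltration d N]) ω := by
  set A : Set (Sample d) := {ω | (within (openGraph α lam ω) (cube d N)).Reachable x z} with hA
  set F := freshEvent n w α lam p z i b with hF
  set J := coordsIn (halfSpace z i b) ∪
      starCoords z (box (len n 0) (dirChain n z i b 0)) with hJ
  have hAm : MeasurableSet[cubeFiltration d N] A := measurableSet_within_reachable α lam _ x z
  have hFJ : MeasurableSet[sigmaOn J] F := measurableSet_freshEvent n w α lam p z i b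
  have hFm : MeasurableSet F := sigmaOn_le _ _ hFJ
  have hint : ∀ S : Set (Sample d), MeasurableSet S →
      Integrable (S.indicator fun _ => (1 : ℝ)) (law d ν) := fun S hS =>
    (integrable_const 1).indicator hS
  have hle : A.indicator (F.indicator fun _ => (1 : ℝ)) ≤
      (attachEvent n w α lam p x).indicator fun _ => (1 : ℝ) := by
    intro ω
    by_cases hω : ω ∈ A ∧ ω ∈ F
    · have : ω ∈ attachEvent n w α lam p x := by
        simp only [attachEvent, Set.mem_iUnion]
        exact ⟨z, i, b, hω.1.mono (within_le _ _), hω.2⟩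
      rw [Set.indicator_of_mem hω.1, Set.indicator_of_mem hω.2, Set.indicator_of_mem this]
    · have : A.indicator (F.indicator fun _ => (1 : ℝ)) ω = 0 := by
        rw [Set.indicator_apply_eq_zero]
        intro h1
        rw [Set.indicator_apply_eq_zero]
        exact fun h2 => absurd ⟨h1, h2⟩ hω
      rw [this]
      exact Set.indicator_nonneg (fun _ _ => zero_le_one) _
  have h1 := condExp_mono (m := cubeFiltration d N) (μ := law d ν)
    ((hint F hFm).indicator ((cubeFiltration d).le N _ hAm))
    (hint _ (measurableSet_attachEvent n w α lam p x)) (ae_of_all _ hle)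
  have h2 := condExp_indicator (m := cubeFiltration d N) (μ := law d ν) (hint F hFm) hAm
  have h3 := condExp_indep_eq (μ := law d ν) (sigmaOn_le J) ((cubeFiltration d).le N)
    (f := F.indicator fun _ => (1 : ℝ))
    ((@stronglyMeasurable_const _ _ (sigmaOn J) _ (1 : ℝ)).indicator hFJ)
    (indep_sigmaOn ν (disjoint_fresh_cube hz))
  filter_upwards [h1, h2, h3] with ω h1 h2 h3 hωA
  refine le_trans ?_ h1
  rw [h2, Set.indicator_of_mem (show ω ∈ A from hωA), h3, integral_indicator_const _ hFm]
  simpa using hδ z i b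

/-- Almost surely, if the component of `x` is infinite then it meets a chain of good boxes. -/
theorem ae_mem_attachEvent {δ : ℝ} (hδ0 : 0 < δ)
    (hδ : ∀ (z : Fin d → ℤ) i b, δ ≤ (law d ν).real (freshEvent n w α lam p z i b))
    (x : Fin d → ℤ) :
    ∀ᵐ ω ∂(law d ν), {z | (openGraph α lam ω).Reachable x z}.Infinite →
      ω ∈ attachEvent n w α lam p x := by
  have hlevy := Integrable.tendsto_ae_condExp (μ := law d ν) (ℱ := cubeFiltration d)
    (g := (attachEvent n w α lam p x).indicator fun _ => (1 : ℝ))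
    ((integrable_const 1).indicator (measurableSet_attachEvent n w α lam p x))
    (by
      rw [iSup_cubeFiltration]
      exact stronglyMeasurable_const.indicator (measurableSet_attachEvent n w α lam p x))
  have hall : ∀ᵐ ω ∂(law d ν), ∀ (N : ℕ) (z : Fin d → ℤ) (i : Fin d) (b : Bool),
      (z i = if b then (N : ℤ) else -N) →
      (within (openGraph α lam ω) (cube d N)).Reachable x z →
      δ ≤ ((law d ν)[(attachEvent n w α lam p x).indicator (fun _ => (1 : ℝ)) |
        cubeFiltration d N]) ω := by
    rw [ae_all_iff]; intro N
    rw [ae_all_iff]; intro z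
    rw [ae_all_iff]; intro i
    rw [ae_all_iff]; intro b
    by_cases hz : z i = if b then (N : ℤ) else -N
    · filter_upwards [ae_le_condExp_attachEvent ν hδ x hz] with ω h _
      exact h
    · exact ae_of_all _ fun ω h => absurd h hz
  filter_upwards [hlevy, hall] with ω hlim hall hinf
  by_contra hω
  -- Off the event, Lévy's law sends the conditional probabilities to `0`. They are at least `δ`
  -- whenever the component reaches the surface of the cube, which happens for arbitrarily large
  -- `N`.
  rw [Set.indicator_of_notMem hω] at hlim
  obtain ⟨N₀, hN₀⟩ := (hlim.eventually_lt_const hδ0).exists_forall_of_atTop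
  obtain ⟨N, hN, z, -, hz, i, hi⟩ := exists_reachable_surface hinf N₀
  have h1 := hN₀ N hN
  rcases hi with hi | hi
  · exact absurd (hall N z i true (by simpa using hi) hz) (not_le.mpr h1)
  · exact absurd (hall N z i false (by simpa using hi) hz) (not_le.mpr h1)

end Exploration

/-! ### Infinite components and the conclusion. -/

theorem ae_le_weight {d : ℕ} (ν : Measure ℝ) [IsProbabilityMeasure ν] {a : ℝ}
    (ha : 1 ≤ ν.real (Set.Ici a)) : ∀ᵐ ω ∂(law d ν), ∀ v, a ≤ ω.1 v := by
  rw [ae_all_iff]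
  intro v
  have h0 : ν (Set.Iio a) = 0 := by
    have h1 := probReal_compl_eq_one_sub (μ := ν) (measurableSet_Ici (a := a))
    rw [Set.compl_Ici] at h1
    have h2 : ν.real (Set.Iio a) = 0 :=
      le_antisymm (by linarith) measureReal_nonneg
    rwa [measureReal_eq_zero_iff] at h2
  have h := law_rect ν {v} ∅ (fun _ => Set.Iio a) (fun _ => Set.univ)
    (fun _ _ => measurableSet_Iio) (fun _ _ => MeasurableSet.univ)
  simp only [Finset.prod_singleton, h0, zero_mul] at h
  rw [ae_iff]
  convert h using 2
  ext ω
  simp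

theorem ae_infinite_hcTree {d : ℕ} (hd : 1 ≤ d) {α lam ρ K a : ℝ} (hα : 0 < α) (hlam : 0 < lam)
    (ha : 0 < a) (ν : Measure ℝ) [IsProbabilityMeasure ν] (hν : 1 ≤ ν.real (Set.Ici a))
    {n : ℕ → ℕ} {w : ℕ → ℝ} (hn : ∀ k, 0 < n k) (h2 : 2 ≤ n 0) (hw : Tendsto w atTop atTop)
    (hρ : ρ ≤ 1 / 2 / (n 0 : ℝ) ^ d)
    (hK : ∀ j : ℕ, 2 * (j : ℝ) ≤ K * max 1 (Real.log (Real.log (len n j))))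
    (hb : ∀ k (x : Fin d → ℤ), (law d ν).real {ω | ¬ Good n w ω.1 (openGraph α lam ω) k x} ≤
      (1 / 2) ^ (k + 2)) :
    ∀ᵐ ω ∂(law d ν),
      (∃ C : (openGraph α lam ω).ConnectedComponent, C.supp.Infinite) ∧
      ∀ C : (openGraph α lam ω).ConnectedComponent, C.supp.Infinite →
        ∃ T : (openGraph α lam ω).Subgraph,
          T.verts ⊆ C.supp ∧ IsInfiniteHCTree ω.1 ρ K T := by
  -- A lower bound for the edge probability between `z` and any vertex of the first box of a chain
  -- next to it, all weights being at least `a`.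
  set p : ℝ := 1 - Real.exp (-(lam * (a * a / (d * (n 0 : ℕ) : ℝ) ^ α))) with hp
  have hD : (0 : ℝ) < (d * (n 0 : ℕ) : ℝ) ^ α := by
    have h1 : (0 : ℝ) < d := by exact_mod_cast hd
    have h2 : (0 : ℝ) < n 0 := by exact_mod_cast hn 0
    positivity
  have hp0 : 0 < p := by
    rw [hp, sub_pos, Real.exp_lt_one_iff, neg_lt_zero]
    positivity
  have hp1 : p ≤ 1 := by
    rw [hp]
    linarith [Real.exp_pos (-(lam * (a * a / (d * (n 0 : ℕ) : ℝ) ^ α)))]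
  have hatt : ∀ᵐ ω ∂(law d ν), ∀ x : Fin d → ℤ,
      {z | (openGraph α lam ω).Reachable x z}.Infinite → ω ∈ attachEvent n w α lam p x :=
    ae_all_iff.mpr fun x => ae_mem_attachEvent ν (δ := 1 / 2 * p ^ (n 0 ^ d)) (by positivity)
      (fun z i b => le_measureReal_freshEvent ν hp0.le hp1 hb z i b) x
  have hchain := ae_eventually_good ν hb (dirChain n 0 (⟨0, hd⟩ : Fin d) true)
  filter_upwards [hatt, hchain, ae_le_weight (d := d) ν hν] with ω hatt hchain hweight
  constructor
  · obtain ⟨j, hj⟩ := hchain.exists_forall_of_atTop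
    have hy := dirChain_isTile (d := d) hn 0 ⟨0, hd⟩ true
    set y := dirChain n 0 (⟨0, hd⟩ : Fin d) true with hydef
    have hinf := chainVerts_infinite hn hw hj
    obtain ⟨v, hv⟩ := hinf.nonempty
    refine ⟨(openGraph α lam ω).connectedComponentMk v, hinf.mono fun u hu => ?_⟩
    rw [SimpleGraph.ConnectedComponent.mem_supp_iff, SimpleGraph.ConnectedComponent.eq]
    exact reachable_chainVerts hn hw hy hj hu hv
  · intro C hC
    obtain ⟨x, rfl⟩ := C.exists_rep
    have hinf : {z | (openGraph α lam ω).Reachable x z}.Infinite := by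
      refine hC.mono fun z hz => ?_
      exact (SimpleGraph.ConnectedComponent.exact hz).symm
    have hmem := hatt x hinf
    simp only [attachEvent, Set.mem_iUnion] at hmem
    obtain ⟨z, i, b, hxz, hgood, hmarks⟩ := hmem
    have hg : ∀ k ≥ 0, Good n w ω.1 (openGraph α lam ω) k (dirChain n z i b k) :=
      fun k _ => hgood k
    have hy := dirChain_isTile hn z i b
    refine ⟨_, ?_, isInfiniteHCTree_chain hn h2 hρ hK hw hy hg⟩
    intro v hv
    have hu := hub_mem (W := ω.1) hn 0 (dirChain n z i b 0)
    set u := hub n ω.1 0 (dirChain n z i b 0) with hudef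
    have hne : z ≠ u := by
      intro h
      exact notMem_halfSpace z i b (h ▸ box_dirChain_subset n z i b 0 hu)
    -- The fresh event controls marks only, so as not to involve the already revealed weight of `z`.
    -- The almost sure lower bound `a` on the weights turns a mark below `p` into an open edge.
    -- Since the hub `u` of the first box is random, all edges from `z` to that box were required to
    -- have small marks.
    have hadj : (openGraph α lam ω).Adj z u :=
      ⟨hne, (hmarks u hu).trans_le (le_edgeProb hα hlam ha.le ha.le hne
        (l1Dist_le_of_mem_dirChain z i b hu) (hweight z) (hweight u))⟩
    have huv := reachable_chainVerts hn hw hy hg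
      (show u ∈ chainVerts n w ω.1 (openGraph α lam ω) (dirChain n z i b) 0 from
        ⟨0, le_rfl, hub_mem_treeVerts _ _⟩) hv
    exact (SimpleGraph.ConnectedComponent.sound ((hxz.trans hadj.reachable).trans huv)).symm

end SFP

theorem theorem2p4 (d : ℕ) (hd : 1 ≤ d) (α τ lam c : ℝ) (hα : 0 < α) (hτ : 1 < τ)
    (hlam : 0 < lam) (hc : 0 < c)
    (hγ1 : 1 < α * (τ - 1) / d) (hγ2 : α * (τ - 1) / d < 2)
    (ν : MeasureTheory.Measure ℝ) [MeasureTheory.IsProbabilityMeasure ν]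
    (hν : ∀ w : ℝ, 0 < w → min (c * w ^ (-(τ - 1))) 1 ≤ ν.real (Set.Ici w)) :
    ∃ (ξ ρ K : ℝ) (m₀ : ℕ), 0 < ξ ∧ 0 < ρ ∧ ρ ≤ 1 ∧ 0 < K ∧ 0 < m₀ ∧
      (∀ m : ℕ, m₀ ≤ m →
        1 - Real.exp (-(ρ * (m : ℝ) ^ ξ)) ≤
          (SFP.law d ν).real {ω | ∃ T : (SFP.openGraph α lam ω).Subgraph,
            SFP.IsHCTree ω.1 ρ K 0 m T}) ∧
      (∀ᵐ ω ∂(SFP.law d ν),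
        (∃ C : (SFP.openGraph α lam ω).ConnectedComponent, C.supp.Infinite) ∧
        ∀ C : (SFP.openGraph α lam ω).ConnectedComponent, C.supp.Infinite →
          ∃ T : (SFP.openGraph α lam ω).Subgraph,
            T.verts ⊆ C.supp ∧ SFP.IsInfiniteHCTree ω.1 ρ K T) := by
  have hd0 : (0 : ℝ) < d := by exact_mod_cast hd
  have hτ0 : 0 < τ - 1 := by linarith
  obtain ⟨β, hβ1, hβ2⟩ : ∃ β, α / 2 < β ∧ β < d / (τ - 1) := by
    refine exists_between ?_
    rw [div_lt_iff₀ hd0] at hγ2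
    rw [div_lt_div_iff₀ two_pos hτ0]
    linarith
  rw [lt_div_iff₀ hτ0] at hβ2
  have hκ : 1 < 2 * β / α := by
    rw [lt_div_iff₀ hα]; linarith
  -- The square root leaves room for two consecutive steps of the scales to be merged into one.
  set θ := Real.sqrt (2 * β / α) with hθdef
  have hθ : 1 < θ := by
    rw [hθdef, Real.lt_sqrt zero_le_one]
    linarith
  have hθκ : θ ^ 2 = 2 * β / α := Real.sq_sqrt (by linarith)
  have hη : 0 < (θ - 1) / 2 := by linarith
  obtain ⟨ξ, hξ, m, hm⟩ := SFP.exists_measureReal_not_good_le hd hα hτ hlam hc hβ1 hβ2 hη ν hν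
  obtain ⟨n, hn0, hn, hscale⟩ := SFP.exists_scales hθ (max m 3)
  have hn3 : 3 ≤ n 0 := (le_max_right _ _).trans hn0
  have hnm : m ≤ n 0 := (le_max_left _ _).trans hn0
  have hn0pos : (0 : ℝ) < n 0 := by exact_mod_cast hn 0
  have hlogη : 0 < Real.log (1 + (θ - 1) / 2) := Real.log_pos (by linarith)
  have hbase : ∀ k, (2 : ℝ) ^ (k + 3) ≤ (SFP.len n k : ℝ) ^ ξ ∧ ∀ x : Fin d → ℤ,
      (SFP.law d ν).real {ω | ¬ SFP.Good n (SFP.thr n β) ω.1 (SFP.openGraph α lam ω) k x} ≤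
        Real.exp (-(SFP.len n k : ℝ) ^ ξ) := fun k =>
    hm n hn hnm k fun j _ => ⟨(hscale j).1, (hscale j).2.trans
      (Real.rpow_le_rpow_of_exponent_le (by exact_mod_cast SFP.len_pos hn j)
        (by rw [← hθκ]; nlinarith))⟩
  -- Both factors of `2` compensate for the side of the adapted box being possibly only about half
  -- of `m`: one in the density, the other in the probability bound.
  set ρ : ℝ := min (1 / 2 / (2 * (n 0 : ℝ)) ^ d) (1 / 2 ^ ξ) with hρ
  have hρ0 : 0 < ρ := by
    have : (0 : ℝ) < 2 ^ ξ := Real.rpow_pos_of_pos two_pos ξ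
    exact lt_min (by positivity) (by positivity)
  have hρ1 : ρ ≤ 1 := by
    refine (min_le_right _ _).trans ?_
    rw [div_le_one (Real.rpow_pos_of_pos two_pos ξ)]
    exact Real.one_le_rpow one_le_two hξ.le
  refine ⟨ξ, ρ, 2 / Real.log (1 + (θ - 1) / 2), SFP.len n 1, hξ, hρ0, hρ1, by positivity,
    SFP.len_pos hn 1, fun l hl => ?_, ?_⟩
  · exact SFP.one_sub_exp_le_measureReal_hcTree hθ hθκ.le hξ ν
      (fun n hn hnm k h => (hm n hn hnm k h).2) hn hnm hn3 hscale
      (min_le_left _ _) (min_le_right _ _) hl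
  -- At this value `c * w ^ (-(τ - 1))` equals `1`, so the tail bound makes it an almost sure lower
  -- bound for the weights.
  · have ha : (0 : ℝ) < c ^ (1 / (τ - 1)) := Real.rpow_pos_of_pos hc _
    refine SFP.ae_infinite_hcTree hd hα hlam ha ν ?_ hn (w := SFP.thr n β) (by omega) ?_ ?_ ?_ ?_
    · have h1 := hν _ ha
      rwa [← Real.rpow_mul hc.le, mul_neg, one_div_mul_cancel hτ0.ne', Real.rpow_neg_one,
        mul_inv_cancel₀ hc.ne', min_self] at h1
    · have h1 : Filter.Tendsto (fun k => (SFP.len n k : ℝ) ^ ξ) Filter.atTop Filter.atTop := by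
        refine Filter.tendsto_atTop_mono (fun k => (hbase k).1) ?_
        exact (tendsto_pow_atTop_atTop_of_one_lt one_lt_two).comp (Filter.tendsto_add_atTop_nat 3)
      have hβ0 : 0 < β := by linarith
      -- The threshold `len n k ^ β` is written as the power `β / ξ` of `len n k ^ ξ`, which is
      -- already known to dominate `2 ^ (k + 3)`.
      have h2 := (tendsto_rpow_atTop (y := β / ξ) (by positivity)).comp h1
      refine h2.congr fun k => ?_
      simp only [Function.comp_apply, SFP.thr]
      rw [← Real.rpow_mul (by positivity), mul_div_cancel₀ _ hξ.ne']
    · refine (min_le_left _ _).trans ?_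
      gcongr
      linarith
    · intro j
      have h1 := SFP.mul_log_le_log_log_len hη hn3 j fun i _ => (hscale i).1
      calc 2 * (j : ℝ) = 2 / Real.log (1 + (θ - 1) / 2) * (j * Real.log (1 + (θ - 1) / 2)) := by
            rw [div_mul_eq_mul_div, eq_div_iff hlogη.ne']; ring
        _ ≤ _ := by
            gcongr
            exact h1.trans (le_max_right _ _)
    · intro k x
      obtain ⟨h1, h2⟩ := hbase k
      refine (h2 x).trans ?_
      have h3 : Real.exp (-(SFP.len n k : ℝ) ^ ξ) ≤ Real.exp (-2 ^ (k + 3)) := by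
        rw [Real.exp_le_exp]; linarith
      refine h3.trans ?_
      have h4 : (2 : ℝ) ^ (k + 2) ≤ Real.exp (2 ^ (k + 3)) := by
        have h5 := Real.add_one_le_exp ((2 : ℝ) ^ (k + 3))
        have h6 : (2 : ℝ) ^ (k + 2) ≤ 2 ^ (k + 3) := pow_le_pow_right₀ one_le_two (by omega)
        linarith
      rw [Real.exp_neg, one_div, inv_pow]
      exact inv_anti₀ (by positivity) h4
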